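/- **Setting.** Write $\|\cdot\|$ for the Euclidean norm on $\mathbb R^d$, $B_r=\{x\in\mathbb R^d:\|x\|\le r\}$ and $B_r^c$ for its complement, $\overline{\mathbb R^d}$ for the compactification of $\mathbb R^d$ by a sphere of infinite radius, and $\stackrel{v}{\to}$ for vague convergence of measures (convergence of integrals of continuous compactly supported functions). For real sequences, $u_n\ll v_n$ means $u_n/v_n\to0$. Let $H$ be an $\mathbb R^d$-valued random vector for which there are a sequence $a_n\to\infty$ and a non-null measure $\mu$ on $\mathbb R^d\setminus\{0\}$, extended by $0$ to a Radon measure on $\overline{\mathbb R^d}\setminus\{0\}$, with $$nP(a_n^{-1}H\in\cdot)\stackrel{v}{\longrightarrow}\mu(\cdot)\quad\text{on }\overline{\mathbb R^d}\setminus\{0\}.$$ Let $H_1,H_2,\dots$ be i.i.d. copies of $H$, let $L_1,L_2,\dots$ be i.i.d. $[0,\infty)$-valued random variables, the two families being independent of each other, and let $M_n>0$ with $M_n\to\infty$. Put $$X_{nj}=H_j\mathbf 1(\|H_j\|\le M_n)+\frac{H_j}{\|H_j\|}(M_n+L_j)\mathbf 1(\|H_j\|>M_n),\qquad S_n=\sum_{j=1}^nX_{nj},$$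 and assume soft truncation: $nP(\|H\|>M_n)\to0$. **Theorem 2.1.** There is a unique $\alpha>0$ such that $\mu(cA)=c^{-\alpha}\mu(A)$ for all Borel $A\subset\mathbb R^d\setminus\{0\}$ and $c>0$. For this $\alpha$ assume further: * if $\alpha=1$, then $H$ has a symmetric distribution; if $\alpha>1$, then $E(H)=0$; * if $\alpha=2$, then $\gamma>0$ is a number such that $M_n/\sqrt{n^{1+\gamma}}\to\infty$; * if $\alpha>2$, then $M_n/\sqrt{n\log M_n}\to\infty$. Let $$b_n=\begin{cases}\inf\{x:P(\|H\|>x)\le n^{-1}\},&\alpha<2,\\ \sqrt{n^{1+\gamma}},&\alpha=2,\\ \sqrt{n\log n},&\alpha>2.\end{cases}$$ If $\lambda_n$ is any sequence of positive numbers with $b_n\ll\lambda_n\ll M_n$, then, as $n\to\infty$, $$\frac{P(\lambda_n^{-1}S_n\in\cdot)}{nP(\|H\|>\lambda_n)}\stackrel{v}{\longrightarrow}\frac{\mu(\cdot)}{\mu(B_1^c)}\quad\text{on }\overline{\mathbb R^d}\setminus\{0\}.$$ -/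

import Mathlib

open MeasureTheory ProbabilityTheory Filter Topology
open scoped ENNReal CompactlySupported Pointwise

noncomputable section

namespace TruncLD

/-- `ℝ^d` with its Euclidean norm. -/
abbrev E (d : ℕ) : Type := EuclideanSpace ℝ (Fin d)

/-- The compactification of `ℝ^d` by a sphere of infinite radius, realized as the closed unit
ball; a point of `ℝ^d` sits in it through `embed`, and the unit sphere is the part at infinity. -/
abbrev ExtSpace (d : ℕ) : Type := Metric.closedBall (0 : E d) 1

/-- The radial homeomorphism `x ↦ x / (1 + ‖x‖)` of `ℝ^d` onto the open unit ball, as a map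
into the compactification. -/
def embed {d : ℕ} (x : E d) : ExtSpace d :=
  ⟨(1 + ‖x‖)⁻¹ • x, by
    have h : 0 < 1 + ‖x‖ := by positivity
    rw [mem_closedBall_zero_iff, norm_smul, norm_inv, Real.norm_of_nonneg h.le,
      inv_mul_le_iff₀ h]
    linarith⟩

/-- The compactified space with the origin removed. -/
abbrev PuncturedExt (d : ℕ) : Type := {z : ExtSpace d // z ≠ embed 0}

/-- A measure on `ℝ^d`, viewed as a measure on the punctured compactification: the mass at the
origin is discarded and no mass is put at infinity. -/
def toExt {d : ℕ} (ν : Measure (E d)) : Measure (PuncturedExt d) :=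
  (ν.map embed).comap Subtype.val

/-- Vague convergence of measures: convergence of the integrals of all continuous functions
with compact support. -/
def VagueTendsto {X : Type*} [TopologicalSpace X] [MeasurableSpace X]
    (ν : ℕ → Measure X) (ν' : Measure X) : Prop :=
  ∀ f : C_c(X, ℝ), Tendsto (fun n => ∫ x, f x ∂(ν n)) atTop (𝓝 (∫ x, f x ∂ν'))

/-- `α > 0` is the index of `μ`: `μ(cA) = c^{-α} μ(A)` for all Borel sets `A` and all `c > 0`. -/
def IsIndex {d : ℕ} (μ : Measure (E d)) (α : ℝ) : Prop :=
  0 < α ∧ ∀ (A : Set (E d)) (c : ℝ), MeasurableSet A → 0 < c →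
    μ (c • A) = ENNReal.ofReal (c ^ (-α)) * μ A

/-- `u ≪ v`, that is, `u_n / v_n → 0`. -/
def MuchLess (u v : ℕ → ℝ) : Prop :=
  Tendsto (fun n => u n / v n) atTop (𝓝 0)

/-- The vector `h` truncated at level `m`, with the modification `l` beyond that level. -/
def truncate {d : ℕ} (m : ℝ) (h : E d) (l : ℝ) : E d :=
  if ‖h‖ ≤ m then h else (m + l) • (‖h‖⁻¹ • h)

/-- The `n`-th row sum of the triangular array; the summands are numbered from `0`. -/
def rowSum {Ω : Type*} {d : ℕ} (M : ℕ → ℝ) (H : ℕ → Ω → E d) (L : ℕ → Ω → ℝ)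
    (n : ℕ) (ω : Ω) : E d :=
  ∑ j ∈ Finset.range n, truncate (M n) (H j ω) (L j ω)

/-- The reference sequence `b_n`. -/
def bSeq {Ω : Type*} [MeasurableSpace Ω] {d : ℕ} (P : Measure Ω) (H : Ω → E d) (α γ : ℝ)
    (n : ℕ) : ℝ :=
  if α < 2 then sInf {x : ℝ | P.real {ω | x < ‖H ω‖} ≤ (n : ℝ)⁻¹}
  else if α = 2 then √((n : ℝ) ^ (1 + γ))
  else √((n : ℝ) * Real.log n)

end TruncLD

end

/-! ### Compactification, test functions and vague convergence. -/

namespace TruncLD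

variable {d : ℕ}

/-! The result is a one-big-jump principle. On a scale $\lambda_n\gg b_n$ the sum leaves a
neighbourhood of the origin essentially only when a single summand does, so for a test function $g$
vanishing near $0$ one has $E\,g(S_n/\lambda_n)\approx nE\,g(H/\lambda_n)$. Regular variation turns
the right side, divided by $nP(\|H\|>\lambda_n)$, into $\int g\,d\mu/\mu(B_1^c)$. Truncation acts
only if some $\|H_j\|>M_n$, which has probability at most $nP(\|H\|>M_n)=o(nP(\|H\|>\lambda_n))$
because $\lambda_n\ll M_n$.

Vague convergence on the punctured compactification is first rewritten as convergence of integrals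
of test functions on $\mathbb R^d$ (`vagueTendsto_toExt_iff`). The hypothesis concerns one scaling
sequence $a_n$. Comparing $a_{\lfloor ns\rfloor}$ with $a_n$ shows that $\mu$ is multiplied by
$s^{-1}$ under some dilation $c(s)$; this $c$ is increasing and multiplicative, hence a power, which
gives homogeneity of $\mu$ (`exists_scales`). Inverting the sequence then gives regular variation
along all real $t\to\infty$ (`RegVarAlong.regVar`), from which the bounds of Potter and Karamata
follow by dyadic iteration.

The probabilistic core is `LDScale.small_sum`: the sum of the vectors of norm at most
$\delta\lambda_n$ exceeds $\rho\lambda_n$ with probability $o(w_n)$, where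
$w_n=nP(\|H\|>\lambda_n)$. This is a Chernoff bound with tilt of order $-\log w_n/\lambda_n$. It
needs truncated means and variances to be negligible in the sense of `LDScale`. Two large summands
have probability $O(w_n^2)$. What is left is a deterministic comparison (`abs_sub_sum_le`).

The three definitions of $b_n$ enter only in checking `LDScale`: Karamata's theorem for $\alpha<2$,
a small power to spare for $\alpha=2$, and finite variance for $\alpha>2$. Symmetry or centring
controls the truncated means when $\alpha\ge1$. -/

lemma norm_embed (x : E d) : ‖(embed x : E d)‖ = ‖x‖ / (1 + ‖x‖) := by
  have h : 0 < 1 + ‖x‖ := by positivity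
  simp only [embed]
  rw [norm_smul, norm_inv, Real.norm_of_nonneg h.le]
  field_simp

lemma continuous_embed : Continuous (embed : E d → ExtSpace d) := by
  refine Continuous.subtype_mk ?_ _
  refine Continuous.smul (Continuous.inv₀ (continuous_const.add continuous_norm) fun x => ?_) continuous_id
  exact (by positivity : 0 < 1 + ‖x‖).ne'

lemma embed_zero_coe : ((embed (0 : E d)) : E d) = 0 := by simp [embed]

lemma ne_embed_zero_iff (z : ExtSpace d) : z ≠ embed 0 ↔ (z : E d) ≠ 0 := by
  rw [Ne, Subtype.ext_iff, embed_zero_coe]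

/-- The inverse of `embed` on the open ball. -/
noncomputable def unembed (z : E d) : E d := (1 - ‖z‖)⁻¹ • z

lemma unembed_embed (x : E d) : unembed (embed x : E d) = x := by
  have h : 0 < 1 + ‖x‖ := by positivity
  unfold unembed
  rw [norm_embed]
  simp only [embed, smul_smul]
  have : (1 - ‖x‖ / (1 + ‖x‖))⁻¹ * (1 + ‖x‖)⁻¹ = 1 := by
    rw [← mul_inv, inv_eq_one]; field_simp; ring
  rw [this, one_smul]

lemma embed_injective : Function.Injective (embed : E d → ExtSpace d) := fun x y h => by
  rw [← unembed_embed x, h, unembed_embed]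

/-- The test functions on `ℝ^d`: those extending continuously to the compactification and
vanishing near the origin. -/
def IsTest (g : E d → ℝ) : Prop :=
  ∃ F : ExtSpace d → ℝ, Continuous F ∧ (∃ r > 0, ∀ z : ExtSpace d, ‖(z : E d)‖ < r → F z = 0) ∧
    ∀ x, g x = F (embed x)

-- The support is compact in the punctured space, so its image is closed in the compactification and
-- misses the origin. Extension by zero is therefore continuous there too.
open Classical in
lemma exists_extension (f : C_c(PuncturedExt d, ℝ)) :
    ∃ F : ExtSpace d → ℝ, Continuous F ∧
      (∃ r > 0, ∀ z : ExtSpace d, ‖(z : E d)‖ < r → F z = 0) ∧ ∀ z : PuncturedExt d, F z.1 = f z := by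
  let F : ExtSpace d → ℝ := fun z => if h : z ≠ embed 0 then f ⟨z, h⟩ else 0
  have hF : ∀ z : PuncturedExt d, F z.1 = f z := fun z => by simp [F, z.2]
  have hK : IsCompact ((Subtype.val : PuncturedExt d → ExtSpace d) '' tsupport f) :=
    f.hasCompactSupport.isCompact.image continuous_subtype_val
  set K := (Subtype.val : PuncturedExt d → ExtSpace d) '' tsupport f with hKdef
  have hFK : ∀ z ∉ K, F z = 0 := by
    intro z hz
    by_cases h : z ≠ embed 0
    · simp only [F, h, dite_true, ne_eq, not_false_eq_true]
      by_contra h0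
      exact hz ⟨⟨z, h⟩, subset_tsupport _ h0, rfl⟩
    · simp only [F, h, dite_false]
  have h0 : embed 0 ∉ K := by
    rintro ⟨z, -, hz⟩
    exact z.2 hz
  refine ⟨F, ?_, ?_, hF⟩
  · rw [continuous_iff_continuousAt]
    intro z
    by_cases hz : z ≠ embed 0
    · have hop : IsOpen {z : ExtSpace d | z ≠ embed 0} := isOpen_ne
      have := hop.isOpenEmbedding_subtypeVal.continuousAt_iff (g := F) (x := (⟨z, hz⟩ : PuncturedExt d))
      refine this.1 ?_
      have h2 : F ∘ (Subtype.val : PuncturedExt d → ExtSpace d) = f := funext fun z => hF z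
      change ContinuousAt (F ∘ (Subtype.val : PuncturedExt d → ExtSpace d)) _
      rw [h2]
      exact f.continuous.continuousAt
    · have : F =ᶠ[𝓝 z] fun _ => 0 := by
        push Not at hz
        rw [hz]
        filter_upwards [hK.isClosed.isOpen_compl.mem_nhds h0] with w hw
        exact hFK w hw
      exact (continuousAt_const).congr this.symm
  · obtain ⟨r, hr, hb⟩ := Metric.isOpen_iff.1 hK.isClosed.isOpen_compl _ h0
    refine ⟨r, hr, fun z hz => hFK z (hb ?_)⟩
    rw [Metric.mem_ball, Subtype.dist_eq, embed_zero_coe, dist_zero_right]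
    exact hz

/-- A continuous function vanishing near the origin, restricted to the punctured space. -/
noncomputable def restrictCc (F : ExtSpace d → ℝ) (hF : Continuous F)
    (hr : ∃ r > 0, ∀ z : ExtSpace d, ‖(z : E d)‖ < r → F z = 0) : C_c(PuncturedExt d, ℝ) where
  toFun z := F z.1
  continuous_toFun := hF.comp continuous_subtype_val
  hasCompactSupport' := by
    obtain ⟨r, hr, h⟩ := hr
    have hC : IsCompact {z : ExtSpace d | r ≤ ‖(z : E d)‖} :=
      (isClosed_le continuous_const (by fun_prop)).isCompact
    have hS : {z : ExtSpace d | r ≤ ‖(z : E d)‖} ⊆ Set.range (Subtype.val : PuncturedExt d → _) := by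
      intro z hz
      refine ⟨⟨z, (ne_embed_zero_iff z).2 fun h0 => ?_⟩, rfl⟩
      simp only [Set.mem_ofPred_eq, h0, norm_zero] at hz
      linarith
    have hcpt : IsCompact ((Subtype.val : PuncturedExt d → ExtSpace d) ⁻¹'
        {z : ExtSpace d | r ≤ ‖(z : E d)‖}) :=
      (Topology.IsInducing.subtypeVal).isCompact_preimage_iff hS |>.2 hC
    refine HasCompactSupport.of_support_subset_isCompact hcpt ?_
    intro z hz
    by_contra hlt
    exact hz (h _ (not_le.1 hlt))

lemma integral_toExt (ν : Measure (E d)) (F : ExtSpace d → ℝ) (hF : Continuous F)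
    (h0 : F (embed 0) = 0) :
    ∫ z : PuncturedExt d, F z.1 ∂(toExt ν) = ∫ x, F (embed x) ∂ν := by
  have hm : MeasurableSet {z : ExtSpace d | z ≠ embed 0} := isOpen_ne.measurableSet
  rw [toExt]
  have := integral_subtype_comap (μ := ν.map embed) hm F
  refine this.trans ?_
  rw [setIntegral_eq_integral_of_forall_compl_eq_zero, integral_map]
  · exact continuous_embed.aemeasurable
  · exact hF.aestronglyMeasurable
  · intro z hz
    simp only [ne_eq, Set.mem_ofPred_eq, not_not] at hz
    rw [hz, h0]

lemma IsTest.exists_cc {g : E d → ℝ} (hg : IsTest g) :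
    ∃ f : C_c(PuncturedExt d, ℝ), ∀ ν : Measure (E d), ∫ z, f z ∂(toExt ν) = ∫ x, g x ∂ν := by
  obtain ⟨F, h1, h2, h3⟩ := hg
  refine ⟨restrictCc F h1 h2, fun ν => ?_⟩
  obtain ⟨r, hr, h⟩ := h2
  have h0 : F (embed 0) = 0 := h _ (by rw [embed_zero_coe, norm_zero]; exact hr)
  rw [funext h3]
  exact integral_toExt ν F h1 h0

lemma exists_test_of_cc (f : C_c(PuncturedExt d, ℝ)) :
    ∃ g : E d → ℝ, IsTest g ∧ ∀ ν : Measure (E d), ∫ z, f z ∂(toExt ν) = ∫ x, g x ∂ν := by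
  obtain ⟨F, h1, h2, h3⟩ := exists_extension f
  refine ⟨fun x => F (embed x), ⟨F, h1, h2, fun _ => rfl⟩, fun ν => ?_⟩
  obtain ⟨r, hr, h⟩ := h2
  have h0 : F (embed 0) = 0 := h _ (by rw [embed_zero_coe, norm_zero]; exact hr)
  rw [← integral_toExt ν F h1 h0]
  exact integral_congr_ae (ae_of_all _ fun z => (h3 z).symm)

/-- From here on the compactification enters only through the class of test functions on $\mathbb
R^d$. -/
lemma vagueTendsto_toExt_iff (ν : ℕ → Measure (E d)) (ν' : Measure (E d)) :
    VagueTendsto (fun n => toExt (ν n)) (toExt ν') ↔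
      ∀ g, IsTest g → Tendsto (fun n => ∫ x, g x ∂(ν n)) atTop (𝓝 (∫ x, g x ∂ν')) := by
  constructor
  · intro h g hg
    obtain ⟨f, hf⟩ := hg.exists_cc
    simpa only [hf] using h f
  · intro h f
    obtain ⟨g, hg, hgf⟩ := exists_test_of_cc f
    simpa only [hgf] using h g hg

lemma IsTest.continuous {g : E d → ℝ} (hg : IsTest g) : Continuous g := by
  obtain ⟨F, h1, -, h3⟩ := hg
  rw [funext h3]
  exact h1.comp continuous_embed

lemma IsTest.bounded {g : E d → ℝ} (hg : IsTest g) : ∃ C, 0 < C ∧ ∀ x, |g x| ≤ C := by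
  obtain ⟨F, h1, -, h3⟩ := hg
  obtain ⟨C, hC⟩ := isCompact_univ.exists_bound_of_continuousOn h1.continuousOn
  exact ⟨max C 1, by positivity, fun x => by
    rw [h3]; exact (hC _ (Set.mem_univ _)).trans (le_max_left _ _)⟩

lemma IsTest.vanish {g : E d → ℝ} (hg : IsTest g) :
    ∃ r > 0, ∀ x, ‖x‖ ≤ r → g x = 0 := by
  obtain ⟨F, -, ⟨r, hr, h⟩, h3⟩ := hg
  refine ⟨r / 2, by positivity, fun x hx => ?_⟩
  rw [h3]
  apply h
  rw [norm_embed, div_lt_iff₀ (by positivity)]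
  nlinarith [norm_nonneg x]

lemma dist_embed_le (x y : E d) : dist (embed x) (embed y) ≤ 2 * ‖x - y‖ := by
  have hx : 0 < 1 + ‖x‖ := by positivity
  have hy : 0 < 1 + ‖y‖ := by positivity
  rw [Subtype.dist_eq, dist_eq_norm]
  simp only [embed]
  have e : (1 + ‖x‖)⁻¹ • x - (1 + ‖y‖)⁻¹ • y
      = (1 + ‖x‖)⁻¹ • (x - y) + ((1 + ‖x‖)⁻¹ - (1 + ‖y‖)⁻¹) • y := by
    rw [smul_sub, sub_smul]; abel
  rw [e]
  refine (norm_add_le _ _).trans ?_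
  rw [norm_smul, norm_smul, norm_inv, Real.norm_of_nonneg hx.le, Real.norm_eq_abs]
  have h1 : (1 + ‖x‖)⁻¹ ≤ 1 := inv_le_one_of_one_le₀ (by linarith [norm_nonneg x])
  have h2 : |(1 + ‖x‖)⁻¹ - (1 + ‖y‖)⁻¹| * ‖y‖ ≤ ‖x - y‖ := by
    rw [inv_sub_inv hx.ne' hy.ne', abs_div, abs_of_pos (mul_pos hx hy), div_mul_eq_mul_div,
      div_le_iff₀ (mul_pos hx hy)]
    have h3 : |1 + ‖y‖ - (1 + ‖x‖)| ≤ ‖x - y‖ := by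
      rw [add_sub_add_left_eq_sub, norm_sub_rev]; exact abs_norm_sub_norm_le _ _
    have h4 : ‖y‖ ≤ (1 + ‖x‖) * (1 + ‖y‖) := by nlinarith [norm_nonneg x, norm_nonneg y]
    exact mul_le_mul h3 h4 (norm_nonneg _) (norm_nonneg _)
  nlinarith [norm_nonneg (x - y)]

lemma IsTest.uniform {g : E d → ℝ} (hg : IsTest g) {η : ℝ} (hη : 0 < η) :
    ∃ ρ > 0, ∀ x y, ‖x - y‖ ≤ ρ → |g x - g y| ≤ η := by
  obtain ⟨F, h1, -, h3⟩ := hg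
  obtain ⟨δ, hδ, h⟩ := Metric.uniformContinuous_iff.1
    (CompactSpace.uniformContinuous_of_continuous h1) η hη
  refine ⟨δ / 4, by positivity, fun x y hxy => ?_⟩
  rw [h3, h3]
  have := h (a := embed x) (b := embed y) (by linarith [dist_embed_le x y])
  rw [Real.dist_eq] at this
  exact this.le

lemma dist_embed_smul_le (x : E d) {b : ℝ} (hb : 0 < b) :
    dist (embed (b • x)) (embed x) ≤ |b - 1| := by
  have hx : 0 < 1 + ‖x‖ := by positivity
  have hy : 0 < 1 + b * ‖x‖ := by positivity
  rw [Subtype.dist_eq, dist_eq_norm]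
  simp only [embed]
  rw [smul_smul, ← sub_smul, norm_smul, norm_smul, Real.norm_of_nonneg hb.le, Real.norm_eq_abs]
  have : (1 + b * ‖x‖)⁻¹ * b - (1 + ‖x‖)⁻¹ = (b - 1) / ((1 + b * ‖x‖) * (1 + ‖x‖)) := by
    field_simp; ring
  rw [this, abs_div, abs_of_pos (mul_pos hy hx), div_mul_eq_mul_div, div_le_iff₀ (mul_pos hy hx)]
  apply mul_le_mul_of_nonneg_left _ (abs_nonneg _)
  have := mul_nonneg hb.le (norm_nonneg x)
  nlinarith [norm_nonneg x]

/-- A dilation with factor near $1$ moves every point of the compactification by little, uniformly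
up to infinity, although $\|bx-x\|$ is unbounded. Uniform continuity on the compact space does the
rest. -/
lemma IsTest.uniform_smul {g : E d → ℝ} (hg : IsTest g) {η : ℝ} (hη : 0 < η) :
    ∃ ρ > 0, ∀ b : ℝ, 0 < b → |b - 1| ≤ ρ → ∀ x, |g (b • x) - g x| ≤ η := by
  obtain ⟨F, h1, -, h3⟩ := hg
  obtain ⟨δ, hδ, h⟩ := Metric.uniformContinuous_iff.1
    (CompactSpace.uniformContinuous_of_continuous h1) η hη
  refine ⟨δ / 2, by positivity, fun b hb hbρ x => ?_⟩
  rw [h3, h3]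
  have := h (a := embed (b • x)) (b := embed x) (by linarith [dist_embed_smul_le x hb])
  rw [Real.dist_eq] at this
  exact this.le

lemma dil_den_pos {c : ℝ} (hc : 0 < c) (z : ExtSpace d) :
    0 < (1 - ‖(z : E d)‖) + c * ‖(z : E d)‖ := by
  have hz : ‖(z : E d)‖ ≤ 1 := mem_closedBall_zero_iff.1 z.2
  rcases hz.lt_or_eq with h | h
  · have := mul_nonneg hc.le (norm_nonneg (z : E d)); linarith
  · rw [h]; linarith

/-- The extension of the dilation `x ↦ c x` to the compactification. -/
noncomputable def dil {c : ℝ} (hc : 0 < c) (z : ExtSpace d) : ExtSpace d :=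
  ⟨(c / ((1 - ‖(z : E d)‖) + c * ‖(z : E d)‖)) • (z : E d), by
    have h := dil_den_pos hc z
    have hz : ‖(z : E d)‖ ≤ 1 := mem_closedBall_zero_iff.1 z.2
    rw [mem_closedBall_zero_iff, norm_smul, Real.norm_of_nonneg (div_pos hc h).le,
      div_mul_eq_mul_div, div_le_one h]
    linarith⟩

lemma continuous_dil {c : ℝ} (hc : 0 < c) : Continuous (dil hc : ExtSpace d → ExtSpace d) := by
  refine Continuous.subtype_mk ?_ _
  have hn : Continuous fun z : ExtSpace d => ‖(z : E d)‖ := continuous_norm.comp continuous_subtype_val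
  refine Continuous.smul (Continuous.div continuous_const
    ((continuous_const.sub hn).add (continuous_const.mul hn)) fun z => ?_)
    continuous_subtype_val
  exact (dil_den_pos hc z).ne'

lemma dil_embed {c : ℝ} (hc : 0 < c) (x : E d) : dil hc (embed x) = embed (c • x) := by
  apply Subtype.ext
  have hx : 0 < 1 + ‖x‖ := by positivity
  have hy : 0 < 1 + c * ‖x‖ := by positivity
  simp only [dil, norm_embed]
  simp only [embed, smul_smul, norm_smul, Real.norm_of_nonneg hc.le]
  congr 1
  have : 1 - ‖x‖ / (1 + ‖x‖) + c * (‖x‖ / (1 + ‖x‖)) = (1 + c * ‖x‖) / (1 + ‖x‖) := by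
    field_simp; ring
  rw [this]
  field_simp

/-- Dilations extend continuously to the compactification and fix the origin, so a neighbourhood of
the origin pulls back to one. -/
lemma IsTest.smul {g : E d → ℝ} (hg : IsTest g) {c : ℝ} (hc : 0 < c) :
    IsTest fun x => g (c • x) := by
  obtain ⟨F, h1, ⟨r, hr, h2⟩, h3⟩ := hg
  refine ⟨F ∘ dil hc, h1.comp (continuous_dil hc), ?_, fun x => by
    simp only [Function.comp, dil_embed, h3]⟩
  have : {z : ExtSpace d | ‖(dil hc z : E d)‖ < r} ∈ 𝓝 (embed 0) := by
    apply IsOpen.mem_nhds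
    · exact isOpen_lt (continuous_norm.comp (continuous_subtype_val.comp (continuous_dil hc)))
        continuous_const
    · simp only [Set.mem_ofPred_eq, dil_embed, smul_zero, embed_zero_coe, norm_zero, hr]
  obtain ⟨s, hs, hb⟩ := Metric.mem_nhds_iff.1 this
  refine ⟨s, hs, fun z hz => h2 _ (hb ?_)⟩
  rw [Metric.mem_ball, Subtype.dist_eq, embed_zero_coe, dist_zero_right]
  exact hz

/-- A radial function of the compactification, vanishing for `‖z‖ ≤ u`. -/
lemma isTest_radial {φ : ℝ → ℝ} (hφ : Continuous φ) {u : ℝ} (hu : 0 < u)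
    (h : ∀ s, s ≤ u → φ s = 0) : IsTest fun x : E d => φ (‖x‖ / (1 + ‖x‖)) :=
  ⟨fun z => φ ‖(z : E d)‖, by fun_prop, ⟨u, hu, fun z hz => h _ hz.le⟩, fun x => by
    simp only [norm_embed]⟩

lemma toExt_apply (ν : Measure (E d)) (K : Set (PuncturedExt d)) :
    toExt ν K = ν.map embed (Subtype.val '' K) := by
  have hm : MeasurableSet {z : ExtSpace d | z ≠ embed 0} := isOpen_ne.measurableSet
  exact (MeasurableEmbedding.subtype_coe hm).comap_apply _ K

lemma toExt_isFiniteMeasureOnCompacts_tail {ν : Measure (E d)}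
    [IsFiniteMeasureOnCompacts (toExt ν)] {r : ℝ} (hr : 0 < r) : ν {x | r ≤ ‖x‖} < ∞ := by
  set s := r / (1 + r)
  have hs : 0 < s := by positivity
  have hC : IsCompact {z : ExtSpace d | s ≤ ‖(z : E d)‖} :=
    (isClosed_le continuous_const (by fun_prop)).isCompact
  have hS : {z : ExtSpace d | s ≤ ‖(z : E d)‖} ⊆ Set.range (Subtype.val : PuncturedExt d → _) := by
    intro z hz
    refine ⟨⟨z, (ne_embed_zero_iff z).2 fun h0 => ?_⟩, rfl⟩
    simp only [Set.mem_ofPred_eq, h0, norm_zero] at hz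
    linarith
  have hcpt : IsCompact ((Subtype.val : PuncturedExt d → ExtSpace d) ⁻¹'
      {z : ExtSpace d | s ≤ ‖(z : E d)‖}) :=
    (Topology.IsInducing.subtypeVal).isCompact_preimage_iff hS |>.2 hC
  have hfin := hcpt.measure_lt_top (μ := toExt ν)
  rw [toExt_apply,
    Set.image_preimage_eq_of_subset hS, Measure.map_apply continuous_embed.measurable
    hC.isClosed.measurableSet] at hfin
  refine (measure_mono ?_).trans_lt hfin
  intro x hx
  simp only [Set.mem_ofPred_eq, Set.mem_preimage] at hx ⊢
  rw [norm_embed, div_le_div_iff₀ (by positivity) (by positivity)]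
  linarith

lemma measurableEmbedding_embed : MeasurableEmbedding (embed : E d → ExtSpace d) :=
  continuous_embed.measurableEmbedding embed_injective

lemma toExt_apply_image (ν : Measure (E d)) (A : Set (E d)) :
    toExt ν (Subtype.val ⁻¹' (embed '' A)) = ν (A \ {0}) := by
  rw [toExt_apply, measurableEmbedding_embed.map_apply]
  congr 1
  ext x
  simp only [Set.mem_preimage, Set.mem_image]
  constructor
  · rintro ⟨⟨z, hz⟩, ⟨y, hy, rfl⟩, h⟩
    obtain rfl := embed_injective h
    exact ⟨hy, fun h0 => hz (by rw [Set.mem_singleton_iff.1 h0])⟩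
  · rintro ⟨hx, h0⟩
    exact ⟨⟨embed x, fun h => h0 (embed_injective h)⟩, ⟨x, hx, rfl⟩, rfl⟩

/-- Measures that are finite away from the origin are determined by their test functions. -/
lemma measure_eq_of_integral_test_eq {ν ν' : Measure (E d)}
    [IsFiniteMeasureOnCompacts (toExt ν)] [IsFiniteMeasureOnCompacts (toExt ν')]
    (h0 : ν {0} = 0) (h0' : ν' {0} = 0)
    (h : ∀ g, IsTest g → ∫ x, g x ∂ν = ∫ x, g x ∂ν') : ν = ν' := by
  have : LocallyCompactSpace (PuncturedExt d) :=
    (isOpen_ne : IsOpen {z : ExtSpace d | z ≠ embed 0}).locallyCompactSpace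
  have hext : toExt ν = toExt ν' := by
    apply Measure.ext_of_integral_eq_on_compactlySupported
    intro f
    obtain ⟨g, hg, hgf⟩ := exists_test_of_cc f
    rw [hgf, hgf, h g hg]
  ext A hA
  rw [← measure_sdiff_null (s := A) h0, ← measure_sdiff_null (s := A) h0',
    ← toExt_apply_image ν A, ← toExt_apply_image ν' A, hext]

lemma isFiniteMeasureOnCompacts_toExt {ν : Measure (E d)}
    (h : ∀ r : ℝ, 0 < r → ν {x | r ≤ ‖x‖} < ∞) : IsFiniteMeasureOnCompacts (toExt ν) := by
  constructor
  intro K hK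
  have hK' : IsCompact ((Subtype.val : PuncturedExt d → ExtSpace d) '' K) :=
    hK.image continuous_subtype_val
  have h0 : embed 0 ∉ (Subtype.val : PuncturedExt d → ExtSpace d) '' K := by
    rintro ⟨z, -, hz⟩
    exact z.2 hz
  obtain ⟨r, hr, hb⟩ := Metric.isOpen_iff.1 hK'.isClosed.isOpen_compl _ h0
  rw [toExt_apply,
    Measure.map_apply continuous_embed.measurable hK'.isClosed.measurableSet]
  refine (measure_mono ?_).trans_lt (h r hr)
  intro x hx
  by_contra hlt
  simp only [Set.mem_ofPred_eq, not_le] at hlt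
  refine hb ?_ hx
  rw [Metric.mem_ball, Subtype.dist_eq, embed_zero_coe, dist_zero_right, norm_embed,
    div_lt_iff₀ (by positivity)]
  nlinarith [norm_nonneg x]

end TruncLD

/-! ### Integrals of dilated test functions and comparison of scales. -/

namespace TruncLD

variable {d : ℕ}

lemma IsTest.integrable {g : E d → ℝ} (hg : IsTest g) {ν : Measure (E d)}
    (hν : ∀ r : ℝ, 0 < r → ν {x | r ≤ ‖x‖} < ∞) : Integrable g ν := by
  obtain ⟨C, hC, hb⟩ := hg.bounded
  obtain ⟨r, hr, h0⟩ := hg.vanish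
  have hm : MeasurableSet {x : E d | r ≤ ‖x‖} := measurableSet_le measurable_const measurable_norm
  have hi : Integrable (Set.indicator {x : E d | r ≤ ‖x‖} fun _ => C) ν :=
    (integrable_indicator_iff hm).2 (integrableOn_const (hν r hr).ne)
  refine hi.mono' hg.continuous.aestronglyMeasurable (ae_of_all _ fun x => ?_)
  by_cases hx : r ≤ ‖x‖
  · rw [Set.indicator_of_mem (show x ∈ {x : E d | r ≤ ‖x‖} from hx)]; exact hb x
  · rw [Set.indicator_of_notMem (show x ∉ {x : E d | r ≤ ‖x‖} from hx), h0 x (not_le.1 hx).le, norm_zero]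

/-- A continuous stand-in for the indicator of the outside of a ball, to be squeezed between two
indicators as $\rho\downarrow1$. -/
lemma exists_cutoff {ρ : ℝ} (hρ : 1 < ρ) : ∃ ψ : E d → ℝ, IsTest ψ ∧ (∀ x, 0 ≤ ψ x) ∧
    (∀ x, ψ x ≤ 1) ∧ (∀ x, ρ ≤ ‖x‖ → ψ x = 1) ∧ ∀ x, ‖x‖ ≤ 1 → ψ x = 0 := by
  set v := ρ / (1 + ρ) - 1 / 2 with hv
  have hv0 : 0 < v := by
    rw [hv, sub_pos, div_lt_div_iff₀ (by norm_num) (by linarith)]; linarith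
  let φ : ℝ → ℝ := fun s => max 0 (min 1 ((s - 1 / 2) / v))
  have hφ : Continuous φ := by fun_prop
  refine ⟨fun x => φ (‖x‖ / (1 + ‖x‖)), isTest_radial hφ (u := 1 / 2) (by norm_num) ?_, ?_, ?_, ?_, ?_⟩
  · intro s hs
    exact max_eq_left ((min_le_right _ _).trans (div_nonpos_of_nonpos_of_nonneg (by linarith) hv0.le))
  · exact fun x => le_max_left _ _
  · exact fun x => max_le (by norm_num) (min_le_left _ _)
  · intro x hx
    have : 1 ≤ (‖x‖ / (1 + ‖x‖) - 1 / 2) / v := by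
      rw [le_div_iff₀ hv0, one_mul, hv]
      gcongr ?_ - _
      rw [div_le_div_iff₀ (by linarith) (by positivity)]; linarith
    simp only [φ, min_eq_left this]; norm_num
  · intro x hx
    refine max_eq_left ((min_le_right _ _).trans (div_nonpos_of_nonpos_of_nonneg ?_ hv0.le))
    rw [sub_nonpos, div_le_div_iff₀ (by positivity) (by norm_num)]; linarith

/-- A radial test function, increasing in the norm. -/
noncomputable def radial (x : E d) : ℝ := max 0 (‖x‖ / (1 + ‖x‖) - 1 / 2)

lemma isTest_radial_fn : IsTest (radial : E d → ℝ) :=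
  isTest_radial (φ := fun s => max 0 (s - 1 / 2)) (by fun_prop) (u := 1 / 2) (by norm_num)
    fun s hs => max_eq_left (by linarith)

lemma radial_nonneg (x : E d) : 0 ≤ radial x := le_max_left _ _

lemma radial_mono {x y : E d} (h : ‖x‖ ≤ ‖y‖) : radial x ≤ radial y := by
  refine max_le_max le_rfl (sub_le_sub_right ?_ _)
  rw [div_le_div_iff₀ (by positivity) (by positivity)]; nlinarith

lemma radial_pos {x : E d} (h : 1 < ‖x‖) : 0 < radial x := by
  refine lt_max_of_lt_right ?_
  rw [sub_pos, div_lt_div_iff₀ (by norm_num) (by positivity)]; linarith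

lemma radial_eq_zero {x : E d} (h : ‖x‖ ≤ 1) : radial x = 0 := by
  refine max_eq_left ?_
  rw [sub_nonpos, div_le_div_iff₀ (by positivity) (by norm_num)]; linarith

/-- The integral of the dilated function `x ↦ g (x / t)`. -/
noncomputable def dilInt (ν : Measure (E d)) (g : E d → ℝ) (t : ℝ) : ℝ := ∫ x, g (t⁻¹ • x) ∂ν

lemma dilInt_one (ν : Measure (E d)) (g : E d → ℝ) : dilInt ν g 1 = ∫ x, g x ∂ν := by
  simp [dilInt]

lemma dilInt_smul (ν : Measure (E d)) (g : E d → ℝ) (s t : ℝ) :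
    dilInt ν (fun x => g (s⁻¹ • x)) t = dilInt ν g (s * t) := by
  simp only [dilInt, smul_smul, mul_inv]

section tails

variable {ν : Measure (E d)} (hν : ∀ r : ℝ, 0 < r → ν {x | r ≤ ‖x‖} < ∞)
include hν

lemma dilInt_radial_antitone {s t : ℝ} (hs : 0 < s) (hst : s ≤ t) :
    dilInt ν radial t ≤ dilInt ν radial s := by
  refine integral_mono ((isTest_radial_fn.smul (inv_pos.2 (hs.trans_le hst))).integrable hν)
    ((isTest_radial_fn.smul (inv_pos.2 hs)).integrable hν) fun x => radial_mono ?_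
  rw [norm_smul, norm_smul, norm_inv, norm_inv, Real.norm_of_nonneg hs.le,
    Real.norm_of_nonneg (hs.trans_le hst).le]
  gcongr

lemma dilInt_radial_tendsto_zero : Tendsto (dilInt ν radial) atTop (𝓝 0) := by
  have : Tendsto (dilInt ν radial) atTop (𝓝 (∫ _, (0 : ℝ) ∂ν)) := by
    refine tendsto_integral_filter_of_dominated_convergence radial ?_ ?_
      (isTest_radial_fn.integrable hν) ?_
    · filter_upwards [eventually_gt_atTop 0] with t ht
      exact ((isTest_radial_fn.smul (inv_pos.2 ht)).integrable hν).aestronglyMeasurable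
    · filter_upwards [eventually_ge_atTop 1] with t ht
      refine ae_of_all _ fun x => ?_
      rw [Real.norm_of_nonneg (radial_nonneg _)]
      refine radial_mono ?_
      rw [norm_smul, norm_inv, Real.norm_of_nonneg (by linarith)]
      exact mul_le_of_le_one_left (norm_nonneg _) (inv_le_one_of_one_le₀ ht)
    · refine ae_of_all _ fun x => ?_
      refine tendsto_const_nhds.congr' ?_
      filter_upwards [eventually_ge_atTop (max 1 ‖x‖)] with t ht
      symm
      have h1 : 1 ≤ t := (le_max_left _ _).trans ht
      apply radial_eq_zero
      rw [norm_smul, norm_inv, Real.norm_of_nonneg (by linarith), inv_mul_le_iff₀ (by linarith), mul_one]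
      exact (le_max_right _ _).trans ht
  simpa using this

end tails

/-- Otherwise every set $\{\|x\|>1/(n+1)\}$ would be null; together with the origin these exhaust
the space. -/
lemma exists_dilInt_radial_pos {μ : Measure (E d)} (hfin : ∀ r : ℝ, 0 < r → μ {x | r ≤ ‖x‖} < ∞)
    (hμ : μ ≠ 0) (hμ0 : μ {0} = 0) : ∃ x > 0, 0 < dilInt μ radial x := by
  by_contra! hcon
  apply hμ
  rw [← Measure.measure_univ_eq_zero]
  have hz : ∀ n : ℕ, μ {x | ((n : ℝ) + 1)⁻¹ < ‖x‖} = 0 := by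
    intro n
    have hp : 0 < ((n : ℝ) + 1)⁻¹ := by positivity
    have h1 := (isTest_radial_fn.smul (inv_pos.2 hp)).integrable (ν := μ) hfin
    have h2 : ∫ x, radial ((((n : ℝ) + 1)⁻¹)⁻¹ • x) ∂μ = 0 :=
      le_antisymm (hcon _ hp) (integral_nonneg fun x => radial_nonneg _)
    rw [integral_eq_zero_iff_of_nonneg (fun x => radial_nonneg _) h1] at h2
    refine measure_mono_null ?_ (ae_iff.1 h2)
    intro x hx
    rw [Set.mem_ofPred_eq] at hx ⊢
    refine (radial_pos ?_).ne'
    rw [norm_smul, norm_inv, Real.norm_of_nonneg hp.le, lt_inv_mul_iff₀ hp, mul_one]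
    exact hx
  have hU : (Set.univ : Set (E d)) ⊆ {0} ∪ ⋃ n : ℕ, {x | ((n : ℝ) + 1)⁻¹ < ‖x‖} := by
    intro x _
    by_cases hx : x = 0
    · exact Or.inl hx
    · right
      obtain ⟨n, hn⟩ := exists_nat_one_div_lt (norm_pos_iff.2 hx)
      exact Set.mem_iUnion.2 ⟨n, by simpa using hn⟩
  exact measure_mono_null hU (measure_union_null hμ0 (measure_iUnion_null hz))

/-- Regular variation of the law `ν` along the scaling sequence `a`, with limit measure `μ`. -/
structure RegVarAlong (ν μ : Measure (E d)) (a : ℕ → ℝ) : Prop where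
  scale : Tendsto a atTop atTop
  fin : ∀ r : ℝ, 0 < r → μ {x | r ≤ ‖x‖} < ∞
  lim : ∀ g, IsTest g → Tendsto (fun n : ℕ => (n : ℝ) * dilInt ν g (a n)) atTop (𝓝 (∫ x, g x ∂μ))

section RV

variable {ν μ : Measure (E d)} {a : ℕ → ℝ}

lemma finite_tails (ν : Measure (E d)) [IsFiniteMeasure ν] (r : ℝ) (_ : 0 < r) :
    ν {x | r ≤ ‖x‖} < ∞ := measure_lt_top _ _

lemma RegVarAlong.lim_mul (h : RegVarAlong ν μ a) {g : E d → ℝ} (hg : IsTest g) {x : ℝ}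
    (hx : 0 < x) :
    Tendsto (fun n : ℕ => (n : ℝ) * dilInt ν g (x * a n)) atTop (𝓝 (dilInt μ g x)) := by
  have := h.lim _ (hg.smul (inv_pos.2 hx))
  simp only [dilInt_smul] at this
  exact this

/-- Replacing the scale by an asymptotically equal one changes $g$ pointwise by at most $\eta$ times
a cutoff, whose integral multiplied by $N$ stays bounded. -/
lemma RegVarAlong.lim_of_ratio [IsFiniteMeasure ν] (h : RegVarAlong ν μ a) {g : E d → ℝ}
    (hg : IsTest g) {ι : Type*} {l : Filter ι} {N : ι → ℕ} (hN : Tendsto N l atTop) {b : ι → ℝ}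
    (hb : Tendsto (fun i => b i / a (N i)) l (𝓝 1)) :
    Tendsto (fun i => (N i : ℝ) * dilInt ν g (b i)) l (𝓝 (∫ x, g x ∂μ)) := by
  obtain ⟨r, hr, hg0⟩ := hg.vanish
  obtain ⟨ψ, hψ, hψ0, -, hψ1, -⟩ := exists_cutoff (d := d) (ρ := 2) (by norm_num)
  -- This cutoff equals $1$ as soon as $\|x\|\ge r/2$. The margin $r/2$ allows the ratio of scales
  -- to be as large as $2$ without leaving the region where $g$ vanishes.
  set ψ' : E d → ℝ := fun x => ψ ((4 / r) • x) with hψ'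
  have hψt : IsTest ψ' := hψ.smul (by positivity)
  have hlim := (h.lim g hg).comp hN
  have hlimψ := (h.lim ψ' hψt).comp hN
  set C := ∫ x, ψ' x ∂μ with hC
  have hC0 : 0 ≤ C := integral_nonneg fun x => hψ0 _
  suffices hd : Tendsto (fun i => (N i : ℝ) * dilInt ν g (b i) - (N i : ℝ) * dilInt ν g (a (N i)))
      l (𝓝 0) by
    have := hd.add hlim
    simpa using this
  rw [Metric.tendsto_nhds]
  intro ε hε
  set η := ε / (C + 2) with hη
  have hη0 : 0 < η := by positivity
  obtain ⟨ρ, hρ, hρg⟩ := hg.uniform_smul hη0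
  have hinv : Tendsto (fun i => a (N i) / b i) l (𝓝 1) := by
    have := hb.inv₀ one_ne_zero
    simpa using this
  have e1 : ∀ᶠ i in l, |a (N i) / b i - 1| ≤ min ρ (1 / 2) := by
    have := Metric.tendsto_nhds.1 hinv (min ρ (1 / 2)) (by positivity)
    filter_upwards [this] with i hi
    exact hi.le
  have e2 : ∀ᶠ i in l, 0 < a (N i) := (h.scale.comp hN).eventually_gt_atTop 0
  have e3 : ∀ᶠ i in l, (N i : ℝ) * dilInt ν ψ' (a (N i)) < C + 1 :=
    hlimψ.eventually (gt_mem_nhds (by linarith))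
  filter_upwards [e1, e2, e3] with i h1 h2 h3
  set A := a (N i)
  set β := A / b i with hβ
  have hβ1 := h1.trans (min_le_right _ _)
  have hβ0 : 0 < β := by have := abs_le.1 hβ1; linarith
  have hβ2 : β ≤ 2 := by have := abs_le.1 hβ1; linarith
  have hbi : 0 < b i := by
    by_contra hneg
    have : β ≤ 0 := div_nonpos_of_nonneg_of_nonpos h2.le (not_lt.1 hneg)
    linarith
  have hpt : ∀ x, |g ((b i)⁻¹ • x) - g (A⁻¹ • x)| ≤ η * ψ' (A⁻¹ • x) := by
    intro x
    have hx : (b i)⁻¹ • x = β • (A⁻¹ • x) := by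
      rw [smul_smul]; congr 1; rw [hβ]; field_simp
    rw [hx]
    set y := A⁻¹ • x
    by_cases hy : ‖y‖ ≤ r / 2
    · rw [hg0 y (by linarith), hg0 (β • y), sub_zero, abs_zero]
      · exact mul_nonneg hη0.le (hψ0 _)
      · rw [norm_smul, Real.norm_of_nonneg hβ0.le]
        nlinarith [norm_nonneg y]
    · have hone : ψ' y = 1 := by
        refine hψ1 _ ?_
        rw [norm_smul, Real.norm_of_nonneg (by positivity)]
        rw [not_le] at hy
        rw [div_mul_eq_mul_div, le_div_iff₀ hr]; linarith
      rw [hone, mul_one]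
      exact hρg β hβ0 (h1.trans (min_le_left _ _)) y
  have hint : ∀ {f : E d → ℝ} (_ : IsTest f) {t : ℝ} (_ : 0 < t), Integrable (fun x => f (t⁻¹ • x)) ν :=
    fun hf _ ht => (hf.smul (inv_pos.2 ht)).integrable (finite_tails ν)
  rw [dist_zero_right, ← mul_sub, norm_mul, Real.norm_natCast]
  have hI : ‖dilInt ν g (b i) - dilInt ν g A‖ ≤ η * dilInt ν ψ' A := by
    rw [dilInt, dilInt, ← integral_sub (hint hg hbi) (hint hg h2), dilInt, ← integral_const_mul]
    exact norm_integral_le_of_norm_le ((hint hψt h2).const_mul η) (ae_of_all _ hpt)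
  calc (N i : ℝ) * ‖dilInt ν g (b i) - dilInt ν g A‖ ≤ N i * (η * dilInt ν ψ' A) := by gcongr
    _ = η * (N i * dilInt ν ψ' A) := by ring
    _ ≤ η * (C + 1) := by gcongr
    _ < η * (C + 2) := by gcongr; norm_num
    _ = ε := by rw [hη]; field_simp

/-- With $k=\lfloor ns\rfloor$, the ratio $a_k/a_n$ stays in a compact subset of $(0,\infty)$. At a
limit point $c$, the same quantity $n\int g(x/a_k)\,d\nu$ is computed in two ways: as $n/k\to
s^{-1}$ times the limit at index $k$, and by $a_k\approx c\,a_n$. -/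
lemma RegVarAlong.exists_scale [IsFiniteMeasure ν] (h : RegVarAlong ν μ a) (hμ : μ ≠ 0)
    (hμ0 : μ {0} = 0) {s : ℝ} (hs : 0 < s) :
    ∃ c > 0, ∀ g, IsTest g → dilInt μ g c = s⁻¹ * ∫ x, g x ∂μ := by
  obtain ⟨x₀, hx₀, hm⟩ := exists_dilInt_radial_pos h.fin hμ hμ0
  set m := dilInt μ radial with hmdef
  have hk : Tendsto (fun n : ℕ => ⌊(n : ℝ) * s⌋₊) atTop atTop :=
    tendsto_nat_floor_atTop.comp (tendsto_natCast_atTop_atTop.atTop_mul_const hs)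
  have hkr : Tendsto (fun n : ℕ => (n : ℝ) / (⌊(n : ℝ) * s⌋₊ : ℝ)) atTop (𝓝 s⁻¹) := by
    have h1 := (tendsto_nat_floor_mul_div_atTop hs.le).comp (tendsto_natCast_atTop_atTop (R := ℝ))
    have h2 := h1.inv₀ hs.ne'
    refine h2.congr fun n => ?_
    simp [mul_comm s]
  have hlim : ∀ g, IsTest g → ∀ x, 0 < x →
      Tendsto (fun n : ℕ => (n : ℝ) * dilInt ν g (x * a ⌊(n : ℝ) * s⌋₊)) atTop
        (𝓝 (s⁻¹ * dilInt μ g x)) := by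
    intro g hg x hx
    have h1 := hkr.mul ((h.lim_mul hg hx).comp hk)
    refine h1.congr' ?_
    filter_upwards [hk.eventually_gt_atTop 0] with n hn
    have : ((⌊(n : ℝ) * s⌋₊ : ℕ) : ℝ) ≠ 0 := by positivity
    simp only [Function.comp]
    field_simp
  have hzero := dilInt_radial_tendsto_zero h.fin
  have hzx : Tendsto (fun R => m (R * x₀)) atTop (𝓝 0) :=
    hzero.comp (tendsto_id.atTop_mul_const hx₀)
  have e1 : ∀ᶠ R in atTop, m (R * x₀) < s⁻¹ * m x₀ := hzx.eventually (gt_mem_nhds (by positivity))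
  have e2 : ∀ᶠ R in atTop, m (R * x₀) < s * m x₀ := hzx.eventually (gt_mem_nhds (by positivity))
  -- $R$ is so large that a ratio outside $[R^{-1},R]$ would contradict the monotonicity of the
  -- radial integral: the first inequality bounds $a_k/a_n$ from above, the second from below.
  obtain ⟨R, hR1, hR2, hR0⟩ := (e1.and (e2.and (eventually_gt_atTop 0))).exists
  have anti : ∀ {s t : ℝ}, 0 < s → s ≤ t → dilInt ν radial t ≤ dilInt ν radial s :=
    fun hs hst => dilInt_radial_antitone (finite_tails ν) hs hst
  have hak := h.scale.comp hk
  have u1 : ∀ᶠ n : ℕ in atTop, a ⌊(n : ℝ) * s⌋₊ / a n ≤ R := by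
    filter_upwards [(h.lim_mul isTest_radial_fn (mul_pos hR0 hx₀)).eventually_lt
      (hlim radial isTest_radial_fn x₀ hx₀) hR1, h.scale.eventually_gt_atTop 0,
      hak.eventually_gt_atTop 0] with n hn ha0 hak0
    rw [div_le_iff₀ ha0]
    by_contra! hlt
    have := anti (by positivity : 0 < R * x₀ * a n) (t := x₀ * a ⌊(n : ℝ) * s⌋₊) (by nlinarith)
    exact absurd hn (not_lt.2 (by gcongr))
  have u2 : ∀ᶠ n : ℕ in atTop, R⁻¹ ≤ a ⌊(n : ℝ) * s⌋₊ / a n := by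
    have hlt : s⁻¹ * m (R * x₀) < m x₀ := by rwa [inv_mul_lt_iff₀ hs]
    filter_upwards [(hlim radial isTest_radial_fn (R * x₀) (mul_pos hR0 hx₀)).eventually_lt
      (h.lim_mul isTest_radial_fn hx₀) hlt, h.scale.eventually_gt_atTop 0,
      hak.eventually_gt_atTop 0] with n hn ha0 hak0
    simp only [Function.comp] at hak0
    rw [le_div_iff₀ ha0, inv_mul_le_iff₀ hR0]
    by_contra! hlt
    have := anti (by positivity : 0 < R * x₀ * a ⌊(n : ℝ) * s⌋₊) (t := x₀ * a n) (by nlinarith)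
    exact absurd hn (not_lt.2 (by gcongr))
  obtain ⟨c, hc, φ, hφ, hcφ⟩ := isCompact_Icc.tendsto_subseq' (s := Set.Icc R⁻¹ R)
    (x := fun n : ℕ => a ⌊(n : ℝ) * s⌋₊ / a n) (u2.and u1).frequently
  have hc0 : 0 < c := (inv_pos.2 hR0).trans_le hc.1
  refine ⟨c, hc0, fun g hg => ?_⟩
  have l1 := (hlim g hg 1 one_pos).comp hφ.tendsto_atTop
  -- The dilation by $c$ is moved from the scale into the test function, so that the ratio of scales
  -- tends to $1$ and `lim_of_ratio` applies.
  have l2 : Tendsto (fun k => (φ k : ℝ) * dilInt ν (fun x => g (c⁻¹ • x))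
      (a ⌊(φ k : ℝ) * s⌋₊ / c)) atTop (𝓝 (∫ x, g (c⁻¹ • x) ∂μ)) := by
    refine h.lim_of_ratio (hg.smul (inv_pos.2 hc0)) hφ.tendsto_atTop ?_
    have := hcφ.div_const c
    rw [div_self hc0.ne'] at this
    refine this.congr fun k => ?_
    simp only [Function.comp]
    ring
  have l3 := tendsto_nhds_unique (l2.congr fun k => ?_) l1
  · rw [dilInt_one] at l3
    exact l3
  · rw [dilInt_smul]
    simp only [Function.comp, one_mul]
    rw [mul_div_cancel₀ _ hc0.ne']

end RV

end TruncLD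

/-! ### Homogeneity of the limit measure and regular variation along the real line. -/

namespace TruncLD

variable {d : ℕ} {ν μ : Measure (E d)} {a : ℕ → ℝ}

/-- A strictly increasing multiplicative function on the positive reals is a power. -/
lemma exists_rpow_of_strictMono_mul {c : ℝ → ℝ} (hpos : ∀ s, 0 < s → 0 < c s)
    (hmono : ∀ s t, 0 < s → s < t → c s < c t)
    (hmul : ∀ s t, 0 < s → 0 < t → c (s * t) = c s * c t) :
    ∃ κ : ℝ, 0 < κ ∧ ∀ s, 0 < s → c s = s ^ κ := by
  let G : ℝ →+ ℝ := AddMonoidHom.mk' (fun u => Real.log (c (Real.exp u))) fun u v => by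
    rw [Real.exp_add, hmul _ _ (Real.exp_pos _) (Real.exp_pos _),
      Real.log_mul (hpos _ (Real.exp_pos _)).ne' (hpos _ (Real.exp_pos _)).ne']
  have hG : StrictMono G := fun u v huv =>
    Real.log_lt_log (hpos _ (Real.exp_pos _)) (hmono _ _ (Real.exp_pos _) (Real.exp_lt_exp.2 huv))
  -- A monotone additive map is measurable, hence continuous, hence linear.
  have hcont : Continuous G := MeasureTheory.Measure.AddMonoidHom.continuous_of_measurable G hG.monotone.measurable
  have hlin : ∀ u, G u = u * G 1 := fun u => by
    have := map_real_smul G hcont u 1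
    simpa using this
  refine ⟨G 1, by simpa using hG one_pos, fun s hs => ?_⟩
  have h1 := hlin (Real.log s)
  have h2 : G (Real.log s) = Real.log (c s) := by simp [G, Real.exp_log hs]
  rw [Real.rpow_def_of_pos hs, ← h1, h2, Real.exp_log (hpos s hs)]

/-- Homogeneity of the limit measure, expressed through test functions. -/
def Scales (μ : Measure (E d)) (α : ℝ) : Prop :=
  ∀ g, IsTest g → ∀ t, 0 < t → dilInt μ g t = t ^ (-α) * ∫ x, g x ∂μ

/-- The factor $c(s)$ that multiplies $\mu$ by $s^{-1}$ is unique, since the radial integral is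
positive somewhere and tends to $0$. Uniqueness makes $c$ multiplicative and monotonicity of the
radial integral makes it increasing, so $c(s)=s^\kappa$ and the index is $1/\kappa$. -/
lemma RegVarAlong.exists_scales [IsFiniteMeasure ν] (h : RegVarAlong ν μ a) (hμ : μ ≠ 0)
    (hμ0 : μ {0} = 0) : ∃ α : ℝ, 0 < α ∧ Scales μ α := by
  obtain ⟨x₀, hx₀, hm⟩ := exists_dilInt_radial_pos h.fin hμ hμ0
  set m := dilInt μ radial with hmdef
  have hanti : ∀ {s t : ℝ}, 0 < s → s ≤ t → m t ≤ m s :=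
    fun hs hst => dilInt_radial_antitone h.fin hs hst
  choose! c hc0 hc using fun s (hs : 0 < s) => h.exists_scale hμ hμ0 hs
  have hcg : ∀ g, IsTest g → ∀ s x, 0 < s → 0 < x → dilInt μ g (x * c s) = s⁻¹ * dilInt μ g x := by
    intro g hg s x hs hx
    rw [← dilInt_smul, hc s hs _ (hg.smul (inv_pos.2 hx))]; rfl
  have hcm : ∀ s x, 0 < s → 0 < x → m (x * c s) = s⁻¹ * m x :=
    hcg radial isTest_radial_fn
  -- a dilation factor is determined by its effect
  have huniq : ∀ u v, 0 < u → u < v → ¬ ∀ x, 0 < x → m (x * u) = m (x * v) := by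
    intro u v hu huv hall
    have hq : 1 < v / u := by rwa [one_lt_div hu]
    have hstep : ∀ x, 0 < x → m (x * (v / u)) = m x := by
      intro x hx
      have := hall (x / u) (by positivity)
      rw [div_mul_cancel₀ _ hu.ne'] at this
      rw [this]; congr 1; ring
    have hiter : ∀ n : ℕ, m (x₀ * (v / u) ^ n) = m x₀ := by
      intro n
      induction n with
      | zero => simp
      | succ n ih => rw [pow_succ, ← mul_assoc, hstep _ (by positivity), ih]
    -- Invariance under the factor $v/u>1$ would keep the radial integral at its positive value
    -- along a sequence going to infinity.
    have hlim : Tendsto (fun n : ℕ => m (x₀ * (v / u) ^ n)) atTop (𝓝 0) :=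
      (dilInt_radial_tendsto_zero h.fin).comp
        ((tendsto_pow_atTop_atTop_of_one_lt hq).const_mul_atTop hx₀)
    simp only [hiter] at hlim
    exact hm.ne' (tendsto_nhds_unique tendsto_const_nhds hlim)
  have hmono : ∀ s t, 0 < s → s < t → c s < c t := by
    intro s t hs hst
    by_contra! hle
    have h1 := hanti (mul_pos hx₀ (hc0 t (hs.trans hst))) (mul_le_mul_of_nonneg_left hle hx₀.le)
    rw [hcm _ _ hs hx₀, hcm _ _ (hs.trans hst) hx₀] at h1
    have : t⁻¹ < s⁻¹ := by gcongr
    nlinarith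
  have hmul : ∀ s t, 0 < s → 0 < t → c (s * t) = c s * c t := by
    intro s t hs ht
    have key : ∀ x, 0 < x → m (x * c (s * t)) = m (x * (c s * c t)) := by
      intro x hx
      rw [hcm _ _ (mul_pos hs ht) hx, ← mul_assoc, hcm _ _ ht (mul_pos hx (hc0 s hs)), hcm _ _ hs hx,
        mul_inv]
      ring
    rcases lt_trichotomy (c (s * t)) (c s * c t) with hlt | heq | hgt
    · exact absurd key (huniq _ _ (hc0 _ (mul_pos hs ht)) hlt)
    · exact heq
    · exact absurd (fun x hx => (key x hx).symm)
        (huniq _ _ (mul_pos (hc0 s hs) (hc0 t ht)) hgt)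
  obtain ⟨κ, hκ, hcκ⟩ := exists_rpow_of_strictMono_mul hc0 hmono hmul
  refine ⟨κ⁻¹, inv_pos.2 hκ, fun g hg t ht => ?_⟩
  -- The parameter $s=t^{1/\kappa}$ is the one with $c(s)=t$.
  have hs : 0 < t ^ κ⁻¹ := Real.rpow_pos_of_pos ht _
  have h1 := hc _ hs g hg
  rw [hcκ _ hs, ← Real.rpow_mul ht.le, inv_mul_cancel₀ hκ.ne', Real.rpow_one] at h1
  rw [h1, Real.rpow_neg ht.le]

/-- The dilated measure and the multiple of $\mu$ agree on test functions, are finite away from the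
origin and do not charge it, so they coincide. -/
lemma isIndex_of_scales (hfin : ∀ r : ℝ, 0 < r → μ {x | r ≤ ‖x‖} < ∞) (hμ0 : μ {0} = 0) {α : ℝ}
    (hα : 0 < α) (hs : Scales μ α) : IsIndex μ α := by
  refine ⟨hα, fun A c hA hc => ?_⟩
  have hmeas : Measurable fun x : E d => c⁻¹ • x := measurable_const_smul c⁻¹
  have hpre : ∀ B : Set (E d), (fun x : E d => c⁻¹ • x) ⁻¹' B = c • B := fun B =>
    Set.preimage_smul_inv₀ hc.ne' B
  have e : μ.map (fun x : E d => c⁻¹ • x) = ENNReal.ofReal (c ^ (-α)) • μ := by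
    have := isFiniteMeasureOnCompacts_toExt (ν := μ.map (fun x : E d => c⁻¹ • x)) fun r hr => by
      rw [Measure.map_apply hmeas (measurableSet_le measurable_const measurable_norm)]
      refine (measure_mono ?_).trans_lt (hfin (c * r) (by positivity))
      intro x hx
      simp only [Set.mem_preimage, Set.mem_ofPred_eq, norm_smul, norm_inv,
        Real.norm_of_nonneg hc.le] at hx ⊢
      rwa [le_inv_mul_iff₀ hc] at hx
    have := isFiniteMeasureOnCompacts_toExt (ν := ENNReal.ofReal (c ^ (-α)) • μ) fun r hr => by
      rw [Measure.smul_apply, smul_eq_mul]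
      exact ENNReal.mul_lt_top ENNReal.ofReal_lt_top (hfin r hr)
    refine measure_eq_of_integral_test_eq ?_ ?_ fun g hg => ?_
    · rw [Measure.map_apply hmeas (measurableSet_singleton 0), hpre]
      simpa using hμ0
    · simp [hμ0]
    · rw [integral_map hmeas.aemeasurable hg.continuous.aestronglyMeasurable, integral_smul_measure,
        ENNReal.toReal_ofReal (Real.rpow_nonneg hc.le _)]
      exact hs g hg c hc
  rw [← hpre A, ← Measure.map_apply hmeas hA, e]
  rfl

/-- Dilation by $2$ of a set of positive finite mass determines the exponent. -/
lemma IsIndex.unique (hfin : ∀ r : ℝ, 0 < r → μ {x | r ≤ ‖x‖} < ∞) (hμ : μ ≠ 0) (hμ0 : μ {0} = 0)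
    {α β : ℝ} (hα : IsIndex μ α) (hβ : IsIndex μ β) : α = β := by
  obtain ⟨x, hx, hm⟩ := exists_dilInt_radial_pos hfin hμ hμ0
  set A := {y : E d | x ≤ ‖y‖} with hAdef
  have hA : MeasurableSet A := measurableSet_le measurable_const measurable_norm
  have hA0 : μ A ≠ 0 := by
    intro h0
    have : dilInt μ radial x = 0 := by
      rw [dilInt]
      refine integral_eq_zero_of_ae ?_
      have h1 : ∀ᵐ y ∂μ, y ∉ A := measure_eq_zero_iff_ae_notMem.1 h0
      filter_upwards [h1] with y hy
      refine radial_eq_zero ?_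
      rw [hAdef, Set.mem_ofPred_eq, not_le] at hy
      rw [norm_smul, norm_inv, Real.norm_of_nonneg hx.le, inv_mul_le_iff₀ hx]
      linarith
    linarith
  have h2 := (hα.2 A 2 hA two_pos).symm.trans (hβ.2 A 2 hA two_pos)
  rw [ENNReal.mul_left_inj hA0 (hfin x hx).ne] at h2
  rw [ENNReal.ofReal_eq_ofReal_iff (by positivity) (by positivity)] at h2
  have := (Real.rpow_right_inj (by norm_num : (0 : ℝ) < 2) (by norm_num)).1 h2
  linarith

/-- The mass outside the closed ball of radius `t`. -/
noncomputable def tailMass (ν : Measure (E d)) (t : ℝ) : ℝ := ν.real {x | t < ‖x‖}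

lemma measurableSet_normGt (t : ℝ) : MeasurableSet {x : E d | t < ‖x‖} :=
  measurableSet_lt measurable_const measurable_norm

lemma tailMass_antitone [IsFiniteMeasure ν] : Antitone (tailMass ν) := fun _ _ hst =>
  measureReal_mono fun _ hx => lt_of_le_of_lt hst hx

section limits

variable [IsFiniteMeasure ν]

/-- Passage from the sequence to real $t$. The normalization is a radial test function instead of
the tail, because its integrals converge without any condition on spheres and are monotone in the
scale. -/
lemma RegVarAlong.ratio_radial (h : RegVarAlong ν μ a) (hμ : μ ≠ 0) (hμ0 : μ {0} = 0) {α : ℝ}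
    (hα : 0 < α) (hs : Scales μ α) :
    0 < dilInt μ radial 1 ∧ (∀ t, 0 < t → 0 < dilInt ν radial t) ∧ ∀ g, IsTest g →
      Tendsto (fun t => dilInt ν g t / dilInt ν radial t) atTop
        (𝓝 ((∫ x, g x ∂μ) / dilInt μ radial 1)) := by
  have hm : ∀ t, 0 < t → dilInt μ radial t = t ^ (-α) * dilInt μ radial 1 := fun t ht => by
    rw [hs radial isTest_radial_fn t ht, dilInt_one]
  set m := dilInt μ radial with hmdef
  set U := dilInt ν radial with hUdef
  have hm1 : 0 < m 1 := by
    obtain ⟨x₀, hx₀, hm0⟩ := exists_dilInt_radial_pos h.fin hμ hμ0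
    rw [← hmdef, hm x₀ hx₀] at hm0
    exact pos_of_mul_pos_right hm0 (by positivity)
  have anti : ∀ {s t : ℝ}, 0 < s → s ≤ t → U t ≤ U s :=
    fun hs hst => dilInt_radial_antitone (finite_tails ν) hs hst
  have hU0 : Tendsto U atTop (𝓝 0) := dilInt_radial_tendsto_zero (finite_tails ν)
  have hUa : ∀ x, 0 < x → Tendsto (fun n : ℕ => (n : ℝ) * U (x * a n)) atTop (𝓝 (m x)) :=
    fun x hx => h.lim_mul isTest_radial_fn hx
  have hUpos : ∀ t, 0 < t → 0 < U t := by
    intro t ht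
    have e1 := (hUa 1 one_pos).eventually (lt_mem_nhds hm1)
    obtain ⟨n, hn, hat⟩ := (e1.and (h.scale.eventually_ge_atTop t)).exists
    rw [one_mul] at hn
    have : 0 < U (a n) := by
      by_contra! hle
      exact absurd hn (not_lt.2 (mul_nonpos_of_nonneg_of_nonpos (by positivity) hle))
    exact this.trans_le (anti ht hat)
  refine ⟨hm1, hUpos, fun g hg => ?_⟩
  -- An index whose scale matches $t$: by this choice $N(t)$ times the radial integral at $t$ tends
  -- to $m(1)$.
  let N : ℝ → ℕ := fun t => ⌊m 1 / U t⌋₊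
  have hUt : Tendsto (fun t => m 1 / U t) atTop atTop := by
    have h1 : Tendsto U atTop (𝓝[>] 0) := tendsto_nhdsWithin_iff.2
      ⟨hU0, (eventually_gt_atTop 0).mono fun t ht => hUpos t ht⟩
    have := (tendsto_inv_nhdsGT_zero.comp h1).const_mul_atTop hm1
    exact this.congr fun t => by simp [div_eq_mul_inv]
  have hN : Tendsto N atTop atTop := tendsto_nat_floor_atTop.comp hUt
  have hNU : Tendsto (fun t => (N t : ℝ) * U t) atTop (𝓝 (m 1)) := by
    have h1 := ((tendsto_nat_floor_div_atTop (R := ℝ)).comp hUt).mul_const (m 1)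
    rw [one_mul] at h1
    refine h1.congr' ?_
    filter_upwards [eventually_gt_atTop 0] with t ht
    have := hUpos t ht
    simp only [Function.comp, N]
    field_simp
  have ha0 : ∀ᶠ t in atTop, 0 < a (N t) := (h.scale.comp hN).eventually_gt_atTop 0
  -- If $t\le x\,a_{N(t)}$ with $x<1$, monotonicity would force a limit at least $m(x)>m(1)$;
  -- symmetrically for $x>1$. The strictness comes from $m(x)=x^{-\alpha}m(1)$.
  have hratio : Tendsto (fun t => t / a (N t)) atTop (𝓝 1) := by
    rw [tendsto_order]
    constructor
    · intro x hx
      by_cases hx0 : 0 < x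
      · have hlt : m 1 < m x := by
          rw [hm x hx0]
          have : 1 < x ^ (-α) := Real.one_lt_rpow_of_pos_of_lt_one_of_neg hx0 hx (by linarith)
          nlinarith
        filter_upwards [hNU.eventually_lt ((hUa x hx0).comp hN) hlt, ha0, eventually_gt_atTop 0]
          with t ht hat ht0
        rw [lt_div_iff₀ hat]
        by_contra! hle
        simp only [Function.comp] at ht
        have := anti ht0 hle
        exact absurd ht (not_lt.2 (by gcongr))
      · filter_upwards [ha0, eventually_gt_atTop 0] with t hat ht0
        have : 0 < t / a (N t) := by positivity
        linarith
    · intro x hx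
      have hx0 : 0 < x := by linarith
      have hlt : m x < m 1 := by
        rw [hm x hx0]
        have : x ^ (-α) < 1 := Real.rpow_lt_one_of_one_lt_of_neg hx (by linarith)
        nlinarith
      filter_upwards [((hUa x hx0).comp hN).eventually_lt hNU hlt, ha0, eventually_gt_atTop 0]
        with t ht hat ht0
      rw [div_lt_iff₀ hat]
      by_contra! hle
      simp only [Function.comp] at ht
      have := anti (by positivity) hle
      exact absurd ht (not_lt.2 (by gcongr))
  have hlim := (h.lim_of_ratio hg hN hratio).div hNU hm1.ne'
  refine hlim.congr' ?_
  filter_upwards [hN.eventually_gt_atTop 0] with t hNt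
  have : (N t : ℝ) ≠ 0 := by positivity
  simp only [Pi.div_apply]
  rw [mul_div_mul_left _ _ this]

end limits

/-- Regular variation along the real line: tail of index `-α` and limit `μ`, normalized. -/
structure RegVar (ν μ : Measure (E d)) (α : ℝ) : Prop where
  pos : ∀ t, 0 < tailMass ν t
  tail : ∀ x, 0 < x → Tendsto (fun t => tailMass ν (x * t) / tailMass ν t) atTop (𝓝 (x ^ (-α)))
  lim : ∀ g, IsTest g → Tendsto (fun t => dilInt ν g t / tailMass ν t) atTop
    (𝓝 ((∫ x, g x ∂μ) / tailMass μ 1))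
  limit_pos : 0 < tailMass μ 1
  limit_fin : ∀ r : ℝ, 0 < r → μ {x | r ≤ ‖x‖} < ∞

lemma tailMass_of_isIndex {α : ℝ} (hα : IsIndex μ α) {t : ℝ} (ht : 0 < t) :
    tailMass μ t = t ^ (-α) * tailMass μ 1 := by
  have h1 := hα.2 {x | 1 < ‖x‖} t (measurableSet_normGt 1) ht
  have h2 : t • {x : E d | 1 < ‖x‖} = {x | t < ‖x‖} := by
    ext x
    rw [Set.mem_smul_set_iff_inv_smul_mem₀ ht.ne', Set.mem_ofPred_eq, Set.mem_ofPred_eq, norm_smul,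
      norm_inv, Real.norm_of_nonneg ht.le, lt_inv_mul_iff₀ ht, mul_one]
  rw [h2] at h1
  simp only [tailMass, Measure.real, h1, ENNReal.toReal_mul,
    ENNReal.toReal_ofReal (Real.rpow_nonneg ht.le _)]

lemma measure_normGt_lt_top (hfin : ∀ r : ℝ, 0 < r → μ {x | r ≤ ‖x‖} < ∞) {t : ℝ} (ht : 0 < t) :
    μ {x | t < ‖x‖} < ∞ :=
  (measure_mono fun x (hx : t < ‖x‖) => hx.le).trans_lt (hfin t ht)

/-- A test function between two indicators has integral between the masses. -/
lemma tailMass_le_integral {ν : Measure (E d)} (hfin : ∀ r : ℝ, 0 < r → ν {x | r ≤ ‖x‖} < ∞)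
    {ψ : E d → ℝ} (hψ : IsTest ψ) (h0 : ∀ x, 0 ≤ ψ x) {s : ℝ}
    (h1 : ∀ x, s < ‖x‖ → 1 ≤ ψ x) : tailMass ν s ≤ ∫ x, ψ x ∂ν := by
  rw [tailMass, ← integral_indicator_one (measurableSet_normGt s)]
  refine integral_mono_of_nonneg (ae_of_all _ fun x => Set.indicator_nonneg (by simp) x)
    (hψ.integrable hfin) (ae_of_all _ fun x => ?_)
  refine Set.indicator_apply_le' (fun hx => h1 x hx) fun _ => h0 x

lemma integral_le_tailMass {ν : Measure (E d)} (hfin : ∀ r : ℝ, 0 < r → ν {x | r ≤ ‖x‖} < ∞)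
    {ψ : E d → ℝ} (hψ : IsTest ψ) {s : ℝ} (hs : 0 < s)
    (h1 : ∀ x, ψ x ≤ 1) (h0 : ∀ x, ‖x‖ ≤ s → ψ x ≤ 0) : ∫ x, ψ x ∂ν ≤ tailMass ν s := by
  rw [tailMass, ← integral_indicator_one (measurableSet_normGt s)]
  refine integral_mono (hψ.integrable hfin) ?_ fun x => ?_
  · exact (integrable_indicator_iff (measurableSet_normGt s)).2
      (integrableOn_const (measure_normGt_lt_top hfin hs).ne)
  · by_cases hx : s < ‖x‖
    · rw [Set.indicator_of_mem (show x ∈ {x : E d | s < ‖x‖} from hx)]; exact h1 x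
    · rw [Set.indicator_of_notMem (show x ∉ {x : E d | s < ‖x‖} from hx)]; exact h0 x (not_lt.1 hx)

theorem RegVarAlong.regVar [IsFiniteMeasure ν] (h : RegVarAlong ν μ a) (hμ : μ ≠ 0)
    (hμ0 : μ {0} = 0) {α : ℝ} (hα : 0 < α) (hs : Scales μ α) : RegVar ν μ α := by
  have hidx := isIndex_of_scales h.fin hμ0 hα hs
  obtain ⟨hm1, hUpos, hlim⟩ := h.ratio_radial hμ hμ0 hα hs
  set U := dilInt ν radial with hUdef
  set K := dilInt μ radial 1 with hK
  have hμ1 : 0 < tailMass μ 1 := by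
    rcases (measureReal_nonneg : 0 ≤ tailMass μ 1).lt_or_eq with h0 | h0
    · exact h0
    · exfalso
      have h2 : μ {x | 1 < ‖x‖} = 0 :=
        (measureReal_eq_zero_iff (measure_normGt_lt_top h.fin one_pos).ne).1 h0.symm
      have : K = 0 := by
        rw [hK, dilInt_one]
        refine integral_eq_zero_of_ae ?_
        have h1 : ∀ᵐ y ∂μ, y ∉ {x : E d | 1 < ‖x‖} := measure_eq_zero_iff_ae_notMem.1 h2
        filter_upwards [h1] with y hy
        exact radial_eq_zero (not_lt.1 hy)
      exact hm1.ne' this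
  -- The tail is squeezed between integrals of cutoffs. Homogeneity makes $\mu(\|x\|>\rho)$
  -- continuous in $\rho$, so the bounds meet as $\rho\downarrow1$. The additional factors $\rho$
  -- serve only to make the inequalities strict.
  have hT : Tendsto (fun t => tailMass ν t / U t) atTop (𝓝 (tailMass μ 1 / K)) := by
    have key : ∀ ρ : ℝ, 1 < ρ → (∀ᶠ t in atTop, ρ ^ (-α) * (tailMass μ 1 / K) / ρ < tailMass ν t / U t) ∧
        ∀ᶠ t in atTop, tailMass ν t / U t < ρ ^ α * (tailMass μ 1 / K) * ρ := by
      intro ρ hρ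
      have hρ0 : 0 < ρ := by linarith
      obtain ⟨ψ, hψ, ψ0, ψ1, ψ2, ψ3⟩ := exists_cutoff (d := d) hρ
      have hlow : ρ ^ (-α) * tailMass μ 1 ≤ ∫ x, ψ x ∂μ := by
        rw [← tailMass_of_isIndex hidx hρ0]
        exact tailMass_le_integral h.fin hψ ψ0 fun x hx => (ψ2 x hx.le).ge
      have hup : ∫ x, ψ x ∂μ ≤ tailMass μ 1 :=
        integral_le_tailMass h.fin hψ one_pos ψ1 fun x hx => (ψ3 x hx).le
      have hposρ : 0 < ρ ^ (-α) := by positivity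
      constructor
      · have hgt : ρ ^ (-α) * (tailMass μ 1 / K) / ρ < (∫ x, ψ x ∂μ) / K := by
          have h1 : ρ ^ (-α) * (tailMass μ 1 / K) ≤ (∫ x, ψ x ∂μ) / K := by
            rw [← mul_div_assoc]; gcongr
          refine lt_of_lt_of_le (div_lt_self (by positivity) hρ) h1
        filter_upwards [(hlim ψ hψ).eventually (lt_mem_nhds hgt), eventually_gt_atTop 0] with t ht ht0
        refine ht.trans_le ?_
        have := hUpos t ht0
        gcongr
        refine integral_le_tailMass (finite_tails ν) (hψ.smul (inv_pos.2 ht0)) ht0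
          (fun x => ψ1 _) fun x hx => (ψ3 _ ?_).le
        rw [norm_smul, norm_inv, Real.norm_of_nonneg ht0.le, inv_mul_le_iff₀ ht0, mul_one]
        exact hx
      · set ψ' : E d → ℝ := fun x => ψ ((ρ⁻¹)⁻¹ • x) with hψ'
        have hψt : IsTest ψ' := hψ.smul (by positivity)
        have hval : ∫ x, ψ' x ∂μ ≤ ρ ^ α * tailMass μ 1 := by
          have := hs ψ hψ ρ⁻¹ (by positivity)
          rw [dilInt, Real.inv_rpow hρ0.le, Real.rpow_neg hρ0.le, inv_inv (ρ ^ α)] at this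
          rw [this]
          gcongr
        have hlt : (∫ x, ψ' x ∂μ) / K < ρ ^ α * (tailMass μ 1 / K) * ρ := by
          have h1 : (∫ x, ψ' x ∂μ) / K ≤ ρ ^ α * (tailMass μ 1 / K) := by
            rw [← mul_div_assoc]; gcongr
          refine h1.trans_lt (lt_mul_of_one_lt_right (by positivity) hρ)
        filter_upwards [(hlim ψ' hψt).eventually (gt_mem_nhds hlt), eventually_gt_atTop 0] with t ht ht0
        refine lt_of_le_of_lt ?_ ht
        have := hUpos t ht0
        gcongr
        refine tailMass_le_integral (finite_tails ν) (hψt.smul (inv_pos.2 ht0)) (fun x => ψ0 _)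
          fun x hx => (ψ2 _ ?_).ge
        rw [inv_inv, norm_smul, norm_smul, norm_inv, Real.norm_of_nonneg ht0.le,
          Real.norm_of_nonneg hρ0.le]
        have : 1 ≤ t⁻¹ * ‖x‖ := by rw [le_inv_mul_iff₀ ht0, mul_one]; exact hx.le
        nlinarith
    have c1 : Tendsto (fun ρ : ℝ => ρ ^ (-α) * (tailMass μ 1 / K) / ρ) (𝓝[>] 1) (𝓝 (tailMass μ 1 / K)) := by
      have : ContinuousAt (fun ρ : ℝ => ρ ^ (-α) * (tailMass μ 1 / K) / ρ) 1 := by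
        refine ContinuousAt.div (ContinuousAt.mul ?_ continuousAt_const) continuousAt_id one_ne_zero
        exact Real.continuousAt_rpow_const _ _ (Or.inl one_ne_zero)
      have h2 := this.tendsto
      simp only [Real.one_rpow, one_mul, div_one] at h2
      exact h2.mono_left nhdsWithin_le_nhds
    have c2 : Tendsto (fun ρ : ℝ => ρ ^ α * (tailMass μ 1 / K) * ρ) (𝓝[>] 1) (𝓝 (tailMass μ 1 / K)) := by
      have : ContinuousAt (fun ρ : ℝ => ρ ^ α * (tailMass μ 1 / K) * ρ) 1 := by
        refine ContinuousAt.mul (ContinuousAt.mul ?_ continuousAt_const) continuousAt_id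
        exact Real.continuousAt_rpow_const _ _ (Or.inl one_ne_zero)
      have h2 := this.tendsto
      simp only [Real.one_rpow, one_mul, mul_one] at h2
      exact h2.mono_left nhdsWithin_le_nhds
    rw [tendsto_order]
    constructor
    · intro y hy
      obtain ⟨ρ, hρy, hρ⟩ := ((c1.eventually (lt_mem_nhds hy)).and self_mem_nhdsWithin).exists
      exact (key ρ hρ).1.mono fun t ht => hρy.trans ht
    · intro y hy
      obtain ⟨ρ, hρy, hρ⟩ := ((c2.eventually (gt_mem_nhds hy)).and self_mem_nhdsWithin).exists
      exact (key ρ hρ).2.mono fun t ht => ht.trans hρy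
  have hKpos : 0 < tailMass μ 1 / K := by positivity
  have hpos : ∀ t, 0 < tailMass ν t := by
    intro t
    obtain ⟨s, hs, hst, hs0⟩ := ((hT.eventually (lt_mem_nhds hKpos)).and
      ((eventually_ge_atTop t).and (eventually_gt_atTop 0))).exists
    refine lt_of_lt_of_le ?_ (tailMass_antitone hst)
    exact (div_pos_iff_of_pos_right (hUpos s hs0)).1 hs
  have hquot : ∀ g, IsTest g → Tendsto (fun t => dilInt ν g t / tailMass ν t) atTop
      (𝓝 ((∫ x, g x ∂μ) / tailMass μ 1)) := by
    intro g hg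
    have h1 := (hlim g hg).div hT hKpos.ne'
    rw [div_div_div_cancel_right₀ hm1.ne'] at h1
    refine h1.congr' ?_
    filter_upwards [eventually_gt_atTop 0] with t ht
    have := (hUpos t ht).ne'
    simp only [Pi.div_apply]
    rw [div_div_div_cancel_right₀ this]
  refine ⟨hpos, fun x hx => ?_, hquot, hμ1, h.fin⟩
  have hxt : Tendsto (fun t : ℝ => x * t) atTop atTop := tendsto_id.const_mul_atTop hx
  have hU : Tendsto (fun t => U (x * t) / U t) atTop (𝓝 (x ^ (-α))) := by
    have h1 := hlim _ (isTest_radial_fn.smul (inv_pos.2 hx))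
    have h2 : ∫ y, radial (x⁻¹ • y) ∂μ = x ^ (-α) * K := by
      rw [hK, dilInt_one]; exact hs radial isTest_radial_fn x hx
    rw [h2, mul_div_cancel_right₀ _ hm1.ne'] at h1
    simpa only [dilInt_smul] using h1
  have h3 := ((hT.comp hxt).mul hU).div hT hKpos.ne'
  rw [mul_div_cancel_left₀ _ hKpos.ne'] at h3
  refine h3.congr' ?_
  filter_upwards [eventually_gt_atTop 0] with t ht
  have h4 := (hUpos t ht).ne'
  have h5 := (hUpos (x * t) (by positivity)).ne'
  have h6 := (hpos t).ne'
  simp only [Function.comp, Pi.div_apply]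
  field_simp

end TruncLD

/-! ### Potter and Karamata bounds for regularly varying tails. -/

namespace TruncLD

variable {d : ℕ}

/-- A positive nonincreasing function, regularly varying with index `-α`. -/
structure RegTail (T : ℝ → ℝ) (α : ℝ) : Prop where
  anti : Antitone T
  pos : ∀ t, 0 < T t
  ratio : ∀ x, 0 < x → Tendsto (fun t => T (x * t) / T t) atTop (𝓝 (x ^ (-α)))

section RegTail

variable {T : ℝ → ℝ} {α : ℝ}

/-- One dyadic step, with the exponent relaxed so that it holds exactly beyond a threshold.
Iterating this step and its counterpart `double_le` gives all the bounds of this part. -/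
lemma RegTail.le_double (h : RegTail T α) {β : ℝ} (hβ : α < β) :
    ∃ t₀, 1 ≤ t₀ ∧ ∀ t, t₀ ≤ t → T t ≤ 2 ^ β * T (2 * t) := by
  have hlt : (2 : ℝ) ^ (-β) < 2 ^ (-α) := Real.rpow_lt_rpow_of_exponent_lt one_lt_two (by linarith)
  obtain ⟨t₀, ht₀⟩ := eventually_atTop.1 ((h.ratio 2 two_pos).eventually (lt_mem_nhds hlt))
  refine ⟨max 1 t₀, le_max_left _ _, fun t ht => ?_⟩
  have := ht₀ t ((le_max_right _ _).trans ht)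
  rw [lt_div_iff₀ (h.pos t), Real.rpow_neg two_pos.le, inv_mul_lt_iff₀ (by positivity)] at this
  exact this.le

lemma RegTail.double_le (h : RegTail T α) {β : ℝ} (hβ : β < α) :
    ∃ t₀, 1 ≤ t₀ ∧ ∀ t, t₀ ≤ t → T (2 * t) ≤ 2 ^ (-β) * T t := by
  have hlt : (2 : ℝ) ^ (-α) < 2 ^ (-β) := Real.rpow_lt_rpow_of_exponent_lt one_lt_two (by linarith)
  obtain ⟨t₀, ht₀⟩ := eventually_atTop.1 ((h.ratio 2 two_pos).eventually (gt_mem_nhds hlt))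
  refine ⟨max 1 t₀, le_max_left _ _, fun t ht => ?_⟩
  have := ht₀ t ((le_max_right _ _).trans ht)
  rw [div_lt_iff₀ (h.pos t)] at this
  exact this.le

/-- Potter's lower bound. -/
lemma RegTail.potter_lower (h : RegTail T α) {β : ℝ} (hβ : α < β) (hβ0 : 0 ≤ β) :
    ∃ t₀ C, 1 ≤ t₀ ∧ 0 < C ∧ ∀ s y, t₀ ≤ s → 1 ≤ y → T s ≤ C * y ^ β * T (y * s) := by
  obtain ⟨t₀, h1, ht⟩ := h.le_double hβ
  refine ⟨t₀, 2 ^ β, h1, by positivity, fun s y hs hy => ?_⟩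
  have hiter : ∀ k : ℕ, T s ≤ ((2 : ℝ) ^ k) ^ β * T (2 ^ k * s) := by
    intro k
    induction k with
    | zero => simp
    | succ k ih =>
      have h2k : (1 : ℝ) ≤ 2 ^ k := one_le_pow₀ one_le_two
      have := ht (2 ^ k * s) (by nlinarith)
      calc T s ≤ ((2 : ℝ) ^ k) ^ β * T (2 ^ k * s) := ih
        _ ≤ ((2 : ℝ) ^ k) ^ β * (2 ^ β * T (2 * (2 ^ k * s))) := by gcongr
        _ = _ := by rw [pow_succ, Real.mul_rpow (by positivity) two_pos.le]; ring_nf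
  obtain ⟨k, hk1, hk2⟩ := exists_nat_pow_near hy one_lt_two
  have h3 := hiter (k + 1)
  have h4 : T (2 ^ (k + 1) * s) ≤ T (y * s) := h.anti (by gcongr; linarith)
  calc T s ≤ ((2 : ℝ) ^ (k + 1)) ^ β * T (2 ^ (k + 1) * s) := h3
    _ ≤ ((2 : ℝ) ^ (k + 1)) ^ β * T (y * s) := by gcongr
    _ ≤ (2 * y) ^ β * T (y * s) := by
        have := h.pos (y * s)
        gcongr
        rw [pow_succ]; linarith
    _ = _ := by rw [Real.mul_rpow two_pos.le (by linarith)]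

/-- Potter's upper bound. -/
lemma RegTail.potter_upper (h : RegTail T α) {β : ℝ} (hβ : β < α) (hβ0 : 0 ≤ β) :
    ∃ t₀ C, 1 ≤ t₀ ∧ 0 < C ∧ ∀ s y, t₀ ≤ s → 1 ≤ y → T (y * s) ≤ C * y ^ (-β) * T s := by
  obtain ⟨t₀, h1, ht⟩ := h.double_le hβ
  refine ⟨t₀, 2 ^ β, h1, by positivity, fun s y hs hy => ?_⟩
  have hiter : ∀ k : ℕ, T (2 ^ k * s) ≤ ((2 : ℝ) ^ k) ^ (-β) * T s := by
    intro k
    induction k with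
    | zero => simp
    | succ k ih =>
      have h2k : (1 : ℝ) ≤ 2 ^ k := one_le_pow₀ one_le_two
      have := ht (2 ^ k * s) (by nlinarith)
      calc T (2 ^ (k + 1) * s) = T (2 * (2 ^ k * s)) := by ring_nf
        _ ≤ 2 ^ (-β) * T (2 ^ k * s) := this
        _ ≤ 2 ^ (-β) * (((2 : ℝ) ^ k) ^ (-β) * T s) := by gcongr
        _ = _ := by rw [pow_succ, Real.mul_rpow (by positivity) two_pos.le]; ring
  obtain ⟨k, hk1, hk2⟩ := exists_nat_pow_near hy one_lt_two
  have hTs := h.pos s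
  calc T (y * s) ≤ T (2 ^ k * s) := h.anti (by gcongr; linarith)
    _ ≤ ((2 : ℝ) ^ k) ^ (-β) * T s := hiter k
    _ ≤ (y / 2) ^ (-β) * T s := by
        gcongr ?_ * _
        refine Real.rpow_le_rpow_of_nonpos (by linarith) ?_ (by linarith)
        rw [pow_succ] at hk2; linarith
    _ = _ := by
        rw [Real.div_rpow (by linarith) two_pos.le, Real.rpow_neg two_pos.le β, div_inv_eq_mul]
        ring

lemma RegTail.exists_rpow_le (h : RegTail T α) {β : ℝ} (hβ : α < β) (hβ0 : 0 ≤ β) :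
    ∃ t₀ c, 1 ≤ t₀ ∧ 0 < c ∧ ∀ t, t₀ ≤ t → c * t ^ (-β) ≤ T t := by
  obtain ⟨t₀, C, h1, hC, hp⟩ := h.potter_lower hβ hβ0
  refine ⟨t₀, T t₀ / C, h1, div_pos (h.pos _) hC, fun t ht => ?_⟩
  have ht0 : 0 < t := by linarith
  have hy : 1 ≤ t / t₀ := by rwa [one_le_div (by linarith)]
  have := hp t₀ (t / t₀) le_rfl hy
  rw [div_mul_cancel₀ _ (by linarith)] at this
  have h2 : (t / t₀) ^ β ≤ t ^ β := by
    gcongr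
    exact div_le_self ht0.le h1
  have h3 := h.pos t
  rw [Real.rpow_neg ht0.le, ← div_eq_mul_inv, div_div, div_le_iff₀ (by positivity)]
  calc T t₀ ≤ C * (t / t₀) ^ β * T t := this
    _ ≤ C * t ^ β * T t := by gcongr
    _ = _ := by ring

lemma RegTail.le_exists_rpow (h : RegTail T α) {β : ℝ} (hβ : β < α) (hβ0 : 0 ≤ β) :
    ∃ t₀ C, 1 ≤ t₀ ∧ 0 < C ∧ ∀ t, t₀ ≤ t → T t ≤ C * t ^ (-β) := by
  obtain ⟨t₀, C, h1, hC, hp⟩ := h.potter_upper hβ hβ0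
  refine ⟨t₀, C * t₀ ^ β * T t₀, h1, mul_pos (by positivity) (h.pos _), fun t ht => ?_⟩
  have ht0 : 0 < t := by linarith
  have ht₀ : 0 < t₀ := by linarith
  have hy : 1 ≤ t / t₀ := by rwa [one_le_div (by linarith)]
  have := hp t₀ (t / t₀) le_rfl hy
  rw [div_mul_cancel₀ _ (by linarith), Real.div_rpow ht0.le (by linarith), Real.rpow_neg ht₀.le,
    div_inv_eq_mul] at this
  linarith

end RegTail

lemma RegVar.regTail {ν μ : Measure (E d)} [IsFiniteMeasure ν] {α : ℝ} (h : RegVar ν μ α) :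
    RegTail (tailMass ν) α := ⟨tailMass_antitone, h.pos, h.tail⟩

section moments

variable {ν : Measure (E d)} [IsFiniteMeasure ν]

/-- The closed ball, as a sublevel set of the norm. -/
lemma measurableSet_normLe (t : ℝ) : MeasurableSet {x : E d | ‖x‖ ≤ t} :=
  measurableSet_le measurable_norm measurable_const

lemma measurable_norm_rpow (p : ℝ) : Measurable fun x : E d => ‖x‖ ^ p := by fun_prop

lemma integrableOn_norm_rpow {p : ℝ} (hp : 0 ≤ p) (t : ℝ) :
    IntegrableOn (fun x : E d => ‖x‖ ^ p) {x | ‖x‖ ≤ t} ν := by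
  refine Measure.integrableOn_of_bounded (M := t ^ p) (measure_lt_top _ _).ne
    (measurable_norm_rpow p).aestronglyMeasurable ?_
  refine (ae_restrict_iff' (measurableSet_normLe t)).2 (ae_of_all _ fun x hx => ?_)
  rw [Real.norm_of_nonneg (by positivity)]
  exact Real.rpow_le_rpow (norm_nonneg _) hx hp

lemma measurableSet_shell (s t : ℝ) : MeasurableSet {x : E d | s < ‖x‖ ∧ ‖x‖ ≤ t} :=
  (measurableSet_normGt s).inter (measurableSet_normLe t)

lemma integrableOn_shell {p : ℝ} (hp : 0 ≤ p) (s t : ℝ) :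
    IntegrableOn (fun x : E d => ‖x‖ ^ p) {x | s < ‖x‖ ∧ ‖x‖ ≤ t} ν :=
  (integrableOn_norm_rpow hp t).mono_set fun _ hx => hx.2

lemma setIntegral_shell_le {p : ℝ} (hp : 0 ≤ p) {s t : ℝ} (ht : 0 ≤ t) :
    ∫ x in {x : E d | s < ‖x‖ ∧ ‖x‖ ≤ t}, ‖x‖ ^ p ∂ν ≤ t ^ p * tailMass ν s := by
  calc ∫ x in {x : E d | s < ‖x‖ ∧ ‖x‖ ≤ t}, ‖x‖ ^ p ∂ν
      ≤ ∫ x in {x : E d | s < ‖x‖ ∧ ‖x‖ ≤ t}, t ^ p ∂ν := by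
        refine setIntegral_mono_on (integrableOn_shell hp s t)
          (integrableOn_const (measure_lt_top _ _).ne) (measurableSet_shell s t) fun x hx => ?_
        exact Real.rpow_le_rpow (norm_nonneg _) hx.2 hp
    _ = ν.real {x : E d | s < ‖x‖ ∧ ‖x‖ ≤ t} * t ^ p := by rw [setIntegral_const, smul_eq_mul]
    _ ≤ t ^ p * tailMass ν s := by
        rw [mul_comm]
        gcongr
        exact measureReal_mono fun x hx => hx.1

lemma setIntegral_normLe_add {p : ℝ} (hp : 0 ≤ p) {s t : ℝ} (hst : s ≤ t) :
    ∫ x in {x : E d | ‖x‖ ≤ t}, ‖x‖ ^ p ∂ν = ∫ x in {x : E d | ‖x‖ ≤ s}, ‖x‖ ^ p ∂ν +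
      ∫ x in {x : E d | s < ‖x‖ ∧ ‖x‖ ≤ t}, ‖x‖ ^ p ∂ν := by
  rw [← setIntegral_union _ (measurableSet_shell s t) (integrableOn_norm_rpow hp s)
    (integrableOn_shell hp s t)]
  · congr 2
    ext x
    simp only [Set.mem_ofPred_eq, Set.mem_union]
    constructor
    · intro hx
      rcases le_or_gt ‖x‖ s with h | h
      · exact Or.inl h
      · exact Or.inr ⟨h, hx⟩
    · rintro (h | h)
      · exact h.trans hst
      · exact h.2
  · exact Set.disjoint_left.2 fun x (hx : ‖x‖ ≤ s) hx' => absurd hx (not_le.2 hx'.1)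

lemma setIntegral_shell_add {p : ℝ} (hp : 0 ≤ p) {r s t : ℝ} (hrs : r ≤ s) (hst : s ≤ t) :
    ∫ x in {x : E d | r < ‖x‖ ∧ ‖x‖ ≤ t}, ‖x‖ ^ p ∂ν =
      ∫ x in {x : E d | r < ‖x‖ ∧ ‖x‖ ≤ s}, ‖x‖ ^ p ∂ν +
      ∫ x in {x : E d | s < ‖x‖ ∧ ‖x‖ ≤ t}, ‖x‖ ^ p ∂ν := by
  have h1 := setIntegral_normLe_add (ν := ν) hp hrs
  have h2 := setIntegral_normLe_add (ν := ν) hp hst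
  have h3 := setIntegral_normLe_add (ν := ν) hp (hrs.trans hst)
  linarith

/-- Karamata's bound for truncated moments of order above the index. -/
lemma RegTail.truncated_moment_le {α : ℝ} (h : RegTail (tailMass ν) α) {p : ℝ} (hp : α < p)
    (hp0 : 0 < p) : ∃ t₀ C, 1 ≤ t₀ ∧ 0 < C ∧ ∀ t, t₀ ≤ t →
      ∫ x in {x : E d | ‖x‖ ≤ t}, ‖x‖ ^ p ∂ν ≤ C * (t ^ p * tailMass ν t) := by
  set T := tailMass ν with hT
  obtain ⟨β, hβ1, hβ2⟩ := exists_between hp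
  obtain ⟨t₀, h1, ht⟩ := h.le_double hβ1
  have ht₀ : 0 < t₀ := by linarith
  set θ : ℝ := 2 ^ (β - p) with hθ
  have hθ0 : 0 < θ := by positivity
  have hθ1 : θ < 1 := Real.rpow_lt_one_of_one_lt_of_neg one_lt_two (by linarith)
  have hT2 := h.pos (2 * t₀)
  -- The first entry makes the induction close, that is $(C+2^p)\theta\le C$; the second settles the
  -- initial range $[t_0,2t_0]$.
  set C := max (2 ^ p * θ / (1 - θ)) ((2 * t₀) ^ p * ν.real Set.univ / (t₀ ^ p * T (2 * t₀)) + 1) with hC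
  have hC0 : 0 < C := lt_max_of_lt_right (by positivity)
  have hCθ : (C + 2 ^ p) * θ ≤ C := by
    have : 2 ^ p * θ / (1 - θ) ≤ C := le_max_left _ _
    rw [div_le_iff₀ (by linarith)] at this
    linarith
  have hbase : ∀ t, t₀ ≤ t → t ≤ 2 * t₀ →
      ∫ x in {x : E d | ‖x‖ ≤ t}, ‖x‖ ^ p ∂ν ≤ C * (t ^ p * T t) := by
    intro t ht1 ht2
    have hle : ∫ x in {x : E d | ‖x‖ ≤ t}, ‖x‖ ^ p ∂ν ≤ (2 * t₀) ^ p * ν.real Set.univ := by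
      calc ∫ x in {x : E d | ‖x‖ ≤ t}, ‖x‖ ^ p ∂ν ≤ ∫ x in {x : E d | ‖x‖ ≤ t}, (2 * t₀) ^ p ∂ν := by
            refine setIntegral_mono_on (integrableOn_norm_rpow hp0.le t)
              (integrableOn_const (measure_lt_top _ _).ne) (measurableSet_normLe t) fun x hx => ?_
            exact Real.rpow_le_rpow (norm_nonneg _) (le_trans hx ht2) hp0.le
        _ = ν.real {x : E d | ‖x‖ ≤ t} * (2 * t₀) ^ p := by rw [setIntegral_const, smul_eq_mul]
        _ ≤ _ := by
            rw [mul_comm]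
            gcongr
            · exact measure_ne_top _ _
            · exact Set.subset_univ _
    have hC2 : (2 * t₀) ^ p * ν.real Set.univ / (t₀ ^ p * T (2 * t₀)) ≤ C :=
      (lt_of_lt_of_le (lt_add_one _) (le_max_right _ _)).le
    rw [div_le_iff₀ (by positivity)] at hC2
    refine (hle.trans hC2).trans ?_
    have : T (2 * t₀) ≤ T t := h.anti ht2
    have ht0 : 0 ≤ t := by linarith
    gcongr
  -- Halving the radius: the ball of radius $t/2$ contributes at most $C\theta$ and the outer shell
  -- at most $2^p\theta$, in units of $t^pT(t)$.
  have hind : ∀ k : ℕ, ∀ t, t₀ ≤ t → t ≤ 2 ^ (k + 1) * t₀ →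
      ∫ x in {x : E d | ‖x‖ ≤ t}, ‖x‖ ^ p ∂ν ≤ C * (t ^ p * T t) := by
    intro k
    induction k with
    | zero => intro t ht1 ht2; exact hbase t ht1 (by simpa using ht2)
    | succ k ih =>
      intro t ht1 ht2
      rcases le_or_gt t (2 * t₀) with hle | hgt
      · exact hbase t ht1 hle
      · have hs1 : t₀ ≤ t / 2 := by linarith
        have hs2 : t / 2 ≤ 2 ^ (k + 1) * t₀ := by rw [pow_succ] at ht2; linarith
        have hi := ih (t / 2) hs1 hs2
        have hd := ht (t / 2) hs1
        rw [mul_div_cancel₀ _ two_ne_zero] at hd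
        have ht0 : 0 < t := by linarith
        have hTt := h.pos t
        rw [setIntegral_normLe_add hp0.le (by linarith : t / 2 ≤ t)]
        have hsh := setIntegral_shell_le (ν := ν) hp0.le (s := t / 2) ht0.le
        have e1 : (t / 2) ^ p = t ^ p * 2 ^ (-p) := by
          rw [Real.div_rpow ht0.le two_pos.le, Real.rpow_neg two_pos.le]; rfl
        have e2 : (2 : ℝ) ^ (-p) * 2 ^ β = θ := by
          rw [← Real.rpow_add two_pos, hθ]; ring_nf
        have e3 : (2 : ℝ) ^ p * 2 ^ (-p) = 1 := by
          rw [← Real.rpow_add two_pos]; simp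
        calc ∫ x in {x : E d | ‖x‖ ≤ t / 2}, ‖x‖ ^ p ∂ν +
              ∫ x in {x : E d | t / 2 < ‖x‖ ∧ ‖x‖ ≤ t}, ‖x‖ ^ p ∂ν
            ≤ C * ((t / 2) ^ p * T (t / 2)) + t ^ p * T (t / 2) := add_le_add hi hsh
          _ = (C * 2 ^ (-p) + 1) * t ^ p * T (t / 2) := by rw [e1]; ring
          _ ≤ (C * 2 ^ (-p) + 1) * t ^ p * (2 ^ β * T t) := by gcongr
          _ = (C + 2 ^ p) * θ * (t ^ p * T t) := by
              rw [← e2]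
              calc _ = (C * 2 ^ (-p) + 2 ^ p * 2 ^ (-p)) * 2 ^ β * (t ^ p * T t) := by rw [e3]; ring
                _ = _ := by ring
          _ ≤ C * (t ^ p * T t) := by gcongr
  refine ⟨t₀, C, h1, hC0, fun t ht1 => ?_⟩
  obtain ⟨k, -, hk⟩ := exists_nat_pow_near ((one_le_div ht₀).2 ht1) one_lt_two
  refine hind k t ht1 ?_
  rw [div_lt_iff₀ ht₀] at hk
  exact hk.le

/-- Karamata's bound for tail moments of order below the index. -/
lemma RegTail.tail_moment_le {α : ℝ} (h : RegTail (tailMass ν) α) {p : ℝ} (hp : p < α)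
    (hp0 : 0 ≤ p) : ∃ t₀ C, 1 ≤ t₀ ∧ 0 < C ∧ ∀ t, t₀ ≤ t →
      IntegrableOn (fun x : E d => ‖x‖ ^ p) {x | t < ‖x‖} ν ∧
      ∫ x in {x : E d | t < ‖x‖}, ‖x‖ ^ p ∂ν ≤ C * (t ^ p * tailMass ν t) := by
  set T := tailMass ν with hT
  obtain ⟨β, hβ1, hβ2⟩ := exists_between hp
  obtain ⟨t₀, h1, ht⟩ := h.double_le hβ2
  set θ : ℝ := 2 ^ (p - β) with hθ
  have hθ0 : 0 < θ := by positivity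
  have hθ1 : θ < 1 := Real.rpow_lt_one_of_one_lt_of_neg one_lt_two (by linarith)
  -- The fixed point of $C=2^p+C\theta$: the first shell costs $2^p$, and the remaining ones, seen
  -- from radius $2t$, cost $C\theta$.
  set C := 2 ^ p / (1 - θ) with hC
  have hC0 : 0 < C := div_pos (by positivity) (by linarith)
  have hCθ : 2 ^ p + C * θ = C := by
    have : (1 - θ) ≠ 0 := by linarith
    rw [hC]; field_simp; ring
  have hind : ∀ N : ℕ, ∀ t, t₀ ≤ t →
      ∫ x in {x : E d | t < ‖x‖ ∧ ‖x‖ ≤ 2 ^ N * t}, ‖x‖ ^ p ∂ν ≤ C * (t ^ p * T t) := by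
    intro N
    induction N with
    | zero =>
      intro t ht1
      have hTt := h.pos t
      have ht0 : 0 < t := by linarith
      have : {x : E d | t < ‖x‖ ∧ ‖x‖ ≤ 2 ^ 0 * t} = ∅ := by
        ext x
        simp only [pow_zero, one_mul, Set.mem_ofPred_eq, Set.mem_empty_iff_false, iff_false, not_and,
          not_le]
        exact fun hx => hx
      rw [this, setIntegral_empty]
      positivity
    | succ N ih =>
      intro t ht1
      have ht0 : 0 < t := by linarith
      have h2N : (1 : ℝ) ≤ 2 ^ N := one_le_pow₀ one_le_two
      have hi := ih (2 * t) (by linarith)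
      have hsh := setIntegral_shell_le (ν := ν) hp0 (s := t) (t := 2 * t) (by linarith)
      rw [setIntegral_shell_add hp0 (by linarith : t ≤ 2 * t)
        (by rw [pow_succ]; nlinarith : 2 * t ≤ 2 ^ (N + 1) * t)]
      have e0 : (2 : ℝ) ^ (N + 1) * t = 2 ^ N * (2 * t) := by ring
      rw [e0]
      have e1 : (2 * t) ^ p = 2 ^ p * t ^ p := Real.mul_rpow two_pos.le ht0.le
      have e2 : (2 : ℝ) ^ p * 2 ^ (-β) = θ := by
        rw [← Real.rpow_add two_pos, hθ]; ring_nf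
      have hd := ht t ht1
      calc _ ≤ (2 * t) ^ p * T t + C * ((2 * t) ^ p * T (2 * t)) := add_le_add hsh hi
        _ ≤ (2 * t) ^ p * T t + C * ((2 * t) ^ p * (2 ^ (-β) * T t)) := by gcongr
        _ = (2 ^ p + C * θ) * (t ^ p * T t) := by rw [e1, ← e2]; ring
        _ = C * (t ^ p * T t) := by rw [hCθ]
  refine ⟨t₀, C, h1, hC0, fun t ht1 => ?_⟩
  have ht0 : 0 < t := by linarith
  -- The shell bounds do not depend on $N$, so exhausting the tail region gives integrability and
  -- the same bound.
  have hcov : AECover (ν.restrict {x : E d | t < ‖x‖}) atTop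
      (fun N : ℕ => {x : E d | ‖x‖ ≤ 2 ^ N * t}) := by
    refine ⟨ae_of_all _ fun x => ?_, fun N => measurableSet_normLe _⟩
    have : Tendsto (fun N : ℕ => (2 : ℝ) ^ N * t) atTop atTop :=
      (tendsto_pow_atTop_atTop_of_one_lt one_lt_two).atTop_mul_const ht0
    exact this.eventually_ge_atTop ‖x‖
  have hrestr : ∀ N : ℕ, (ν.restrict {x : E d | t < ‖x‖}).restrict {x : E d | ‖x‖ ≤ 2 ^ N * t}
      = ν.restrict {x : E d | t < ‖x‖ ∧ ‖x‖ ≤ 2 ^ N * t} := by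
    intro N
    rw [Measure.restrict_restrict (measurableSet_normLe _), Set.inter_comm]
    rfl
  have hint : IntegrableOn (fun x : E d => ‖x‖ ^ p) {x | t < ‖x‖} ν := by
    refine hcov.integrable_of_integral_bounded_of_nonneg_ae (C * (t ^ p * T t)) (fun N => ?_)
      (ae_of_all _ fun x => by positivity) (Eventually.of_forall fun N => ?_)
    · rw [IntegrableOn, hrestr]; exact integrableOn_shell hp0 _ _
    · rw [hrestr]; exact hind N t ht1
  refine ⟨hint, ?_⟩
  have hl := hcov.integral_tendsto_of_countably_generated hint
  refine le_of_tendsto' hl fun N => ?_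
  rw [hrestr]
  exact hind N t ht1

lemma RegTail.integrable_norm_rpow {α : ℝ} (h : RegTail (tailMass ν) α) {p : ℝ} (hp : p < α)
    (hp0 : 0 ≤ p) : Integrable (fun x : E d => ‖x‖ ^ p) ν := by
  obtain ⟨t₀, C, -, -, hb⟩ := h.tail_moment_le hp hp0
  have h1 := (hb t₀ le_rfl).1
  have h2 := (integrableOn_norm_rpow (ν := ν) hp0 t₀).union h1
  rw [← integrableOn_univ]
  refine h2.mono_set fun x _ => ?_
  rcases le_or_gt ‖x‖ t₀ with h | h
  · exact Or.inl h
  · exact Or.inr h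

end moments

end TruncLD

/-! ### Chernoff bounds and negligibility of the small summands. -/

namespace TruncLD

variable {d : ℕ} {Ω : Type*} [MeasurableSpace Ω]

/-- Independent random vectors with common law `ν`. -/
structure IsIID (P : Measure Ω) (Hs : ℕ → Ω → E d) (ν : Measure (E d)) : Prop where
  meas : ∀ j, Measurable (Hs j)
  law : ∀ j, P.map (Hs j) = ν
  indep : iIndepFun Hs P

/-- The quadratic bound holds for all $u\le1$; beyond that the crude bound $e^b$ is used. In the
application $u>1$ forces a vector of norm above $1/h$, so the crude term is paid only with a tail
probability. -/
lemma exp_le_quadratic_add {u b : ℝ} (hub : u ≤ b) :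
    Real.exp u ≤ 1 + u + u ^ 2 + Real.exp b * (if 1 < u then 1 else 0) := by
  split_ifs with h
  · have : Real.exp u ≤ Real.exp b := Real.exp_le_exp.2 hub
    nlinarith [sq_nonneg u]
  · rw [not_lt] at h
    rcases le_or_gt (-1) u with h1 | h1
    · have := (abs_le.1 (Real.abs_exp_sub_one_sub_id_le (abs_le.2 ⟨h1, h⟩))).2
      linarith
    · have : Real.exp u ≤ 1 := Real.exp_le_one_iff.2 (by linarith)
      nlinarith

/-- The vector `x`, replaced by `0` outside the ball of radius `y`. -/
noncomputable def cut (y : ℝ) (x : E d) : E d := if ‖x‖ ≤ y then x else 0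

lemma measurable_cut (y : ℝ) : Measurable (cut y : E d → E d) :=
  Measurable.ite (measurableSet_normLe y) measurable_id measurable_const

lemma norm_cut_le {y : ℝ} (hy : 0 ≤ y) (x : E d) : ‖cut y x‖ ≤ y := by
  unfold cut
  split_ifs with h
  · exact h
  · rwa [norm_zero]

lemma norm_cut_le_norm (y : ℝ) (x : E d) : ‖cut y x‖ ≤ ‖x‖ := by
  unfold cut
  split_ifs with h
  · exact le_rfl
  · rw [norm_zero]; exact norm_nonneg _

lemma integrable_cut (ν : Measure (E d)) [IsFiniteMeasure ν] {y : ℝ} (hy : 0 ≤ y) :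
    Integrable (cut y) ν :=
  Integrable.of_bound (measurable_cut y).aestronglyMeasurable y (ae_of_all _ fun x => norm_cut_le hy x)

/-- The second moment inside the ball of radius `t`. -/
noncomputable def truncSq (ν : Measure (E d)) (t : ℝ) : ℝ := ∫ x in {x : E d | ‖x‖ ≤ t}, ‖x‖ ^ (2 : ℝ) ∂ν

lemma truncSq_nonneg (ν : Measure (E d)) (t : ℝ) : 0 ≤ truncSq ν t :=
  integral_nonneg fun x => by positivity

lemma truncSq_mono {ν : Measure (E d)} [IsFiniteMeasure ν] {s t : ℝ} (hst : s ≤ t) :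
    truncSq ν s ≤ truncSq ν t :=
  setIntegral_mono_set (integrableOn_norm_rpow two_pos.le t)
    (ae_of_all _ fun x => by positivity)
    (Eventually.of_forall fun x (hx : ‖x‖ ≤ s) => (hx.trans hst : ‖x‖ ≤ t))

section chernoff

variable {ν : Measure (E d)} [IsProbabilityMeasure ν]

lemma integral_exp_linear_le (ℓ : E d →L[ℝ] ℝ) (hℓ : ∀ x, |ℓ x| ≤ ‖x‖) {y h : ℝ} (hy : 0 ≤ y)
    (hh : 0 < h) : ∫ x, Real.exp (h * ℓ (cut y x)) ∂ν ≤
      1 + (h * ‖∫ x, cut y x ∂ν‖ + h ^ 2 * truncSq ν y + Real.exp (h * y) * tailMass ν h⁻¹) := by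
  have hb : ∀ x, |ℓ (cut y x)| ≤ y := fun x => (hℓ _).trans (norm_cut_le hy x)
  have hm : Measurable fun x => ℓ (cut y x) := ℓ.measurable.comp (measurable_cut y)
  have i1 : Integrable (fun x => ℓ (cut y x)) ν := ℓ.integrable_comp (integrable_cut ν hy)
  have i2 : Integrable (Set.indicator {x : E d | ‖x‖ ≤ y} fun x => ‖x‖ ^ (2 : ℝ)) ν :=
    (integrable_indicator_iff (measurableSet_normLe y)).2 (integrableOn_norm_rpow two_pos.le y)
  have i3 : Integrable (Set.indicator {x : E d | h⁻¹ < ‖x‖} (1 : E d → ℝ)) ν :=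
    (integrable_indicator_iff (measurableSet_normGt _)).2 (integrableOn_const (measure_lt_top _ _).ne)
  have ie : Integrable (fun x => Real.exp (h * ℓ (cut y x))) ν := by
    refine Integrable.of_bound (Real.measurable_exp.comp (hm.const_mul h)).aestronglyMeasurable
      (Real.exp (h * y)) (ae_of_all _ fun x => ?_)
    rw [Real.norm_of_nonneg (Real.exp_pos _).le, Real.exp_le_exp]
    exact mul_le_mul_of_nonneg_left (abs_le.1 (hb x)).2 hh.le
  have hpt : ∀ x, Real.exp (h * ℓ (cut y x)) ≤ 1 + h * ℓ (cut y x) +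
      h ^ 2 * Set.indicator {x : E d | ‖x‖ ≤ y} (fun x => ‖x‖ ^ (2 : ℝ)) x +
      Real.exp (h * y) * Set.indicator {x : E d | h⁻¹ < ‖x‖} (1 : E d → ℝ) x := by
    intro x
    have h1 := exp_le_quadratic_add (mul_le_mul_of_nonneg_left (abs_le.1 (hb x)).2 hh.le)
    refine h1.trans ?_
    have h2 : (h * ℓ (cut y x)) ^ 2 ≤
        h ^ 2 * Set.indicator {x : E d | ‖x‖ ≤ y} (fun x => ‖x‖ ^ (2 : ℝ)) x := by
      rw [mul_pow]
      gcongr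
      by_cases hx : ‖x‖ ≤ y
      · rw [Set.indicator_of_mem (show x ∈ {x : E d | ‖x‖ ≤ y} from hx), Real.rpow_two]
        refine sq_le_sq' ?_ ?_
        · have := (abs_le.1 (hℓ (cut y x))).1
          linarith [norm_cut_le_norm y x]
        · exact ((abs_le.1 (hℓ _)).2).trans (norm_cut_le_norm y x)
      · rw [Set.indicator_of_notMem (show x ∉ {x : E d | ‖x‖ ≤ y} from hx), cut, if_neg hx]
        simp
    have h3 : (if 1 < h * ℓ (cut y x) then (1 : ℝ) else 0) ≤
        Set.indicator {x : E d | h⁻¹ < ‖x‖} (1 : E d → ℝ) x := by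
      split_ifs with hx
      · rw [Set.indicator_of_mem]
        · rfl
        · rw [Set.mem_ofPred_eq, inv_lt_iff_one_lt_mul₀ hh]
          refine hx.trans_le ?_
          rw [mul_comm ‖x‖ h]
          exact mul_le_mul_of_nonneg_left
            ((abs_le.1 (hℓ _)).2.trans (norm_cut_le_norm y x)) hh.le
      · exact Set.indicator_nonneg (fun _ _ => zero_le_one) _
    have h4 := mul_le_mul_of_nonneg_left h3 (Real.exp_pos (h * y)).le
    linarith
  have hint := integral_mono ie ((((integrable_const 1).add (i1.const_mul h)).add
    (i2.const_mul (h ^ 2))).add (i3.const_mul (Real.exp (h * y)))) hpt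
  refine hint.trans ?_
  have e1 : ∫ x, ℓ (cut y x) ∂ν ≤ ‖∫ x, cut y x ∂ν‖ := by
    rw [ℓ.integral_comp_comm (integrable_cut ν hy)]
    exact (le_abs_self _).trans (hℓ _)
  rw [integral_add' (((integrable_const 1).add (i1.const_mul h)).add (i2.const_mul (h ^ 2)))
    (i3.const_mul (Real.exp (h * y))), integral_add' ((integrable_const 1).add (i1.const_mul h))
    (i2.const_mul (h ^ 2)), integral_add' (integrable_const 1) (i1.const_mul h),
    integral_const_mul, integral_const_mul, integral_const_mul,
    integral_indicator (measurableSet_normLe y), integral_indicator_one (measurableSet_normGt _)]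
  have e2 : ∫ _ : E d, (1 : ℝ) ∂ν = 1 := by simp
  rw [e2]
  have e3 := mul_le_mul_of_nonneg_left e1 hh.le
  rw [truncSq, tailMass]
  linarith

variable {P : Measure Ω} [IsProbabilityMeasure P] {Hs : ℕ → Ω → E d}

/-- Exponential Markov inequality, with $1+B\le e^B$ applied to each factor of the moment generating
function. -/
lemma IsIID.chernoff (hI : IsIID P Hs ν) (ℓ : E d →L[ℝ] ℝ) (hℓ : ∀ x, |ℓ x| ≤ ‖x‖) {y h : ℝ}
    (hy : 0 ≤ y) (hh : 0 < h) (x : ℝ) (n : ℕ) :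
    P.real {ω | x ≤ ℓ (∑ j ∈ Finset.range n, cut y (Hs j ω))} ≤ Real.exp (-h * x +
      n * (h * ‖∫ x, cut y x ∂ν‖ + h ^ 2 * truncSq ν y + Real.exp (h * y) * tailMass ν h⁻¹)) := by
  set B := h * ‖∫ x, cut y x ∂ν‖ + h ^ 2 * truncSq ν y + Real.exp (h * y) * tailMass ν h⁻¹
  set X : ℕ → Ω → ℝ := fun j ω => ℓ (cut y (Hs j ω)) with hX
  have hmc : Measurable fun x : E d => ℓ (cut y x) := ℓ.measurable.comp (measurable_cut y)
  have hXm : ∀ j, Measurable (X j) := fun j => hmc.comp (hI.meas j)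
  have hXi : iIndepFun X P := hI.indep.comp (fun _ x => ℓ (cut y x)) fun _ => hmc
  have hb : ∀ j ω, |X j ω| ≤ y := fun j ω => (hℓ _).trans (norm_cut_le hy _)
  have hmgf : ∀ j, mgf (X j) P h ≤ Real.exp B := by
    intro j
    have h1 : mgf (X j) P h = ∫ x, Real.exp (h * ℓ (cut y x)) ∂ν := by
      rw [mgf, ← hI.law j, integral_map (hI.meas j).aemeasurable]
      exact (Real.measurable_exp.comp (hmc.const_mul h)).aestronglyMeasurable
    rw [h1]
    refine (integral_exp_linear_le ℓ hℓ hy hh).trans ?_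
    rw [add_comm]; exact Real.add_one_le_exp B
  have hsum : ∀ ω, ℓ (∑ j ∈ Finset.range n, cut y (Hs j ω)) = (∑ j ∈ Finset.range n, X j) ω := by
    intro ω
    rw [map_sum, Finset.sum_apply]
  simp only [hsum]
  have hint : Integrable (fun ω => Real.exp (h * (∑ j ∈ Finset.range n, X j) ω)) P := by
    refine Integrable.of_bound ?_ (Real.exp (h * (n * y))) (ae_of_all _ fun ω => ?_)
    · have : Measurable (∑ j ∈ Finset.range n, X j) := by
        have e : ∑ j ∈ Finset.range n, X j = fun ω => ∑ j ∈ Finset.range n, X j ω := by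
          ext ω; rw [Finset.sum_apply]
        rw [e]
        exact Finset.measurable_sum _ fun j _ => hXm j
      exact (Real.measurable_exp.comp (this.const_mul h)).aestronglyMeasurable
    · rw [Real.norm_of_nonneg (Real.exp_pos _).le, Real.exp_le_exp]
      gcongr
      rw [Finset.sum_apply]
      calc ∑ j ∈ Finset.range n, X j ω ≤ ∑ j ∈ Finset.range n, y :=
            Finset.sum_le_sum fun j _ => (abs_le.1 (hb j ω)).2
        _ = n * y := by simp
  refine (measure_ge_le_exp_mul_mgf x hh.le hint).trans ?_
  rw [hXi.mgf_sum hXm, Real.exp_add]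
  gcongr
  calc ∏ j ∈ Finset.range n, mgf (X j) P h ≤ ∏ j ∈ Finset.range n, Real.exp B :=
        Finset.prod_le_prod (fun j _ => mgf_nonneg) fun j _ => hmgf j
    _ = Real.exp (n * B) := by rw [Finset.prod_const, Finset.card_range, ← Real.exp_nat_mul]

/-- The `i`-th coordinate. -/
noncomputable def coord (i : Fin d) : E d →L[ℝ] ℝ := EuclideanSpace.proj i

lemma coord_apply (i : Fin d) (x : E d) : coord i x = x i := rfl

lemma abs_coord_le (i : Fin d) (x : E d) : |coord i x| ≤ ‖x‖ := PiLp.norm_apply_le x i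

lemma norm_le_sum_coord (x : E d) : ‖x‖ ≤ ∑ i, |coord i x| := by
  have h : x = ∑ i, (x i) • EuclideanSpace.single i (1 : ℝ) := by
    ext j
    simp [Finset.sum_apply, Pi.single_apply]
  calc ‖x‖ = ‖∑ i, (x i) • EuclideanSpace.single i (1 : ℝ)‖ := by rw [← h]
    _ ≤ ∑ i, ‖(x i) • EuclideanSpace.single i (1 : ℝ)‖ := norm_sum_le _ _
    _ = ∑ i, |coord i x| := by
        refine Finset.sum_congr rfl fun i _ => ?_
        rw [norm_smul, PiLp.norm_single]; simp [coord_apply]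

/-- A large vector has a large coordinate of one sign or the other. Dividing by $d+1$ rather than
$d$ also covers dimension zero. -/
lemma IsIID.chernoff_norm (hI : IsIID P Hs ν) {y h x : ℝ} (hy : 0 ≤ y) (hh : 0 < h) (hx : 0 < x)
    (n : ℕ) : P.real {ω | x < ‖∑ j ∈ Finset.range n, cut y (Hs j ω)‖} ≤
      2 * d * Real.exp (-h * (x / (d + 1)) +
      n * (h * ‖∫ x, cut y x ∂ν‖ + h ^ 2 * truncSq ν y + Real.exp (h * y) * tailMass ν h⁻¹)) := by
  set B := Real.exp (-h * (x / (d + 1)) +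
      n * (h * ‖∫ x, cut y x ∂ν‖ + h ^ 2 * truncSq ν y + Real.exp (h * y) * tailMass ν h⁻¹))
  set S : Ω → E d := fun ω => ∑ j ∈ Finset.range n, cut y (Hs j ω)
  set x' := x / ((d : ℝ) + 1) with hx'
  have hx'0 : 0 < x' := by positivity
  have hsub : {ω | x < ‖S ω‖} ⊆
      ⋃ i : Fin d, ({ω | x' ≤ coord i (S ω)} ∪ {ω | x' ≤ (-coord i) (S ω)}) := by
    intro ω hω
    by_contra hcon
    simp only [Set.mem_iUnion, Set.mem_union, Set.mem_ofPred_eq, not_exists, not_or, not_le] at hcon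
    have h1 : ∀ i, |coord i (S ω)| ≤ x' := fun i => by
      rw [abs_le]
      have := hcon i
      simp only [neg_apply] at this
      exact ⟨by linarith, this.1.le⟩
    have h2 : ‖S ω‖ ≤ d * x' := by
      refine (norm_le_sum_coord _).trans ((Finset.sum_le_sum fun i _ => h1 i).trans ?_)
      simp
    have h3 : d * x' ≤ x := by
      rw [hx', mul_div_assoc', div_le_iff₀ (by positivity)]; nlinarith
    exact absurd hω (not_lt.2 (h2.trans h3))
  calc P.real {ω | x < ‖S ω‖} ≤ P.real (⋃ i : Fin d, ({ω | x' ≤ coord i (S ω)} ∪ {ω | x' ≤ (-coord i) (S ω)})) :=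
        measureReal_mono hsub
    _ ≤ ∑ i : Fin d, P.real ({ω | x' ≤ coord i (S ω)} ∪ {ω | x' ≤ (-coord i) (S ω)}) :=
        measureReal_iUnion_fintype_le _
    _ ≤ ∑ i : Fin d, (B + B) := by
        refine Finset.sum_le_sum fun i _ => (measureReal_union_le _ _).trans (add_le_add ?_ ?_)
        · exact hI.chernoff (coord i) (abs_coord_le i) hy hh x' n
        · exact hI.chernoff (-coord i) (fun x => by
            rw [neg_apply, abs_neg]; exact abs_coord_le i x) hy hh x' n
    _ = 2 * d * B := by simp; ring

end chernoff

/-- The conditions on a scaling sequence under which a large deviation of the sum comes from a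
single large summand. -/
structure LDScale (ν : Measure (E d)) (lam : ℕ → ℝ) : Prop where
  scale : Tendsto lam atTop atTop
  tail : Tendsto (fun n : ℕ => n * tailMass ν (lam n)) atTop (𝓝 0)
  var : Tendsto (fun n : ℕ => n * -Real.log (n * tailMass ν (lam n)) * truncSq ν (lam n) / lam n ^ 2)
    atTop (𝓝 0)
  mean : ∀ δ, 0 < δ → δ ≤ 1 →
    Tendsto (fun n : ℕ => n * ‖∫ x, cut (δ * lam n) x ∂ν‖ / lam n) atTop (𝓝 0)

section asymptotics

variable {ν : Measure (E d)} {α : ℝ}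

/-- For $n\ge1$ one has $nT(\lambda)\ge T(\lambda)\ge c\lambda^{-(\alpha+1)}$; the extra unit in
$\alpha+2$ absorbs $-\log c$. No upper bound of $\lambda_n$ by a power of $n$ is involved. -/
lemma RegTail.neg_log_le (h : RegTail (tailMass ν) α) (hα : 0 < α) {lam : ℕ → ℝ}
    (hlam : Tendsto lam atTop atTop) :
    ∀ᶠ n : ℕ in atTop, -Real.log (n * tailMass ν (lam n)) ≤ (α + 2) * Real.log (lam n) := by
  obtain ⟨t₀, c, h1, hc, hb⟩ := h.exists_rpow_le (β := α + 1) (by linarith) (by linarith)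
  have hl := Real.tendsto_log_atTop.comp hlam
  filter_upwards [hlam.eventually_ge_atTop t₀, eventually_ge_atTop 1,
    hl.eventually_ge_atTop (-Real.log c)] with n hn hn1 hln
  simp only [Function.comp] at hln
  have hlam0 : 0 < lam n := by linarith
  have hn1' : (1 : ℝ) ≤ n := by exact_mod_cast hn1
  have hT := h.pos (lam n)
  have h2 : c * lam n ^ (-(α + 1)) ≤ n * tailMass ν (lam n) :=
    (hb _ hn).trans (le_mul_of_one_le_left hT.le hn1')
  have h3 := Real.log_le_log (by positivity) h2
  rw [Real.log_mul hc.ne' (by positivity), Real.log_rpow hlam0] at h3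
  nlinarith

variable [IsProbabilityMeasure ν] {P : Measure Ω} [IsProbabilityMeasure P] {Hs : ℕ → Ω → E d}

/-- The sum of the small vectors is negligible on the scale of the large deviation. -/
lemma LDScale.small_sum {lam : ℕ → ℝ} (hL : LDScale ν lam) (h : RegTail (tailMass ν) α)
    (hα : 0 < α) (hI : IsIID P Hs ν) {ρ : ℝ} (hρ : 0 < ρ) :
    ∃ δ₀ > 0, ∀ δ, 0 < δ → δ ≤ δ₀ → Tendsto (fun n : ℕ =>
      P.real {ω | ρ * lam n < ‖∑ j ∈ Finset.range n, cut (δ * lam n) (Hs j ω)‖} /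
        (n * tailMass ν (lam n))) atTop (𝓝 0) := by
  set ε := ρ / ((d : ℝ) + 1) with hε
  have hε0 : 0 < ε := by positivity
  -- With $\delta\le\varepsilon/8$ the tilt chosen below gives $e^{h'\delta\lambda_n}\le
  -- e^{q_n/2}=w_n^{-1/2}$, which the factor $w_n$ from the tail more than compensates.
  refine ⟨min 1 (ε / 8), by positivity, fun δ hδ hδ0 => ?_⟩
  have hδ1 : δ ≤ 1 := hδ0.trans (min_le_left _ _)
  have hδε : δ ≤ ε / 8 := hδ0.trans (min_le_right _ _)
  set w : ℕ → ℝ := fun n => n * tailMass ν (lam n) with hw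
  set q : ℕ → ℝ := fun n => -Real.log (w n) with hq
  have hwpos : ∀ᶠ n in atTop, 0 < w n := by
    filter_upwards [eventually_gt_atTop 0] with n hn
    have := h.pos (lam n)
    positivity
  have hqtop : Tendsto q atTop atTop := by
    have h1 : Tendsto w atTop (𝓝[>] 0) := tendsto_nhdsWithin_iff.2 ⟨hL.tail, hwpos⟩
    exact tendsto_neg_atBot_atTop.comp (Real.tendsto_log_nhdsGT_zero.comp h1)
  obtain ⟨t₀, C, h1, hC, hpot⟩ := h.potter_lower (β := α + 1) (by linarith) (by linarith)
  -- the level of the exponential tilt tends to infinity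
  have hqlam : Tendsto (fun n => q n / lam n) atTop (𝓝 0) := by
    have h2 : Tendsto (fun n => (α + 2) * (Real.log (lam n) / lam n)) atTop (𝓝 0) := by
      have := (Real.isLittleO_log_id_atTop.tendsto_div_nhds_zero.comp hL.scale).const_mul (α + 2)
      rw [mul_zero] at this
      exact this
    refine squeeze_zero' ?_ ?_ h2
    · filter_upwards [hqtop.eventually_ge_atTop 0, hL.scale.eventually_gt_atTop 0] with n a b
      positivity
    · filter_upwards [h.neg_log_le hα hL.scale, hL.scale.eventually_gt_atTop 0] with n a b
      rw [← mul_div_assoc]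
      gcongr
  have hthird : Tendsto (fun n => C * (4 / ε) ^ (α + 1) * (q n ^ (α + 1) * Real.exp (-(1 / 2) * q n)))
      atTop (𝓝 0) := by
    have := ((tendsto_rpow_mul_exp_neg_mul_atTop_nhds_zero (α + 1) (1 / 2) (by norm_num)).comp
      hqtop).const_mul (C * (4 / ε) ^ (α + 1))
    rw [mul_zero] at this
    exact this
  have hfinal : Tendsto (fun n => 2 * (d : ℝ) * Real.exp (-q n)) atTop (𝓝 0) := by
    have := ((Real.tendsto_exp_neg_atTop_nhds_zero).comp hqtop).const_mul (2 * (d : ℝ))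
    rw [mul_zero] at this
    exact this
  refine squeeze_zero' ?_ ?_ hfinal
  · filter_upwards [hwpos] with n hn
    positivity
  have hpos16 : 0 < ε ^ 2 / 32 := by positivity
  filter_upwards [hwpos, hqtop.eventually_ge_atTop 1, hqtop.eventually_ge_atTop (ε / 4),
    hL.scale.eventually_gt_atTop 0,
    hqlam.eventually (ge_mem_nhds (by positivity : 0 < ε / (4 * t₀))),
    hthird.eventually (ge_mem_nhds (by norm_num : (0 : ℝ) < 1 / 2)),
    hL.var.eventually (ge_mem_nhds hpos16),
    (hL.mean δ hδ hδ1).eventually (ge_mem_nhds (by positivity : 0 < ε / 4))]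
    with n hwn hq1 hqε hlam hqt hth hvar hmean
  have hq0 : 0 < q n := by linarith
  -- The tilt for which the main exponent $-h'\varepsilon\lambda_n$ equals $-4q_n$. The error terms
  -- will be at most $q_n$, $q_n/2$ and $1/2$.
  set h' := 4 * q n / (ε * lam n) with hh'
  have hh'0 : 0 < h' := by positivity
  have hwexp : w n = Real.exp (-q n) := by rw [hq]; simp only [neg_neg]; rw [Real.exp_log hwn]
  have hch := hI.chernoff_norm (y := δ * lam n) (h := h') (x := ρ * lam n) (by positivity) hh'0
    (by positivity) n
  have T0 := h.pos (lam n)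
  have b0 : -h' * (ρ * lam n / (d + 1)) = -4 * q n := by
    rw [hh', hε]; field_simp
  have b1 : (n : ℝ) * (h' * ‖∫ x, cut (δ * lam n) x ∂ν‖) ≤ q n := by
    have e : (n : ℝ) * (h' * ‖∫ x, cut (δ * lam n) x ∂ν‖)
        = 4 * q n / ε * (n * ‖∫ x, cut (δ * lam n) x ∂ν‖ / lam n) := by
      rw [hh']; field_simp
    rw [e]
    calc _ ≤ 4 * q n / ε * (ε / 4) := by gcongr
      _ = q n := by field_simp
  have b2 : (n : ℝ) * (h' ^ 2 * truncSq ν (δ * lam n)) ≤ q n / 2 := by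
    have e0 : truncSq ν (δ * lam n) ≤ truncSq ν (lam n) :=
      truncSq_mono (mul_le_of_le_one_left hlam.le hδ1)
    have e : (n : ℝ) * (h' ^ 2 * truncSq ν (lam n))
        = 16 * q n / ε ^ 2 * (n * -Real.log (n * tailMass ν (lam n)) * truncSq ν (lam n) / lam n ^ 2) := by
      have : -Real.log (n * tailMass ν (lam n)) = q n := rfl
      rw [this, hh']; field_simp; ring
    calc (n : ℝ) * (h' ^ 2 * truncSq ν (δ * lam n)) ≤ n * (h' ^ 2 * truncSq ν (lam n)) := by gcongr
      _ ≤ 16 * q n / ε ^ 2 * (ε ^ 2 / 32) := by rw [e]; gcongr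
      _ = q n / 2 := by field_simp; norm_num
  have b3 : (n : ℝ) * (Real.exp (h' * (δ * lam n)) * tailMass ν h'⁻¹) ≤ 1 / 2 := by
    have e1 : Real.exp (h' * (δ * lam n)) ≤ Real.exp (q n / 2) := by
      rw [Real.exp_le_exp]
      have : h' * (δ * lam n) = 4 * q n / ε * δ := by rw [hh']; field_simp
      rw [this]
      calc 4 * q n / ε * δ ≤ 4 * q n / ε * (ε / 8) := by gcongr
        _ = q n / 2 := by field_simp; norm_num
    -- Potter's bound compares the level $1/h'$ with $\lambda_n$ at the price of a power of $q_n$,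
    -- harmless against $e^{-q_n/2}$.
    have e2 : tailMass ν h'⁻¹ ≤ C * (4 * q n / ε) ^ (α + 1) * tailMass ν (lam n) := by
      have hs : t₀ ≤ h'⁻¹ := by
        rw [hh', inv_div]
        rw [div_le_div_iff₀ hlam (by linarith)] at hqt
        rw [le_div_iff₀ (by positivity)]
        linarith
      have hy : 1 ≤ 4 * q n / ε := by rw [one_le_div hε0]; linarith
      have := hpot _ _ hs hy
      have e3 : 4 * q n / ε * h'⁻¹ = lam n := by rw [hh', inv_div]; field_simp
      rwa [e3] at this
    have T1 := h.pos h'⁻¹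
    calc (n : ℝ) * (Real.exp (h' * (δ * lam n)) * tailMass ν h'⁻¹)
        ≤ n * (Real.exp (q n / 2) * (C * (4 * q n / ε) ^ (α + 1) * tailMass ν (lam n))) := by gcongr
      _ = C * (4 * q n / ε) ^ (α + 1) * (Real.exp (q n / 2) * w n) := by rw [hw]; ring
      _ = C * (4 / ε) ^ (α + 1) * (q n ^ (α + 1) * Real.exp (-(1 / 2) * q n)) := by
          rw [hwexp, ← Real.exp_add, mul_div_right_comm, Real.mul_rpow (by positivity) hq0.le]
          ring_nf
      _ ≤ 1 / 2 := hth
  rw [div_le_iff₀ hwn]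
  refine hch.trans ?_
  rw [mul_assoc (2 * (d : ℝ)), hwexp, ← Real.exp_add]
  refine mul_le_mul_of_nonneg_left (Real.exp_le_exp.2 ?_) (by positivity)
  -- Since $q_n\ge1$, $-4q_n+q_n+q_n/2+1/2\le-2q_n$. The probability is thus of order $w_n^2$, one
  -- factor $w_n$ better than needed.
  rw [b0, mul_add, mul_add]
  linarith

end asymptotics

end TruncLD

/-! ### The single large summand, and removal of the truncation. -/

namespace TruncLD

variable {d : ℕ} {Ω : Type*} [MeasurableSpace Ω] {ν μ : Measure (E d)} {P : Measure Ω}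
  {Hs : ℕ → Ω → E d}

lemma IsIID.real_normGt (hI : IsIID P Hs ν) (j : ℕ) (s : ℝ) :
    P.real {ω | s < ‖Hs j ω‖} = tailMass ν s := by
  rw [tailMass, ← hI.law j, map_measureReal_apply (hI.meas j) (measurableSet_normGt s)]
  rfl

lemma IsIID.real_pair (hI : IsIID P Hs ν) {i j : ℕ} (hij : i ≠ j) (s : ℝ) :
    P.real ({ω | s < ‖Hs i ω‖} ∩ {ω | s < ‖Hs j ω‖}) = tailMass ν s ^ 2 := by
  have h := (hI.indep.indepFun hij).measure_inter_preimage_eq_mul _ _ (measurableSet_normGt s)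
    (measurableSet_normGt s)
  have h2 : P.real ({ω | s < ‖Hs i ω‖} ∩ {ω | s < ‖Hs j ω‖})
      = P.real {ω | s < ‖Hs i ω‖} * P.real {ω | s < ‖Hs j ω‖} := by
    simp only [Measure.real, ← ENNReal.toReal_mul]
    exact congrArg _ h
  rw [h2, hI.real_normGt, hI.real_normGt, sq]

lemma IsIID.measurableSet_gt (hI : IsIID P Hs ν) (j : ℕ) (s : ℝ) :
    MeasurableSet {ω | s < ‖Hs j ω‖} := (hI.meas j) (measurableSet_normGt s)

lemma IsIID.measurableSet_cutSum (hI : IsIID P Hs ν) (n : ℕ) (y x : ℝ) :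
    MeasurableSet {ω | x < ‖∑ j ∈ Finset.range n, cut y (Hs j ω)‖} :=
  measurableSet_lt measurable_const
    (Finset.measurable_sum _ fun j _ => (measurable_cut y).comp (hI.meas j)).norm

/-- Deterministic comparison of a function of a sum with the sum of its values, when `g` vanishes
near the origin: the error is due to small summands adding up or to two large summands. -/
lemma abs_sub_sum_le {g : E d → ℝ} {C r ρ δ η : ℝ} (hC : ∀ x, |g x| ≤ C)
    (hg0 : ∀ x, ‖x‖ ≤ r → g x = 0) (hρr : ρ ≤ r / 2) (hδr : δ ≤ r / 2) (hr : 0 < r) (hη : 0 ≤ η)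
    (hunif : ∀ x y, ‖x - y‖ ≤ ρ → |g x - g y| ≤ η) (x : ℕ → E d) (n : ℕ) :
    |g (∑ j ∈ Finset.range n, x j) - ∑ j ∈ Finset.range n, g (x j)| ≤
      η * ∑ j ∈ Finset.range n, (if r / 2 < ‖x j‖ then 1 else 0) +
      2 * C * (if ρ < ‖∑ j ∈ Finset.range n, cut δ (x j)‖ then 1 else 0) +
      2 * C * ∑ p ∈ (Finset.range n).offDiag, (if δ < ‖x p.1‖ ∧ δ < ‖x p.2‖ then 1 else 0) := by
  have hC0 : 0 ≤ C := (abs_nonneg _).trans (hC 0)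
  set J := (Finset.range n).filter fun j => δ < ‖x j‖ with hJ
  set A : ℝ := ∑ j ∈ Finset.range n, (if r / 2 < ‖x j‖ then 1 else 0) with hA
  set K : ℝ := ∑ p ∈ (Finset.range n).offDiag, (if δ < ‖x p.1‖ ∧ δ < ‖x p.2‖ then 1 else 0) with hK
  have hA0 : 0 ≤ A := Finset.sum_nonneg fun j _ => by split_ifs <;> norm_num
  -- Ordered pairs of distinct large summands are counted, so $k$ large summands give $k^2-k$.
  have hKJ : K = J.card * J.card - J.card := by
    have h1 : K = (((Finset.range n).offDiag.filter fun p => δ < ‖x p.1‖ ∧ δ < ‖x p.2‖).card : ℝ) := by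
      rw [hK, Finset.sum_boole]
    have h2 : ((Finset.range n).offDiag.filter fun p => δ < ‖x p.1‖ ∧ δ < ‖x p.2‖) = J.offDiag := by
      ext p
      simp only [hJ, Finset.mem_filter, Finset.mem_offDiag]
      tauto
    rw [h1, h2, Finset.offDiag_card, Nat.cast_sub (Nat.le_mul_self _)]
    push_cast; ring
  have hK0 : 0 ≤ K := Finset.sum_nonneg fun j _ => by split_ifs <;> norm_num
  have hsplit : ∑ j ∈ Finset.range n, x j = ∑ j ∈ Finset.range n, cut δ (x j) + ∑ j ∈ J, x j := by
    rw [hJ, Finset.sum_filter, ← Finset.sum_add_distrib]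
    refine Finset.sum_congr rfl fun j _ => ?_
    unfold cut
    split_ifs with h1 h2 h2
    · exact absurd h2 (not_lt.2 h1)
    · rw [add_zero]
    · rw [zero_add]
    · exact absurd (not_le.1 h1) h2
  have hgsum : ∑ j ∈ Finset.range n, g (x j) = ∑ j ∈ J, g (x j) := by
    rw [hJ, Finset.sum_filter]
    refine Finset.sum_congr rfl fun j _ => ?_
    split_ifs with h1
    · rfl
    · exact hg0 _ (by linarith [not_lt.1 h1])
  rw [hgsum]
  have hcrude : |g (∑ j ∈ Finset.range n, x j) - ∑ j ∈ J, g (x j)| ≤ C + J.card * C := by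
    refine (abs_sub _ _).trans (add_le_add (hC _) ?_)
    refine (Finset.abs_sum_le_sum_abs _ _).trans ?_
    refine (Finset.sum_le_sum fun j _ => hC (x j)).trans ?_
    rw [Finset.sum_const, nsmul_eq_mul]
  rcases le_or_gt 2 J.card with h2 | h2
  · have h2' : (2 : ℝ) ≤ J.card := by exact_mod_cast h2
    have hb : 0 ≤ 2 * C * (if ρ < ‖∑ j ∈ Finset.range n, cut δ (x j)‖ then (1 : ℝ) else 0) := by
      split_ifs <;> simp [hC0]
    have : C + J.card * C ≤ 2 * C * K := by
      rw [hKJ]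
      -- For $k\ge2$ large summands the trivial bound $(1+k)C$ is absorbed by the pair count.
      have h3 : 1 + (J.card : ℝ) ≤ 2 * (J.card * J.card - J.card) := by nlinarith
      nlinarith
    have := mul_nonneg hη hA0
    linarith
  · have hcard : (J.card : ℝ) ≤ 1 := by exact_mod_cast Nat.le_of_lt_succ h2
    split_ifs with hB
    · have := mul_nonneg hη hA0
      have := mul_nonneg hC0 hK0
      have : J.card * C ≤ C := mul_le_of_le_one_left hC0 hcard
      linarith
    · rw [not_lt] at hB
      have hrest : |g (∑ j ∈ Finset.range n, x j) - ∑ j ∈ J, g (x j)| ≤ η * A := by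
        -- With a negligible small part and at most one large summand, either both sides vanish near
        -- the origin or the single summand exceeds $r/2$, and uniform continuity costs $\eta$.
        rcases Nat.lt_or_ge J.card 1 with h0 | h0
        · have hJ0 : J = ∅ := Finset.card_eq_zero.1 (by omega)
          rw [hsplit, hJ0, Finset.sum_empty, Finset.sum_empty, add_zero, hg0 _ (by linarith)]
          simpa using mul_nonneg hη hA0
        · obtain ⟨k, hk⟩ := Finset.card_eq_one.1 (by omega : J.card = 1)
          rw [hsplit, hk, Finset.sum_singleton, Finset.sum_singleton]
          rcases le_or_gt ‖x k‖ (r / 2) with hxk | hxk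
          · rw [hg0 (x k) (by linarith), hg0, sub_zero, abs_zero]
            · exact mul_nonneg hη hA0
            · exact (norm_add_le _ _).trans (by linarith)
          · refine (hunif _ _ (by rwa [add_sub_cancel_right])).trans ?_
            have hkn : k ∈ Finset.range n := by
              have : k ∈ J := by rw [hk]; exact Finset.mem_singleton_self k
              exact (Finset.mem_filter.1 this).1
            have h1A : 1 ≤ A := by
              have := Finset.single_le_sum (f := fun j => if r / 2 < ‖x j‖ then (1 : ℝ) else 0)
                (fun j _ => by split_ifs <;> norm_num) hkn
              simp only [if_pos hxk] at this
              exact this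
            nlinarith
      have := mul_nonneg hC0 hK0
      linarith

section

variable [IsProbabilityMeasure ν] [IsProbabilityMeasure P]

lemma IsTest.integrable_comp {g : E d → ℝ} (hg : IsTest g) {X : Ω → E d} (hX : Measurable X) (c : ℝ) :
    Integrable (fun ω => g (c • X ω)) P := by
  obtain ⟨C, -, hC⟩ := hg.bounded
  have hm : Measurable fun x : E d => g (c • x) :=
    (hg.continuous.comp (continuous_const_smul c)).measurable
  exact Integrable.of_bound (hm.comp hX).aestronglyMeasurable C (ae_of_all _ fun ω => hC _)

omit [IsProbabilityMeasure ν] [IsProbabilityMeasure P] in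
lemma IsIID.measurable_sum (hI : IsIID P Hs ν) (n : ℕ) :
    Measurable fun ω => ∑ j ∈ Finset.range n, Hs j ω :=
  Finset.measurable_sum _ fun j _ => hI.meas j

omit [IsProbabilityMeasure ν] in
lemma IsIID.integral_sum_dil (hI : IsIID P Hs ν) {g : E d → ℝ} (hg : IsTest g) (t : ℝ) (n : ℕ) :
    Integrable (fun ω => ∑ j ∈ Finset.range n, g (t⁻¹ • Hs j ω)) P ∧
    ∫ ω, ∑ j ∈ Finset.range n, g (t⁻¹ • Hs j ω) ∂P = n * dilInt ν g t := by
  have hi : ∀ j, Integrable (fun ω => g (t⁻¹ • Hs j ω)) P := fun j =>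
    hg.integrable_comp (hI.meas j) _
  refine ⟨integrable_finsetSum _ fun j _ => hi j, ?_⟩
  rw [integral_finsetSum _ fun j _ => hi j]
  have : ∀ j, ∫ ω, g (t⁻¹ • Hs j ω) ∂P = dilInt ν g t := by
    intro j
    rw [dilInt, ← hI.law j, integral_map (hI.meas j).aemeasurable]
    exact (hg.continuous.comp (continuous_const_smul _)).aestronglyMeasurable
  simp [this]

-- Expectation of the deterministic comparison; pairwise independence makes the term with two large
-- summands quadratic in the tail.
omit [IsProbabilityMeasure ν] in
lemma IsIID.integral_abs_le (hI : IsIID P Hs ν) {g : E d → ℝ} (hg : IsTest g) {C r ρ δ η : ℝ}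
    (hC : ∀ x, |g x| ≤ C) (hg0 : ∀ x, ‖x‖ ≤ r → g x = 0) (hρr : ρ ≤ r / 2) (hδr : δ ≤ r / 2)
    (hr : 0 < r) (hη : 0 ≤ η) (hunif : ∀ x y, ‖x - y‖ ≤ ρ → |g x - g y| ≤ η) {t : ℝ} (ht : 0 < t)
    (n : ℕ) :
    |∫ ω, g (t⁻¹ • ∑ j ∈ Finset.range n, Hs j ω) ∂P - n * dilInt ν g t| ≤
      η * (n * tailMass ν (r / 2 * t)) +
      2 * C * P.real {ω | ρ * t < ‖∑ j ∈ Finset.range n, cut (δ * t) (Hs j ω)‖} +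
      2 * C * (n * tailMass ν (δ * t)) ^ 2 := by
  have hC0 : 0 ≤ C := (abs_nonneg _).trans (hC 0)
  obtain ⟨hi2, he2⟩ := hI.integral_sum_dil hg t n
  have hi1 : Integrable (fun ω => g (t⁻¹ • ∑ j ∈ Finset.range n, Hs j ω)) P :=
    hg.integrable_comp (hI.measurable_sum n) _
  rw [← he2, ← integral_sub hi1 hi2]
  set BA : ℕ → Set Ω := fun j => {ω | r / 2 * t < ‖Hs j ω‖}
  set BB : Set Ω := {ω | ρ * t < ‖∑ j ∈ Finset.range n, cut (δ * t) (Hs j ω)‖}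
  set BK : ℕ × ℕ → Set Ω := fun p => {ω | δ * t < ‖Hs p.1 ω‖} ∩ {ω | δ * t < ‖Hs p.2 ω‖}
  have mA : ∀ j, MeasurableSet (BA j) := fun j => hI.measurableSet_gt j _
  have mB : MeasurableSet BB := hI.measurableSet_cutSum n _ _
  have mK : ∀ p, MeasurableSet (BK p) := fun p =>
    (hI.measurableSet_gt p.1 _).inter (hI.measurableSet_gt p.2 _)
  have iind : ∀ {S : Set Ω}, MeasurableSet S → Integrable (S.indicator (1 : Ω → ℝ)) P := fun hS =>
    (integrable_indicator_iff hS).2 (integrableOn_const (measure_lt_top _ _).ne)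
  have iA : Integrable (fun ω => ∑ j ∈ Finset.range n, (BA j).indicator (1 : Ω → ℝ) ω) P :=
    integrable_finsetSum _ fun j _ => iind (mA j)
  have iK : Integrable (fun ω => ∑ p ∈ (Finset.range n).offDiag, (BK p).indicator (1 : Ω → ℝ) ω) P :=
    integrable_finsetSum _ fun j _ => iind (mK j)
  have hpt : ∀ ω, ‖g (t⁻¹ • ∑ j ∈ Finset.range n, Hs j ω) - ∑ j ∈ Finset.range n, g (t⁻¹ • Hs j ω)‖ ≤
      η * ∑ j ∈ Finset.range n, (BA j).indicator (1 : Ω → ℝ) ω +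
      2 * C * BB.indicator (1 : Ω → ℝ) ω +
      2 * C * ∑ p ∈ (Finset.range n).offDiag, (BK p).indicator (1 : Ω → ℝ) ω := by
    intro ω
    have h := abs_sub_sum_le hC hg0 hρr hδr hr hη hunif (fun j => t⁻¹ • Hs j ω) n
    have hn : ∀ (s : ℝ) (v : E d), s < ‖t⁻¹ • v‖ ↔ s * t < ‖v‖ := by
      intro s v
      rw [norm_smul, norm_inv, Real.norm_of_nonneg ht.le, lt_inv_mul_iff₀ ht, mul_comm]
    have hcut : ∀ v : E d, cut δ (t⁻¹ • v) = t⁻¹ • cut (δ * t) v := by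
      intro v
      unfold cut
      have : ‖t⁻¹ • v‖ ≤ δ ↔ ‖v‖ ≤ δ * t := by rw [← not_lt, hn, not_lt]
      by_cases hv : ‖v‖ ≤ δ * t
      · rw [if_pos (this.2 hv), if_pos hv]
      · rw [if_neg (fun h => hv (this.1 h)), if_neg hv, smul_zero]
    simp only [← Finset.smul_sum, hcut, hn] at h
    simp only [Set.indicator_apply, Pi.one_apply]
    exact h
  have hle := norm_integral_le_of_norm_le (((iA.const_mul η).add ((iind mB).const_mul (2 * C))).add
    (iK.const_mul (2 * C))) (ae_of_all _ hpt)
  have heq : η * ∑ j ∈ Finset.range n, P.real (BA j) + 2 * C * P.real BB +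
      2 * C * ∑ p ∈ (Finset.range n).offDiag, P.real (BK p) =
      ∫ ω, (((fun ω => η * ∑ j ∈ Finset.range n, (BA j).indicator (1 : Ω → ℝ) ω) +
        fun ω => 2 * C * BB.indicator (1 : Ω → ℝ) ω) +
        fun ω => 2 * C * ∑ p ∈ (Finset.range n).offDiag, (BK p).indicator (1 : Ω → ℝ) ω) ω ∂P := by
    rw [integral_add' ((iA.const_mul η).add ((iind mB).const_mul (2 * C))) (iK.const_mul (2 * C)),
      integral_add' (iA.const_mul η) ((iind mB).const_mul (2 * C)), integral_const_mul,
      integral_const_mul, integral_const_mul, integral_finsetSum _ fun j _ => iind (mA j),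
      integral_finsetSum _ fun j _ => iind (mK j), integral_indicator_one mB]
    simp only [integral_indicator_one (mA _), integral_indicator_one (mK _)]
  refine (hle.trans heq.ge).trans ?_
  · have e1 : ∑ j ∈ Finset.range n, P.real (BA j) = n * tailMass ν (r / 2 * t) := by
      simp [BA, hI.real_normGt]
    have e2 : ∑ p ∈ (Finset.range n).offDiag, P.real (BK p) ≤ (n * tailMass ν (δ * t)) ^ 2 := by
      have : ∀ p ∈ (Finset.range n).offDiag, P.real (BK p) = tailMass ν (δ * t) ^ 2 := fun p hp =>
        hI.real_pair (Finset.mem_offDiag.1 hp).2.2 _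
      rw [Finset.sum_congr rfl this, Finset.sum_const, nsmul_eq_mul, mul_pow]
      gcongr
      rw [Finset.offDiag_card, Finset.card_range, sq]
      exact_mod_cast Nat.sub_le _ _
    rw [e1]
    gcongr

omit [IsProbabilityMeasure ν] in
lemma LDScale.pos {lam : ℕ → ℝ} (hL : LDScale ν lam) : ∀ᶠ n in atTop, 0 < lam n :=
  hL.scale.eventually_gt_atTop 0

/-- Large deviations of the sum, without truncation: a single summand is responsible. -/
theorem LDScale.sum_tendsto {lam : ℕ → ℝ} (hL : LDScale ν lam) {α : ℝ} (hα : 0 < α)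
    (h : RegVar ν μ α) (hI : IsIID P Hs ν) {g : E d → ℝ} (hg : IsTest g) :
    Tendsto (fun n : ℕ => (∫ ω, g ((lam n)⁻¹ • ∑ j ∈ Finset.range n, Hs j ω) ∂P) /
      (n * tailMass ν (lam n))) atTop (𝓝 ((∫ x, g x ∂μ) / tailMass μ 1)) := by
  obtain ⟨C, hC0, hC⟩ := hg.bounded
  obtain ⟨r, hr, hg0⟩ := hg.vanish
  have hw : ∀ᶠ n : ℕ in atTop, 0 < n * tailMass ν (lam n) := by
    filter_upwards [eventually_gt_atTop 0] with n hn
    have := h.pos (lam n)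
    positivity
  have hmain : Tendsto (fun n : ℕ => n * dilInt ν g (lam n) / (n * tailMass ν (lam n))) atTop
      (𝓝 ((∫ x, g x ∂μ) / tailMass μ 1)) := by
    refine ((h.lim g hg).comp hL.scale).congr' ?_
    filter_upwards [eventually_gt_atTop 0] with n hn
    have : (n : ℝ) ≠ 0 := by positivity
    rw [mul_div_mul_left _ _ this]; rfl
  suffices hd : Tendsto (fun n : ℕ => (∫ ω, g ((lam n)⁻¹ • ∑ j ∈ Finset.range n, Hs j ω) ∂P) /
      (n * tailMass ν (lam n)) - n * dilInt ν g (lam n) / (n * tailMass ν (lam n))) atTop (𝓝 0) by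
    have := hd.add hmain
    simpa using this
  rw [Metric.tendsto_nhds]
  intro ε hε
  set κ := (r / 2) ^ (-α) with hκ
  have hκ0 : 0 < κ := by positivity
  -- The number of summands beyond $r\lambda_n/2$ has mean about $\kappa w_n$, so this choice leaves
  -- a limiting relative error $\varepsilon/2$.
  set η := ε / (2 * κ) with hη
  have hη0 : 0 < η := by positivity
  obtain ⟨ρ₀, hρ₀, hunif⟩ := hg.uniform hη0
  obtain ⟨ρ, hρ, hρρ₀, hρr⟩ : ∃ ρ, 0 < ρ ∧ ρ ≤ ρ₀ ∧ ρ ≤ r / 2 :=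
    ⟨min ρ₀ (r / 2), by positivity, min_le_left _ _, min_le_right _ _⟩
  obtain ⟨δ₀, hδ₀, hsmall⟩ := hL.small_sum h.regTail hα hI hρ
  obtain ⟨δ, hδ, hδδ₀, hδr⟩ : ∃ δ, 0 < δ ∧ δ ≤ δ₀ ∧ δ ≤ r / 2 :=
    ⟨min δ₀ (r / 2), by positivity, min_le_left _ _, min_le_right _ _⟩
  have hs := hsmall δ hδ hδδ₀
  have t1 : Tendsto (fun n : ℕ => η * (tailMass ν (r / 2 * lam n) / tailMass ν (lam n))) atTop
      (𝓝 (η * κ)) := ((h.tail (r / 2) (by positivity)).comp hL.scale).const_mul η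
  have t2 : Tendsto (fun n : ℕ => 2 * C * (P.real {ω | ρ * lam n <
      ‖∑ j ∈ Finset.range n, cut (δ * lam n) (Hs j ω)‖} / (n * tailMass ν (lam n)))) atTop
      (𝓝 (2 * C * 0)) := hs.const_mul (2 * C)
  have t3 : Tendsto (fun n : ℕ => 2 * C * ((n * tailMass ν (lam n)) *
      (tailMass ν (δ * lam n) / tailMass ν (lam n)) ^ 2)) atTop
      (𝓝 (2 * C * (0 * (δ ^ (-α)) ^ 2))) :=
    (hL.tail.mul (((h.tail δ hδ).comp hL.scale).pow 2)).const_mul (2 * C)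
  have t := (t1.add t2).add t3
  have hlt : η * κ + 2 * C * 0 + 2 * C * (0 * (δ ^ (-α)) ^ 2) < ε := by
    have : η * κ = ε / 2 := by rw [hη]; field_simp
    rw [this]; simp only [mul_zero, zero_mul, add_zero]; linarith
  filter_upwards [t.eventually (gt_mem_nhds hlt), hw, hL.pos, eventually_gt_atTop 0]
    with n hn hwn hlam hn0
  have hT := h.pos (lam n)
  have hn0' : (0 : ℝ) < n := by exact_mod_cast hn0
  rw [dist_zero_right, ← sub_div, norm_div, Real.norm_of_nonneg hwn.le, div_lt_iff₀ hwn]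
  have hb := hI.integral_abs_le hg hC hg0 hρr hδr hr hη0.le
    (fun x y hxy => hunif x y (hxy.trans hρρ₀)) hlam n
  refine hb.trans_lt ?_
  refine lt_of_eq_of_lt ?_ (mul_lt_mul_of_pos_right hn hwn)
  field_simp

lemma truncate_eq {m : ℝ} {x : E d} (hx : ‖x‖ ≤ m) (l : ℝ) : truncate m x l = x := if_pos hx

lemma measurable_truncate (m : ℝ) {X : Ω → E d} {Y : Ω → ℝ} (hX : Measurable X) (hY : Measurable Y) :
    Measurable fun ω => truncate m (X ω) (Y ω) := by
  unfold truncate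
  refine Measurable.ite (measurableSet_le hX.norm measurable_const) hX ?_
  exact (measurable_const.add hY).smul (hX.norm.inv.smul hX)

lemma measurable_rowSum {M : ℕ → ℝ} {L : ℕ → Ω → ℝ} (hH : ∀ j, Measurable (Hs j))
    (hL : ∀ j, Measurable (L j)) (n : ℕ) : Measurable (rowSum M Hs L n) :=
  Finset.measurable_sum (Finset.range n) fun j _ => measurable_truncate (M n) (hH j) (hL j)

/-- Truncation above a level much larger than the scale does not matter. -/
theorem LDScale.rowSum_tendsto {lam : ℕ → ℝ} (hL : LDScale ν lam) {α : ℝ} (hα : 0 < α)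
    (h : RegVar ν μ α) (hI : IsIID P Hs ν) {L : ℕ → Ω → ℝ} (hLm : ∀ j, Measurable (L j))
    {M : ℕ → ℝ} (hM : Tendsto (fun n => M n / lam n) atTop atTop) {g : E d → ℝ} (hg : IsTest g) :
    Tendsto (fun n : ℕ => (∫ ω, g ((lam n)⁻¹ • rowSum M Hs L n ω) ∂P) /
      (n * tailMass ν (lam n))) atTop (𝓝 ((∫ x, g x ∂μ) / tailMass μ 1)) := by
  obtain ⟨C, hC0, hC⟩ := hg.bounded
  have hmain := hL.sum_tendsto hα h hI hg
  -- For each fixed $K$, eventually $M_n\ge K\lambda_n$, so the ratio is at most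
  -- $T(K\lambda_n)/T(\lambda_n)\to K^{-\alpha}$, which is small for large $K$.
  have hTM : Tendsto (fun n => tailMass ν (M n) / tailMass ν (lam n)) atTop (𝓝 0) := by
    rw [tendsto_order]
    constructor
    · intro a ha
      filter_upwards with n
      have := h.pos (M n)
      have := h.pos (lam n)
      refine ha.trans (by positivity)
    · intro a ha
      have hk := (tendsto_rpow_neg_atTop hα).eventually (gt_mem_nhds ha)
      obtain ⟨K, hK, hK0⟩ := (hk.and (eventually_gt_atTop 0)).exists
      filter_upwards [((h.tail K hK0).comp hL.scale).eventually (gt_mem_nhds hK),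
        hM.eventually_ge_atTop K, hL.pos] with n hn hMn hlam
      refine lt_of_le_of_lt ?_ hn
      have := h.pos (lam n)
      simp only [Function.comp]
      gcongr
      refine tailMass_antitone ?_
      rwa [le_div_iff₀ hlam] at hMn
  suffices hd : Tendsto (fun n : ℕ => (∫ ω, g ((lam n)⁻¹ • rowSum M Hs L n ω) ∂P) /
      (n * tailMass ν (lam n)) - (∫ ω, g ((lam n)⁻¹ • ∑ j ∈ Finset.range n, Hs j ω) ∂P) /
      (n * tailMass ν (lam n))) atTop (𝓝 0) by
    have := hd.add hmain
    simpa using this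
  have hlim := hTM.const_mul (2 * C)
  rw [mul_zero] at hlim
  refine squeeze_zero_norm' ?_ hlim
  filter_upwards [eventually_gt_atTop 0] with n hn
  have hn0' : (0 : ℝ) < n := by exact_mod_cast hn
  have hT := h.pos (lam n)
  -- Off this event no summand is truncated and the two sums are equal.
  set B : Set Ω := ⋃ j : Fin n, {ω | M n < ‖Hs j ω‖} with hB
  have mB : MeasurableSet B := MeasurableSet.iUnion fun j => hI.measurableSet_gt j _
  have hPB : P.real B ≤ n * tailMass ν (M n) := by
    refine (measureReal_iUnion_fintype_le _).trans ?_
    simp [hI.real_normGt]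
  have m1 := measurable_rowSum (M := M) hI.meas hLm n
  have i1 : Integrable (fun ω => g ((lam n)⁻¹ • rowSum M Hs L n ω)) P :=
    hg.integrable_comp m1 _
  have i2 : Integrable (fun ω => g ((lam n)⁻¹ • ∑ j ∈ Finset.range n, Hs j ω)) P :=
    hg.integrable_comp (hI.measurable_sum n) _
  have iB : Integrable (fun ω => 2 * C * B.indicator (1 : Ω → ℝ) ω) P :=
    ((integrable_indicator_iff mB).2 (integrableOn_const (measure_lt_top _ _).ne)).const_mul _
  have hpt : ∀ ω, ‖g ((lam n)⁻¹ • rowSum M Hs L n ω) - g ((lam n)⁻¹ • ∑ j ∈ Finset.range n, Hs j ω)‖ ≤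
      2 * C * B.indicator (1 : Ω → ℝ) ω := by
    intro ω
    by_cases hω : ω ∈ B
    · rw [Set.indicator_of_mem hω, Pi.one_apply, mul_one, Real.norm_eq_abs]
      refine (abs_sub _ _).trans ?_
      linarith [hC ((lam n)⁻¹ • rowSum M Hs L n ω), hC ((lam n)⁻¹ • ∑ j ∈ Finset.range n, Hs j ω)]
    · rw [Set.indicator_of_notMem hω, mul_zero]
      have : rowSum M Hs L n ω = ∑ j ∈ Finset.range n, Hs j ω := by
        refine Finset.sum_congr rfl fun j hj => truncate_eq ?_ _
        by_contra hlt
        exact hω (Set.mem_iUnion.2 ⟨⟨j, Finset.mem_range.1 hj⟩, not_le.1 hlt⟩)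
      rw [this, sub_self, norm_zero]
  have hdiff := norm_integral_le_of_norm_le iB (ae_of_all _ hpt)
  rw [integral_sub i1 i2, integral_const_mul, integral_indicator_one mB] at hdiff
  rw [← sub_div, norm_div, Real.norm_of_nonneg (by positivity : 0 ≤ n * tailMass ν (lam n)),
    div_le_iff₀ (by positivity)]
  refine hdiff.trans ?_
  calc 2 * C * P.real B ≤ 2 * C * (n * tailMass ν (M n)) := by gcongr
    _ = _ := by field_simp

end

end TruncLD

/-! ### Admissible scales in the three ranges of the index. -/

namespace TruncLD

variable {d : ℕ} {ν : Measure (E d)} {α : ℝ}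

/-- The truncated mean is at most of the order of the tail. -/
def CutMeanBound (ν : Measure (E d)) : Prop :=
  ∃ t₀ C, 1 ≤ t₀ ∧ 0 < C ∧ ∀ y, t₀ ≤ y → ‖∫ x, cut y x ∂ν‖ ≤ C * (y * tailMass ν y)

lemma cut_eq_indicator (y : ℝ) : (cut y : E d → E d) = Set.indicator {x : E d | ‖x‖ ≤ y} id := by
  ext1 x
  simp [cut, Set.indicator_apply]

section

variable [IsFiniteMeasure ν]

lemma integral_cut_eq (ν : Measure (E d)) (y : ℝ) :
    ∫ x, cut y x ∂ν = ∫ x in {x : E d | ‖x‖ ≤ y}, x ∂ν := by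
  rw [cut_eq_indicator, integral_indicator (measurableSet_normLe y)]
  rfl

lemma RegTail.cutMeanBound_of_lt_one (h : RegTail (tailMass ν) α) (hα : α < 1) :
    CutMeanBound ν := by
  obtain ⟨t₀, C, h1, hC, hb⟩ := h.truncated_moment_le hα one_pos
  refine ⟨t₀, C, h1, hC, fun y hy => ?_⟩
  have := hb y hy
  simp only [Real.rpow_one] at this
  refine le_trans ?_ this
  rw [integral_cut_eq]
  exact norm_integral_le_integral_norm _

omit [IsFiniteMeasure ν] in
lemma RegTail.cutMeanBound_of_symm (h : RegTail (tailMass ν) α) (hs : ν.map (fun x => -x) = ν) :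
    CutMeanBound ν := by
  refine ⟨1, 1, le_rfl, one_pos, fun y hy => ?_⟩
  have h1 : ∫ x, cut y x ∂ν = -∫ x, cut y x ∂ν := by
    conv_lhs => rw [← hs]
    rw [integral_map measurable_neg.aemeasurable (measurable_cut y).aestronglyMeasurable,
      ← integral_neg]
    refine integral_congr_ae (ae_of_all _ fun x => ?_)
    simp only [cut, norm_neg]
    split_ifs <;> simp
  have h2 : ∫ x, cut y x ∂ν = 0 := by
    have h2 : (2 : ℝ) • ∫ x, cut y x ∂ν = 0 := by
      rw [two_smul]; nth_rewrite 1 [h1]; exact neg_add_cancel _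
    exact (smul_eq_zero.1 h2).resolve_left two_ne_zero
  rw [h2, norm_zero]
  have := h.pos y
  positivity

/-- For a centred law the mean inside a ball is minus the mean outside, which Karamata's tail bound
controls. -/
lemma RegTail.cutMeanBound_of_centered (h : RegTail (tailMass ν) α) (hα : 1 < α)
    (h0 : ∫ x, x ∂ν = 0) : CutMeanBound ν := by
  obtain ⟨t₀, C, h1, hC, hb⟩ := h.tail_moment_le hα zero_le_one
  refine ⟨t₀, C, h1, hC, fun y hy => ?_⟩
  have hi : Integrable (fun x : E d => x) ν := by
    have := h.integrable_norm_rpow hα zero_le_one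
    simp only [Real.rpow_one] at this
    exact (integrable_norm_iff measurable_id.aestronglyMeasurable).1 this
  have h2 := (hb y hy).2
  simp only [Real.rpow_one] at h2
  have hadd := integral_add_compl (measurableSet_normLe (d := d) y) hi
  have hc : {x : E d | ‖x‖ ≤ y}ᶜ = {x : E d | y < ‖x‖} := by
    ext x; simp
  rw [h0, hc] at hadd
  rw [integral_cut_eq, eq_neg_of_add_eq_zero_left hadd, norm_neg]
  exact (norm_integral_le_integral_norm _).trans h2

end

/-- The mean condition follows from the tail condition: $n\|E\,\mathrm{cut}\|/\lambda_n\le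
C\delta\,nT(\delta\lambda_n)$, which is comparable to $nT(\lambda_n)$. -/
lemma LDScale.of_cutMeanBound {lam : ℕ → ℝ} (h : RegTail (tailMass ν) α) (hc : CutMeanBound ν)
    (hscale : Tendsto lam atTop atTop)
    (htail : Tendsto (fun n : ℕ => n * tailMass ν (lam n)) atTop (𝓝 0))
    (hvar : Tendsto (fun n : ℕ => n * -Real.log (n * tailMass ν (lam n)) * truncSq ν (lam n) / lam n ^ 2)
      atTop (𝓝 0)) : LDScale ν lam := by
  refine ⟨hscale, htail, hvar, fun δ hδ _ => ?_⟩
  obtain ⟨t₀, C, h1, hC, hb⟩ := hc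
  have hlim : Tendsto (fun n : ℕ => C * δ * ((n * tailMass ν (lam n)) *
      (tailMass ν (δ * lam n) / tailMass ν (lam n)))) atTop (𝓝 (C * δ * (0 * δ ^ (-α)))) :=
    (htail.mul ((h.ratio δ hδ).comp hscale)).const_mul _
  rw [zero_mul, mul_zero] at hlim
  refine squeeze_zero' ?_ ?_ hlim
  · filter_upwards [hscale.eventually_gt_atTop 0] with n hn
    positivity
  · filter_upwards [hscale.eventually_gt_atTop 0, hscale.eventually_ge_atTop (t₀ / δ)] with n hn hn2
    rw [div_le_iff₀ hδ, mul_comm] at hn2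
    have := hb _ hn2
    have hT := h.pos (lam n)
    rw [div_le_iff₀ hn]
    calc (n : ℝ) * ‖∫ x, cut (δ * lam n) x ∂ν‖ ≤ n * (C * (δ * lam n * tailMass ν (δ * lam n))) := by
          gcongr
      _ = _ := by field_simp

lemma eventually_neg_log_nonneg {w : ℕ → ℝ} (hw : Tendsto w atTop (𝓝 0)) (h0 : ∀ n, 0 ≤ w n) :
    ∀ᶠ n in atTop, 0 ≤ -Real.log (w n) := by
  filter_upwards [hw.eventually (ge_mem_nhds one_pos)] with n hn
  linarith [Real.log_nonpos (h0 n) hn]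

lemma RegTail.tendsto_zero {T : ℝ → ℝ} (h : RegTail T α) (hα : 0 < α) : Tendsto T atTop (𝓝 0) := by
  obtain ⟨t₀, C, h1, hC, hb⟩ := h.le_exists_rpow (half_lt_self hα) (half_pos hα).le
  have hlim := (tendsto_rpow_neg_atTop (half_pos hα)).const_mul C
  rw [mul_zero] at hlim
  exact squeeze_zero' (Eventually.of_forall fun t => (h.pos t).le)
    ((eventually_ge_atTop t₀).mono fun t ht => hb t ht) hlim

lemma MuchLess.eventually_le {u v : ℕ → ℝ} (h : MuchLess u v) (hv : ∀ n, 0 < v n) {K : ℝ}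
    (hK : 0 < K) : ∀ᶠ n in atTop, K * u n ≤ v n := by
  filter_upwards [Tendsto.eventually h (ge_mem_nhds (inv_pos.2 hK))] with n hn
  rw [div_le_iff₀ (hv n), inv_mul_eq_div, le_div_iff₀ hK] at hn
  linarith

lemma RegTail.quantile_tendsto {T : ℝ → ℝ} (h : RegTail T α) (hα : 0 < α) :
    Tendsto (fun n : ℕ => sInf {x : ℝ | T x ≤ (n : ℝ)⁻¹}) atTop atTop := by
  rw [tendsto_atTop]
  intro R
  have h0 := tendsto_inv_atTop_nhds_zero_nat (𝕜 := ℝ)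
  filter_upwards [h0.eventually (gt_mem_nhds (h.pos R)), eventually_gt_atTop 0] with n hn hn0
  have hne : {x : ℝ | T x ≤ (n : ℝ)⁻¹}.Nonempty :=
    ((h.tendsto_zero hα).eventually (ge_mem_nhds (by positivity : (0 : ℝ) < (n : ℝ)⁻¹))).exists
  refine le_csInf hne fun x hx => ?_
  by_contra! hlt
  have : T R ≤ T x := h.anti hlt.le
  exact absurd (this.trans hx) (not_le.2 hn)

lemma RegTail.tail_at_quantile {T : ℝ → ℝ} (h : RegTail T α) (hα : 0 < α) {n : ℕ} (hn : 0 < n)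
    {x : ℝ} (hx : sInf {x : ℝ | T x ≤ (n : ℝ)⁻¹} < x) : T x ≤ (n : ℝ)⁻¹ := by
  have hne : {x : ℝ | T x ≤ (n : ℝ)⁻¹}.Nonempty :=
    ((h.tendsto_zero hα).eventually (ge_mem_nhds (by positivity : (0 : ℝ) < (n : ℝ)⁻¹))).exists
  obtain ⟨y, hy, hyx⟩ := exists_lt_of_csInf_lt hne hx
  exact (h.anti hyx.le).trans hy

/-- The comparison is made at $2b_n$, not $b_n$: being strictly above the infimum it satisfies
$nT(2b_n)\le1$ without any right-continuity. Then $\lambda_n\ge 2Kb_n$ gives a limit superior of at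
most $K^{-\alpha}$. -/
lemma RegTail.mul_tail_tendsto {T : ℝ → ℝ} (h : RegTail T α) (hα : 0 < α) {lam : ℕ → ℝ}
    (hpos : ∀ n, 0 < lam n)
    (hb : MuchLess (fun n : ℕ => sInf {x : ℝ | T x ≤ (n : ℝ)⁻¹}) lam) :
    Tendsto (fun n : ℕ => n * T (lam n)) atTop (𝓝 0) := by
  set b : ℕ → ℝ := fun n => sInf {x : ℝ | T x ≤ (n : ℝ)⁻¹} with hbdef
  have hb2 : Tendsto (fun n => 2 * b n) atTop atTop :=
    (h.quantile_tendsto hα).const_mul_atTop two_pos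
  rw [tendsto_order]
  constructor
  · intro a ha
    filter_upwards with n
    have := h.pos (lam n)
    exact ha.trans_le (by positivity)
  · intro a ha
    have hk := (tendsto_rpow_neg_atTop hα).eventually (gt_mem_nhds ha)
    obtain ⟨K, hK, hK0⟩ := (hk.and (eventually_gt_atTop 0)).exists
    filter_upwards [((h.ratio K hK0).comp hb2).eventually (gt_mem_nhds hK),
      hb.eventually_le hpos (by positivity : 0 < 2 * K), eventually_gt_atTop 0,
      hb2.eventually_gt_atTop 0] with n h1 h2 hn hbn
    refine lt_of_le_of_lt ?_ h1
    have hT2 := h.pos (2 * b n)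
    have hn' : (0 : ℝ) < n := by exact_mod_cast hn
    have h3 : T (2 * b n) ≤ (n : ℝ)⁻¹ := h.tail_at_quantile hα hn (x := 2 * b n) (by
      change b n < 2 * b n
      linarith)
    simp only [Function.comp]
    rw [le_div_iff₀ hT2]
    have h4 : T (lam n) ≤ T (K * (2 * b n)) := h.anti (by linarith)
    have h5 : n * T (2 * b n) ≤ 1 := by
      calc n * T (2 * b n) ≤ n * (n : ℝ)⁻¹ := by gcongr
        _ = 1 := mul_inv_cancel₀ hn'.ne'
    have h6 := h.pos (lam n)
    nlinarith

section

variable [IsFiniteMeasure ν]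

/-- Karamata gives a truncated second moment of order $\lambda^2T(\lambda)$, so the variance
condition reduces to $-w\log w\to0$. -/
lemma RegTail.ldScale_of_lt_two (h : RegTail (tailMass ν) α) (hα : 0 < α) (hα2 : α < 2)
    (hc : CutMeanBound ν) {lam : ℕ → ℝ} (hpos : ∀ n, 0 < lam n)
    (hb : MuchLess (fun n : ℕ => sInf {x : ℝ | tailMass ν x ≤ (n : ℝ)⁻¹}) lam) :
    LDScale ν lam := by
  have htail := h.mul_tail_tendsto hα hpos hb
  have hscale : Tendsto lam atTop atTop := by
    refine tendsto_atTop_mono' _ ?_ (h.quantile_tendsto hα)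
    filter_upwards [hb.eventually_le hpos one_pos] with n hn
    simpa using hn
  refine LDScale.of_cutMeanBound h hc hscale htail ?_
  obtain ⟨t₀, C, h1, hC, hbd⟩ := h.truncated_moment_le hα2 two_pos
  have hlim := ((Real.continuous_negMulLog.tendsto 0).comp htail).const_mul C
  rw [Real.negMulLog_zero, mul_zero] at hlim
  have hw0 : ∀ n : ℕ, 0 ≤ n * tailMass ν (lam n) := fun n => by
    have := h.pos (lam n); positivity
  have hq := eventually_neg_log_nonneg htail hw0
  refine squeeze_zero' ?_ ?_ hlim
  · filter_upwards [hq] with n hn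
    have := truncSq_nonneg ν (lam n)
    positivity
  · filter_upwards [hq, hscale.eventually_ge_atTop t₀] with n hn hlam
    have hl := hpos n
    have hV : truncSq ν (lam n) ≤ C * (lam n ^ (2 : ℝ) * tailMass ν (lam n)) := hbd _ hlam
    rw [Real.rpow_two] at hV
    rw [div_le_iff₀ (by positivity)]
    calc (n : ℝ) * -Real.log (n * tailMass ν (lam n)) * truncSq ν (lam n)
        ≤ n * -Real.log (n * tailMass ν (lam n)) * (C * (lam n ^ 2 * tailMass ν (lam n))) := by gcongr
      _ = _ := by simp only [Function.comp, Real.negMulLog]; ring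

/-- A substitute for a finite second moment, needed at index $2$ where the variance may be infinite;
$\kappa=0$ gives the usual bound. -/
lemma truncSq_le_rpow {κ : ℝ} (hκ0 : 0 ≤ κ) (hκ2 : κ ≤ 2) {t : ℝ} (ht : 0 < t)
    (hi : Integrable (fun x : E d => ‖x‖ ^ (2 - κ)) ν) :
    truncSq ν t ≤ t ^ κ * ∫ x, ‖x‖ ^ (2 - κ) ∂ν := by
  calc truncSq ν t ≤ ∫ x in {x : E d | ‖x‖ ≤ t}, t ^ κ * ‖x‖ ^ (2 - κ) ∂ν := by
        refine setIntegral_mono_on (integrableOn_norm_rpow two_pos.le t)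
          (hi.const_mul _).integrableOn (measurableSet_normLe t) fun x hx => ?_
        have e : (2 : ℝ) = κ + (2 - κ) := by ring
        conv_lhs => rw [e]
        rw [Real.rpow_add_of_nonneg (norm_nonneg _) hκ0 (by linarith)]
        gcongr
        exact hx
    _ = t ^ κ * ∫ x in {x : E d | ‖x‖ ≤ t}, ‖x‖ ^ (2 - κ) ∂ν := integral_const_mul _ _
    _ ≤ t ^ κ * ∫ x, ‖x‖ ^ (2 - κ) ∂ν := by
        gcongr
        · exact ae_of_all _ fun x => by positivity
        · exact Measure.restrict_le_self

lemma RegTail.ldScale_of_eq_two (h : RegTail (tailMass ν) 2) (hc : CutMeanBound ν) {γ : ℝ}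
    (hγ : 0 < γ) {lam : ℕ → ℝ} (hpos : ∀ n, 0 < lam n)
    (hb : MuchLess (fun n : ℕ => √((n : ℝ) ^ (1 + γ))) lam) : LDScale ν lam := by
  have hle : ∀ᶠ n : ℕ in atTop, √((n : ℝ) ^ (1 + γ)) ≤ lam n := by
    filter_upwards [hb.eventually_le hpos one_pos] with n hn
    simpa using hn
  have hscale : Tendsto lam atTop atTop := by
    refine tendsto_atTop_mono' _ hle ?_
    exact Real.tendsto_sqrt_atTop.comp
      ((tendsto_rpow_atTop (by linarith : 0 < 1 + γ)).comp tendsto_natCast_atTop_atTop)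
  -- From $\lambda_n\ge n^{(1+\gamma)/2}$ one gets
  -- $n\le\lambda_n^{2/(1+\gamma)}=\lambda_n^{2-2\kappa}$. One $\kappa$ pays for the tail or the
  -- truncated variance; the other beats the logarithm.
  set κ := γ / (1 + γ) with hκ
  have hκ0 : 0 < κ := by positivity
  have hκ1 : κ < 1 := by rw [hκ, div_lt_one (by linarith)]; linarith
  have hn_le : ∀ᶠ n : ℕ in atTop, (n : ℝ) ≤ lam n ^ (2 - 2 * κ) := by
    filter_upwards [hle] with n hn
    have hl := hpos n
    rw [Real.sqrt_le_left hl.le] at hn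
    have h1 : ((n : ℝ) ^ (1 + γ)) ^ (1 + γ)⁻¹ ≤ (lam n ^ 2) ^ (1 + γ)⁻¹ := by gcongr
    rw [← Real.rpow_mul (by positivity), mul_inv_cancel₀ (by linarith), Real.rpow_one,
      ← Real.rpow_natCast, ← Real.rpow_mul hl.le] at h1
    have e : ((2 : ℕ) : ℝ) * (1 + γ)⁻¹ = 2 - 2 * κ := by
      rw [hκ]; push_cast; field_simp; ring
    rwa [e] at h1
  have htail : Tendsto (fun n : ℕ => n * tailMass ν (lam n)) atTop (𝓝 0) := by
    obtain ⟨t₀, C, h1, hC, hbd⟩ := h.le_exists_rpow (β := 2 - κ) (by linarith) (by linarith)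
    have hlim := ((tendsto_rpow_neg_atTop hκ0).comp hscale).const_mul C
    rw [mul_zero] at hlim
    refine squeeze_zero' (Eventually.of_forall fun n => ?_) ?_ hlim
    · have := h.pos (lam n); positivity
    · filter_upwards [hn_le, hscale.eventually_ge_atTop t₀] with n hn hl
      have h0 := hpos n
      have hT := h.pos (lam n)
      calc (n : ℝ) * tailMass ν (lam n) ≤ lam n ^ (2 - 2 * κ) * (C * lam n ^ (-(2 - κ))) := by
            gcongr
            exact hbd _ hl
        _ = C * (lam n ^ (2 - 2 * κ) * lam n ^ (-(2 - κ))) := by ring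
        _ = C * lam n ^ (-κ) := by rw [← Real.rpow_add h0]; ring_nf
  refine LDScale.of_cutMeanBound h hc hscale htail ?_
  have hi : Integrable (fun x : E d => ‖x‖ ^ (2 - κ)) ν :=
    h.integrable_norm_rpow (by linarith) (by linarith)
  set D := ∫ x, ‖x‖ ^ (2 - κ) ∂ν with hD
  have hD0 : 0 ≤ D := integral_nonneg fun x => by positivity
  have hw0 : ∀ n : ℕ, 0 ≤ n * tailMass ν (lam n) := fun n => by
    have := h.pos (lam n); positivity
  have hq := eventually_neg_log_nonneg htail hw0
  have hlim : Tendsto (fun n => 4 * D * (Real.log (lam n) / lam n ^ κ)) atTop (𝓝 0) := by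
    have := ((isLittleO_log_rpow_atTop hκ0).tendsto_div_nhds_zero.comp hscale).const_mul (4 * D)
    rw [mul_zero] at this
    exact this
  refine squeeze_zero' ?_ ?_ hlim
  · filter_upwards [hq] with n hn
    have := truncSq_nonneg ν (lam n)
    positivity
  · filter_upwards [hq, hn_le, h.neg_log_le two_pos hscale, hscale.eventually_ge_atTop 1]
      with n hqn hn hlog hl1
    have h0 := hpos n
    have hV := truncSq_le_rpow hκ0.le (by linarith) h0 hi
    have hV0 := truncSq_nonneg ν (lam n)
    have hlog0 := Real.log_nonneg hl1
    rw [div_le_iff₀ (by positivity)]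
    calc (n : ℝ) * -Real.log (n * tailMass ν (lam n)) * truncSq ν (lam n)
        ≤ lam n ^ (2 - 2 * κ) * ((2 + 2) * Real.log (lam n)) * (lam n ^ κ * D) := by gcongr
      _ = 4 * D * Real.log (lam n) * (lam n ^ (2 - 2 * κ) * lam n ^ κ) := by ring
      _ = 4 * D * Real.log (lam n) * (lam n ^ (2 : ℝ) / lam n ^ κ) := by
          rw [← Real.rpow_add h0, ← Real.rpow_sub h0]; ring_nf
      _ = _ := by rw [Real.rpow_two]; ring

/-- The second moment is finite, so the variance condition reduces to
$n\log\lambda_n/\lambda_n^2\to0$. -/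
lemma RegTail.ldScale_of_two_lt (h : RegTail (tailMass ν) α) (hα : 2 < α) (hc : CutMeanBound ν)
    {lam : ℕ → ℝ} (hpos : ∀ n, 0 < lam n)
    (hb : MuchLess (fun n : ℕ => √((n : ℝ) * Real.log n)) lam) : LDScale ν lam := by
  have hsq : Tendsto (fun n : ℕ => n * Real.log n / lam n ^ 2) atTop (𝓝 0) := by
    have := Tendsto.pow hb 2
    rw [zero_pow two_ne_zero] at this
    refine this.congr' ?_
    filter_upwards [eventually_ge_atTop 1] with n hn
    have hn' : (1 : ℝ) ≤ n := by exact_mod_cast hn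
    rw [div_pow, Real.sq_sqrt (mul_nonneg (by linarith) (Real.log_nonneg hn'))]
  have hlogn : ∀ᶠ n : ℕ in atTop, 1 ≤ Real.log (n : ℝ) :=
    (Real.tendsto_log_atTop.comp tendsto_natCast_atTop_atTop).eventually_ge_atTop 1
  have hn2 : Tendsto (fun n : ℕ => (n : ℝ) / lam n ^ 2) atTop (𝓝 0) := by
    refine squeeze_zero' (Eventually.of_forall fun n => by positivity) ?_ hsq
    filter_upwards [hlogn] with n hn
    gcongr
    exact le_mul_of_one_le_right (by positivity) hn
  have hu : Tendsto (fun n : ℕ => lam n ^ 2 / n) atTop atTop := by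
    have h1 : Tendsto (fun n : ℕ => (n : ℝ) / lam n ^ 2) atTop (𝓝[>] 0) := by
      refine tendsto_nhdsWithin_iff.2 ⟨hn2, ?_⟩
      filter_upwards [eventually_gt_atTop 0] with n hn
      have := hpos n
      have hn' : (0 : ℝ) < n := by exact_mod_cast hn
      exact div_pos hn' (by positivity)
    refine (tendsto_inv_nhdsGT_zero.comp h1).congr fun n => ?_
    simp
  have hscale : Tendsto lam atTop atTop := by
    refine tendsto_atTop_mono' _ ?_ (Real.tendsto_sqrt_atTop.comp tendsto_natCast_atTop_atTop)
    filter_upwards [hb.eventually_le hpos one_pos, hlogn] with n hn hl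
    refine le_trans (Real.sqrt_le_sqrt ?_) ((one_mul _).symm.le.trans hn)
    exact le_mul_of_one_le_right (by positivity) hl
  have htail : Tendsto (fun n : ℕ => n * tailMass ν (lam n)) atTop (𝓝 0) := by
    obtain ⟨t₀, C, h1, hC, hbd⟩ := h.le_exists_rpow hα two_pos.le
    have hlim := hn2.const_mul C
    rw [mul_zero] at hlim
    refine squeeze_zero' (Eventually.of_forall fun n => ?_) ?_ hlim
    · have := h.pos (lam n); positivity
    · filter_upwards [hscale.eventually_ge_atTop t₀] with n hl
      have h0 := hpos n
      have h2 := hbd _ hl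
      rw [Real.rpow_neg h0.le, Real.rpow_two] at h2
      calc (n : ℝ) * tailMass ν (lam n) ≤ n * (C * (lam n ^ 2)⁻¹) := by gcongr
        _ = _ := by ring
  refine LDScale.of_cutMeanBound h hc hscale htail ?_
  have hi : Integrable (fun x : E d => ‖x‖ ^ (2 - (0 : ℝ))) ν :=
    h.integrable_norm_rpow (by linarith) (by linarith)
  set D := ∫ x, ‖x‖ ^ (2 - (0 : ℝ)) ∂ν with hD
  have hD0 : 0 ≤ D := integral_nonneg fun x => by positivity
  have hw0 : ∀ n : ℕ, 0 ≤ n * tailMass ν (lam n) := fun n => by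
    have := h.pos (lam n); positivity
  have hq := eventually_neg_log_nonneg htail hw0
  have hlogu : Tendsto (fun n : ℕ => Real.log (lam n ^ 2 / n) / (lam n ^ 2 / n)) atTop (𝓝 0) :=
    Real.isLittleO_log_id_atTop.tendsto_div_nhds_zero.comp hu
  have hlim := (hsq.add hlogu).const_mul ((α + 2) * D / 2)
  rw [add_zero, mul_zero] at hlim
  refine squeeze_zero' ?_ ?_ hlim
  · filter_upwards [hq] with n hn
    have := truncSq_nonneg ν (lam n)
    positivity
  · filter_upwards [hq, h.neg_log_le (by linarith) hscale, hscale.eventually_ge_atTop 1,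
      eventually_gt_atTop 0] with n hqn hlog hl1 hn0
    have h0 := hpos n
    have hn' : (0 : ℝ) < n := by exact_mod_cast hn0
    have hV := truncSq_le_rpow le_rfl two_pos.le h0 hi
    rw [Real.rpow_zero, one_mul] at hV
    have hV0 := truncSq_nonneg ν (lam n)
    have hlog0 := Real.log_nonneg hl1
    -- Because $\lambda_n$ may far exceed every power of $n$, $\log\lambda_n$ is split: $n\log
    -- n/\lambda_n^2\to0$ by hypothesis, and the rest is $\log u/u$ with $u=\lambda_n^2/n\to\infty$.
    have e : Real.log (lam n) = (Real.log n + Real.log (lam n ^ 2 / n)) / 2 := by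
      rw [Real.log_div (by positivity) hn'.ne', Real.log_pow]; push_cast; ring
    have hα0 : 0 < α + 2 := by linarith
    rw [div_le_iff₀ (by positivity)]
    calc (n : ℝ) * -Real.log (n * tailMass ν (lam n)) * truncSq ν (lam n)
        ≤ n * ((α + 2) * Real.log (lam n)) * D := by gcongr
      _ = _ := by rw [e]; field_simp

end

end TruncLD

/-! ### Translation of the hypotheses and proof of the theorem. -/

namespace TruncLD

variable {d : ℕ}

lemma integral_smul_comp {Ω : Type*} [MeasurableSpace Ω] {P : Measure Ω} {X : Ω → E d}
    (hX : Measurable X) {g : E d → ℝ} (hg : IsTest g) (c : ℝ≥0∞) (t : ℝ) :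
    ∫ x, g x ∂(c • P.map fun ω => t⁻¹ • X ω) = c.toReal * ∫ ω, g (t⁻¹ • X ω) ∂P := by
  have hm : Measurable fun ω => t⁻¹ • X ω := (measurable_const_smul t⁻¹).comp hX
  rw [integral_smul_measure, smul_eq_mul,
    integral_map hm.aemeasurable hg.continuous.aestronglyMeasurable]

lemma regVarAlong_of_vagueTendsto {Ω : Type*} [MeasurableSpace Ω] {P : Measure Ω} {H : Ω → E d}
    (hH : Measurable H) {a : ℕ → ℝ} (ha : Tendsto a atTop atTop) {μ : Measure (E d)}
    (hμR : IsFiniteMeasureOnCompacts (toExt μ))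
    (hreg : VagueTendsto (fun n => toExt ((n : ℝ≥0∞) • P.map (fun ω => (a n)⁻¹ • H ω))) (toExt μ)) :
    RegVarAlong (P.map H) μ a := by
  refine ⟨ha, fun r hr => toExt_isFiniteMeasureOnCompacts_tail hr, fun g hg => ?_⟩
  have h1 := (vagueTendsto_toExt_iff _ _).1 hreg g hg
  refine h1.congr fun n => ?_
  rw [integral_smul_comp hH hg, ENNReal.toReal_natCast, dilInt, integral_map hH.aemeasurable]
  exact (hg.continuous.comp (continuous_const_smul _)).aestronglyMeasurable

lemma tailMass_map {Ω : Type*} [MeasurableSpace Ω] {P : Measure Ω} {H : Ω → E d}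
    (hH : Measurable H) (t : ℝ) : tailMass (P.map H) t = P.real {ω | t < ‖H ω‖} := by
  rw [tailMass, map_measureReal_apply hH (measurableSet_normGt t)]
  rfl

/-- The admissible scales of the theorem, in each of the three ranges of the index. -/
lemma RegTail.ldScale_of_bSeq {Ω : Type*} [MeasurableSpace Ω] {P : Measure Ω} [IsProbabilityMeasure P]
    {H : Ω → E d} (hH : Measurable H) {α γ : ℝ} (hα : 0 < α)
    (h : RegTail (tailMass (P.map H)) α)
    (hsym : α = 1 → IdentDistrib (fun ω => -H ω) H P P)
    (hcen : 1 < α → ∫ ω, H ω ∂P = 0) (hγ : α = 2 → 0 < γ) {lam : ℕ → ℝ} (hpos : ∀ n, 0 < lam n)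
    (hb : MuchLess (bSeq P H α γ) lam) : LDScale (P.map H) lam := by
  have := Measure.isProbabilityMeasure_map (μ := P) hH.aemeasurable
  have hc : CutMeanBound (P.map H) := by
    rcases lt_trichotomy α 1 with h1 | h1 | h1
    · exact h.cutMeanBound_of_lt_one h1
    · refine h.cutMeanBound_of_symm ?_
      rw [Measure.map_map measurable_neg hH]
      exact (hsym h1).map_eq
    · refine h.cutMeanBound_of_centered h1 ?_
      exact (integral_map hH.aemeasurable measurable_id.aestronglyMeasurable).trans (hcen h1)
  rcases lt_trichotomy α 2 with h2 | h2 | h2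
  · refine h.ldScale_of_lt_two hα h2 hc hpos ?_
    have e : (fun n : ℕ => sInf {x : ℝ | tailMass (P.map H) x ≤ (n : ℝ)⁻¹}) = bSeq P H α γ := by
      funext n
      simp only [bSeq, if_pos h2, tailMass_map hH]
    rwa [e]
  · subst h2
    refine h.ldScale_of_eq_two hc (hγ rfl) hpos ?_
    have e : (fun n : ℕ => √((n : ℝ) ^ (1 + γ))) = bSeq P H 2 γ := by
      funext n
      simp only [bSeq, lt_irrefl, if_false, if_true]
    rwa [e]
  · refine h.ldScale_of_two_lt h2 hc hpos ?_
    have e : (fun n : ℕ => √((n : ℝ) * Real.log n)) = bSeq P H α γ := by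
      funext n
      simp only [bSeq, if_neg h2.not_gt, if_neg h2.ne']
    rwa [e]

end TruncLD

theorem theorem2p1 {d : ℕ} {Ω : Type*} [MeasurableSpace Ω]
    (P : Measure Ω) [IsProbabilityMeasure P]
    -- the heavy-tailed vector `H`, its scaling sequence and its limit measure on `ℝ^d \ {0}`
    (H : Ω → TruncLD.E d) (hH : Measurable H)
    (a : ℕ → ℝ) (ha : Tendsto a atTop atTop)
    (μ : Measure (TruncLD.E d)) (hμ : μ ≠ 0) (hμ0 : μ {0} = 0)
    (hμR : IsFiniteMeasureOnCompacts (TruncLD.toExt μ))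
    (hreg : TruncLD.VagueTendsto
      (fun n => TruncLD.toExt ((n : ℝ≥0∞) • P.map (fun ω => (a n)⁻¹ • H ω)))
      (TruncLD.toExt μ))
    -- the i.i.d. copies of `H` and the i.i.d. modifications
    (Hs : ℕ → Ω → TruncLD.E d) (hHs : ∀ j, Measurable (Hs j))
    (hHs_law : ∀ j, IdentDistrib (Hs j) H P P) (hHs_ind : iIndepFun Hs P)
    (L : ℕ → Ω → ℝ) (hL : ∀ j, Measurable (L j)) (hL_nonneg : ∀ j ω, 0 ≤ L j ω)
    (hL_law : ∀ j, IdentDistrib (L j) (L 0) P P) (hL_ind : iIndepFun L P)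
    (hHL : IndepFun (fun ω j => Hs j ω) (fun ω j => L j ω) P)
    -- truncation levels in the soft regime
    (M : ℕ → ℝ) (hM_pos : ∀ n, 0 < M n) (hM : Tendsto M atTop atTop)
    (hsoft : Tendsto (fun n : ℕ => (n : ℝ) * P.real {ω | M n < ‖H ω‖}) atTop (𝓝 0)) :
    (∃! α : ℝ, TruncLD.IsIndex μ α) ∧
    ∀ α γ : ℝ, TruncLD.IsIndex μ α →
      (α = 1 → IdentDistrib (fun ω => -H ω) H P P) →
      (1 < α → ∫ ω, H ω ∂P = 0) →
      (α = 2 → 0 < γ ∧ Tendsto (fun n : ℕ => M n / √((n : ℝ) ^ (1 + γ))) atTop atTop) →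
      (2 < α → Tendsto (fun n : ℕ => M n / √((n : ℝ) * Real.log (M n))) atTop atTop) →
      ∀ lam : ℕ → ℝ, (∀ n, 0 < lam n) →
        TruncLD.MuchLess (TruncLD.bSeq P H α γ) lam → TruncLD.MuchLess lam M →
        TruncLD.VagueTendsto
          (fun n => TruncLD.toExt (((n : ℝ≥0∞) * P {ω | lam n < ‖H ω‖})⁻¹ •
            P.map (fun ω => (lam n)⁻¹ • TruncLD.rowSum M Hs L n ω)))
          (TruncLD.toExt ((μ (Metric.closedBall 0 1)ᶜ)⁻¹ • μ)) := by
  have := Measure.isProbabilityMeasure_map (μ := P) hH.aemeasurable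
  have hRV := TruncLD.regVarAlong_of_vagueTendsto hH ha hμR hreg
  obtain ⟨α₀, hα₀, hs⟩ := hRV.exists_scales hμ hμ0
  have hidx := TruncLD.isIndex_of_scales hRV.fin hμ0 hα₀ hs
  refine ⟨⟨α₀, hidx, fun β hβ => hβ.unique hRV.fin hμ hμ0 hidx⟩, ?_⟩
  intro α γ hα hsym hcen htwo _ lam hlam hblam hlamM
  -- By uniqueness, the given index is the one for which homogeneity against test functions was
  -- established.
  obtain rfl : α = α₀ := hα.unique hRV.fin hμ hμ0 hidx
  have hR := hRV.regVar hμ hμ0 hα₀ hs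
  have hScale := hR.regTail.ldScale_of_bSeq hH hα₀ hsym hcen (fun h => (htwo h).1) hlam hblam
  have hI : TruncLD.IsIID P Hs (P.map H) := ⟨hHs, fun j => (hHs_law j).map_eq, hHs_ind⟩
  have hMlam : Tendsto (fun n => M n / lam n) atTop atTop := by
    have h1 : Tendsto (fun n => lam n / M n) atTop (𝓝[>] 0) := tendsto_nhdsWithin_iff.2
      ⟨hlamM, Eventually.of_forall fun n => div_pos (hlam n) (hM_pos n)⟩
    exact (tendsto_inv_nhdsGT_zero.comp h1).congr fun n => by simp
  rw [TruncLD.vagueTendsto_toExt_iff]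
  intro g hg
  have hlim := hScale.rowSum_tendsto hα₀ hR hI hL hMlam hg
  have e : ∫ x, g x ∂((μ (Metric.closedBall 0 1)ᶜ)⁻¹ • μ) =
      (∫ x, g x ∂μ) / TruncLD.tailMass μ 1 := by
    have hset : (Metric.closedBall (0 : TruncLD.E d) 1)ᶜ = {x | 1 < ‖x‖} := by
      ext x; simp
    rw [integral_smul_measure, hset, ENNReal.toReal_inv, smul_eq_mul, inv_mul_eq_div]
    rfl
  rw [e]
  refine hlim.congr fun n => ?_
  rw [TruncLD.integral_smul_comp (TruncLD.measurable_rowSum hHs hL n) hg, ENNReal.toReal_inv,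
    ENNReal.toReal_mul, ENNReal.toReal_natCast, inv_mul_eq_div, TruncLD.tailMass_map hH]
  rfl
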